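/- Let $K$ be a field and let $q,s\in K$ be nonzero with no multiplicative relation: $q^as^b=1$ with $a,b\in\mathbb Z$ only for $a=b=0$ (for instance $K=\mathbb C(q,s)$). Let $N\ge 1$ and let $\lambda$ be a partition of $N$. All operators act on the right, so in a product the leftmost factor is applied first. **Tableaux.** The shape $\lambda$ is drawn with its longest row at the bottom (row 1). $\mathrm{Tab}_\lambda$ is the set of reverse standard tableaux: fillings of $\lambda$ by $1,\dots,N$, each used once, strictly decreasing along rows (left to right) and columns (bottom to top). $\mathrm{ROW}_{\mathbb T}[i]$ and $\mathrm{COL}_{\mathbb T}[i]$ are the row and column of the entry $i$ in $\mathbb T$, $\mathrm{CT}_{\mathbb T}[i]=\mathrm{COL}_{\mathbb T}[i]-\mathrm{ROW}_{\mathbb T}[i]$ is its content, and $\mathbb T^{(i,j)}$ is $\mathbb T$ with the entries $i,j$ exchanged. $\mathbb T_\lambda$ is obtained by writing $N,N-1,\dots,1$ column by column from left to right, each column from bottom to top. **Operators.** $V_\lambda$ is the $K$-vector space with basis $\mathrm{Tab}_\lambda$. For $1\le i<N$ the operator $T_i$ acts on it as follows. If $i,i+1$ are in the same row of $\mathbb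 T$, then $\mathbb T T_i=s\mathbb T$; if they are in the same column, then $\mathbb T T_i=-\mathbb T$. Otherwise put $m=\mathrm{CT}_{\mathbb T}[i+1]-\mathrm{CT}_{\mathbb T}[i]$; then $$\mathbb T T_i=\mathbb T^{(i,i+1)}-\frac{1-s}{1-s^m}\mathbb T\quad\text{if }\mathrm{ROW}_{\mathbb T}[i]<\mathrm{ROW}_{\mathbb T}[i+1],$$ $$\mathbb T T_i=\frac{s-1}{1-s^m}\mathbb T+\frac{s(1-s^{m+1})(1-s^{m-1})}{(1-s^m)^2}\mathbb T^{(i,i+1)}\quad\text{if }\mathrm{ROW}_{\mathbb T}[i]>\mathrm{ROW}_{\mathbb T}[i+1].$$ On $K[x_1,\dots,x_N]$ let $s_i^x$ exchange $x_i$ and $x_{i+1}$, let $\tau_1^x$ substitute $qx_1$ for $x_1$, and let $f\delta_i^x=(1-s)\,x_{i+1}\,\dfrac{f-fs_i^x}{x_i-x_{i+1}}$. On $\mathcal M_\lambda=K[x_1,\dots,x_N]\otimes V_\lambda$ put $$\mathbf T_i=\delta_i^x+s_i^xT_i,\qquad \mathbf T_i^{-1}=\tfrac1s(\mathbf T_i+1-s),\qquad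 \mathbf w=\tau_1^x s_1^x\cdots s_{N-1}^x\,T_1\cdots T_{N-1},$$ $$\boldsymbol\xi_i=s^{i-N}\mathbf T_{i-1}^{-1}\cdots\mathbf T_1^{-1}\,\mathbf w\,\mathbf T_{N-1}\cdots\mathbf T_i\ (1\le i\le N),\qquad \boldsymbol\Phi=\mathbf T_1^{-1}\cdots\mathbf T_{N-1}^{-1}x_N .$$ **Graph.** On 4-tuples $(\mathbb T,\zeta,v,\sigma)$ with $\mathbb T\in\mathrm{Tab}_\lambda$, $\zeta\in K^N$, $v\in\mathbb N^N$, $\sigma\in\mathfrak S_N$ (written as a word), let $(\mathbb T,\zeta,v,\sigma)s_i$ be - $(\mathbb T,\zeta s_i,vs_i,\sigma s_i)$ if $v[i]\ne v[i+1]$, where $s_i$ exchanges the places $i$ and $i+1$; - $(\mathbb T^{(\sigma[i],\sigma[i+1])},\zeta s_i,v,\sigma)$ if $v[i]=v[i+1]$ and $\mathbb T^{(\sigma[i],\sigma[i+1])}\in\mathrm{Tab}_\lambda$; - $(\mathbb T,\zeta,v,\sigma)$ otherwise. Let also $$(\mathbb T,\zeta,v,\sigma)\Psi=(\mathbb T,[\zeta[2],\dots,\zeta[N],q\zeta[1]],[v[2],\dots,v[N],v[1]+1],[\sigma[2],\dots,\sigma[N],\sigma[1]]).$$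 The Yang–Baxter graph $G_\lambda^{q,s}$ starts at the root $(\mathbb T_\lambda,[s^{\mathrm{CT}_{\mathbb T_\lambda}[i]}]_i,0^N,[1,\dots,N])$ and has the following arrows. From each vertex $A=(\mathbb T,\zeta,v,\sigma)$ there is an arrow $\Psi$ to $A\Psi$. There is an arrow $s_i$ to $As_i$ if $v[i]<v[i+1]$, and also if $v[i]=v[i+1]$ and the tableau of $As_i$ is $\mathbb T^{(k,l)}$ for some $k<l$ with $\mathrm{CT}_{\mathbb T}[k]\ge\mathrm{CT}_{\mathbb T}[l]+2$. If $As_i=A$, there is an arrow $s_i$ to an extra vertex $\emptyset$, called a fall. No arrow starts at $\emptyset$. A path is a finite (possibly empty) sequence of consecutive arrows starting at the root, given by its labels. **Polynomials.** Set $P_{[]}=\mathbb T_\lambda$, $P_{[a_1,\dots,a_k,\Psi]}=P_{[a_1,\dots,a_k]}\boldsymbol\Phi$ and $$P_{[a_1,\dots,a_k,s_i]}=P_{[a_1,\dots,a_k]}\Bigl(\mathbf T_i+\frac{1-s}{1-\zeta[i+1]/\zeta[i]}\Bigr),$$ where $\zeta$ is the second component of the root acted on by $a_1\cdots a_k$.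 **Theorem.** 1. If $\mathcal P$ is a path without fall from the root to $(\mathbb T,\zeta,v,\sigma)$, then $P_{\mathcal P}\neq0$ and $P_{\mathcal P}\boldsymbol\xi_i=\zeta[i]P_{\mathcal P}$ for $1\le i\le N$. 2. $P_{\mathcal P}$ depends only on the end point of $\mathcal P$, and indeed only on its spectral vector $\zeta$: two paths without fall whose end points have the same $\zeta$ give the same polynomial. 3. For all $v\in\mathbb N^N$ and $\mathbb T\in\mathrm{Tab}_\lambda$ there is exactly one vertex $(\mathbb T,\zeta,v,\sigma)$ of $G_\lambda^{q,s}$ with these $\mathbb T$ and $v$. Let $P_{v,\mathbb T}$ be the polynomial of any path without fall ending there. The family $(P_{v,\mathbb T})_{v\in\mathbb N^N,\,\mathbb T\in\mathrm{Tab}_\lambda}$ is a $K$-basis of $\mathcal M_\lambda$, and it consists of simultaneous eigenfunctions of the $\boldsymbol\xi_i$, with $P_{v,\mathbb T}\boldsymbol\xi_i=\zeta[i]P_{v,\mathbb T}$. -/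

import Mathlib

open scoped TensorProduct

noncomputable section

namespace VVMacdonald

/-! Positions `1, …, N` are represented by `Fin N` (the index `i` is the element of value
`i - 1`), `N = n + 1`, and the generators with index `1, …, N - 1` by `Fin n`: the generator `i`
involves the positions `i.castSucc` and `i.succ`. All operators act on the right. -/

/-! ### Reverse standard tableaux -/

/-- A filling of the shape `μ` with the integers `1, …, N`, each used once; `f i` is the cell
`(row, column)` of the entry `i`. Row `0` is the longest row of the shape. -/
abbrev Filling (μ : YoungDiagram) (N : ℕ) := Fin N ≃ {c : ℕ × ℕ // c ∈ μ.cells}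

section Tableaux
variable {μ : YoungDiagram} {N : ℕ}

/-- The row of the entry `i`. -/
def row (f : Filling μ N) (i : Fin N) : ℕ := (f i).1.1

/-- The column of the entry `i`. -/
def col (f : Filling μ N) (i : Fin N) : ℕ := (f i).1.2

/-- The content of the entry `i`: column minus row. -/
def content (f : Filling μ N) (i : Fin N) : ℤ := (col f i : ℤ) - (row f i : ℤ)

/-- Entries strictly decrease along each row and along each column. -/
def IsRST (f : Filling μ N) : Prop :=
  (∀ i j, row f i = row f j → col f i < col f j → j < i) ∧
  (∀ i j, col f i = col f j → row f i < row f j → j < i)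

/-- The filling `f^{(i,j)}`, in which the entries `i` and `j` have been exchanged. -/
def exchange (f : Filling μ N) (i j : Fin N) : Filling μ N := (Equiv.swap i j).trans f

end Tableaux

/-- The set of reverse standard tableaux of shape `μ`. -/
abbrev Tab (μ : YoungDiagram) (N : ℕ) := {f : Filling μ N // IsRST f}

/-- Cells, ordered column by column (left to right) and by increasing row in each column. -/
def columnKey : ℕ × ℕ ≃ ℕ ×ₗ ℕ := (Equiv.prodComm ℕ ℕ).trans toLex

/-- The increasing enumeration of the cells of `μ` in the order given by `columnKey`. -/
def columnReading (μ : YoungDiagram) {N : ℕ} (h : μ.card = N) : Filling μ N :=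
  ((μ.cells.map columnKey.toEmbedding).orderIsoOfFin
      (by rw [Finset.card_map]; exact h)).toEquiv.trans
    (columnKey.symm.subtypeEquiv (by intro a; simp))

/-- The filling of the shape, from bottom to top in each column and from the left column to the
right one, by `N, N - 1, …, 1`. -/
def rootFilling (μ : YoungDiagram) {N : ℕ} (h : μ.card = N) : Filling μ N :=
  Fin.revPerm.trans (columnReading μ h)

theorem columnReading_lt (μ : YoungDiagram) {N : ℕ} (h : μ.card = N) (i j : Fin N) :
    i < j ↔ columnKey (columnReading μ h i).1 < columnKey (columnReading μ h j).1 := by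
  rw [← OrderIso.lt_iff_lt ((μ.cells.map columnKey.toEmbedding).orderIsoOfFin
      (by rw [Finset.card_map]; exact h)), ← Subtype.coe_lt_coe]
  simp [columnReading]

theorem rootFilling_lt (μ : YoungDiagram) {N : ℕ} (h : μ.card = N) (i j : Fin N) :
    j < i ↔ col (rootFilling μ h) i < col (rootFilling μ h) j ∨
      (col (rootFilling μ h) i = col (rootFilling μ h) j ∧
        row (rootFilling μ h) i < row (rootFilling μ h) j) := by
  rw [← Fin.rev_lt_rev, columnReading_lt μ h, columnKey]
  simp [row, col, rootFilling, Prod.Lex.toLex_lt_toLex]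

theorem rootFilling_isRST (μ : YoungDiagram) {N : ℕ} (h : μ.card = N) :
    IsRST (rootFilling μ h) :=
  ⟨fun i j _ hc => (rootFilling_lt μ h i j).2 (Or.inl hc),
   fun i j hc hr => (rootFilling_lt μ h i j).2 (Or.inr ⟨hc, hr⟩)⟩

/-- The root tableau. -/
def rootTab (μ : YoungDiagram) {N : ℕ} (h : μ.card = N) : Tab μ N :=
  ⟨rootFilling μ h, rootFilling_isRST μ h⟩

/-! ### Operators -/

/-- The product `A₁ A₂ ⋯ A_k` of operators acting on the right: `A₁` is applied first. -/
def rightProd {K M : Type*} [Field K] [AddCommGroup M] [Module K M]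
    (L : List (Module.End K M)) : Module.End K M := L.reverse.prod

section Polynomials
variable (K : Type*) [Field K] {n : ℕ}

/-- `s_i^x`: exchange of the variables `x_i` and `x_{i+1}`. -/
def sX (i : Fin n) : Module.End K (MvPolynomial (Fin (n + 1)) K) :=
  (MvPolynomial.rename (R := K) (Equiv.swap i.castSucc i.succ)).toLinearMap

theorem dvd_sub_sX (i : Fin n) (f : MvPolynomial (Fin (n + 1)) K) :
    (MvPolynomial.X i.castSucc - MvPolynomial.X i.succ : MvPolynomial (Fin (n + 1)) K) ∣
      f - sX K i f := by
  induction f using MvPolynomial.induction_on with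
  | C a => simp [sX]
  | add p r hp hr =>
    rw [map_add, add_sub_add_comm]
    exact dvd_add hp hr
  | mul_X p k hp =>
    have h1 : sX K i (p * MvPolynomial.X k)
        = sX K i p * MvPolynomial.X (Equiv.swap i.castSucc i.succ k) := by
      simp [sX]
    have h2 : (MvPolynomial.X i.castSucc - MvPolynomial.X i.succ :
        MvPolynomial (Fin (n + 1)) K) ∣
          MvPolynomial.X k - MvPolynomial.X (Equiv.swap i.castSucc i.succ k) := by
      rcases eq_or_ne k i.castSucc with rfl | h
      · simp
      rcases eq_or_ne k i.succ with rfl | h'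
      · rw [Equiv.swap_apply_right, ← dvd_neg, neg_sub]
      · simp [Equiv.swap_apply_of_ne_of_ne h h']
    rw [h1]
    have h3 : p * MvPolynomial.X k
        - sX K i p * MvPolynomial.X (Equiv.swap i.castSucc i.succ k)
        = (p - sX K i p) * MvPolynomial.X k + sX K i p *
          (MvPolynomial.X k - MvPolynomial.X (Equiv.swap i.castSucc i.succ k)) := by ring
    rw [h3]
    exact dvd_add (hp.mul_right _) (h2.mul_left _)

theorem X_sub_X_ne_zero (i : Fin n) :
    (MvPolynomial.X i.castSucc - MvPolynomial.X i.succ : MvPolynomial (Fin (n + 1)) K) ≠ 0 := by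
  rw [sub_ne_zero]
  intro h
  exact absurd (MvPolynomial.X_injective h) (Fin.castSucc_lt_succ (i := i)).ne

/-- The divided difference `∂_i`: the quotient of `f - f s_i` by `x_i - x_{i+1}`. -/
def divDiff (i : Fin n) : Module.End K (MvPolynomial (Fin (n + 1)) K) where
  toFun f := (dvd_sub_sX K i f).choose
  map_add' f g := by
    apply mul_left_cancel₀ (X_sub_X_ne_zero K i)
    rw [mul_add, ← (dvd_sub_sX K i (f + g)).choose_spec, ← (dvd_sub_sX K i f).choose_spec,
      ← (dvd_sub_sX K i g).choose_spec, map_add]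
    ring
  map_smul' c f := by
    apply mul_left_cancel₀ (X_sub_X_ne_zero K i)
    rw [RingHom.id_apply, mul_smul_comm, ← (dvd_sub_sX K i (c • f)).choose_spec,
      ← (dvd_sub_sX K i f).choose_spec, map_smul, smul_sub]

theorem divDiff_spec (i : Fin n) (f : MvPolynomial (Fin (n + 1)) K) :
    (MvPolynomial.X i.castSucc - MvPolynomial.X i.succ) * divDiff K i f = f - sX K i f :=
  (dvd_sub_sX K i f).choose_spec.symm

variable {K}

/-- `δ_i^x = (1 - s) ∂_i x_{i+1}`. -/
def deltaX (s : K) (i : Fin n) : Module.End K (MvPolynomial (Fin (n + 1)) K) :=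
  (1 - s) • rightProd [divDiff K i, LinearMap.mulLeft K (MvPolynomial.X i.succ)]

/-- `τ_1^x`: the substitution `x_1 ↦ q x_1`. -/
def tauX (q : K) (n : ℕ) : Module.End K (MvPolynomial (Fin (n + 1)) K) :=
  (MvPolynomial.aeval (R := K) fun j : Fin (n + 1) =>
    if j = 0 then MvPolynomial.C q * MvPolynomial.X 0 else MvPolynomial.X j).toLinearMap

end Polynomials

/-- The vector space `V_μ` with basis the reverse standard tableaux of shape `μ`. -/
abbrev V (K : Type*) [Field K] (μ : YoungDiagram) (N : ℕ) := Tab μ N →₀ K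

/-- The space `K[x_1, …, x_N] ⊗ V_μ` of vector valued polynomials, `N = n + 1`. -/
abbrev VVPoly (K : Type*) [Field K] (μ : YoungDiagram) (n : ℕ) :=
  MvPolynomial (Fin (n + 1)) K ⊗[K] V K μ (n + 1)

section Hecke
variable {K : Type*} [Field K] {μ : YoungDiagram} {n : ℕ}

/-- Exchanging `i` and `i + 1` in a reverse standard tableau gives a reverse standard tableau when
these entries are neither in the same row nor in the same column. -/
theorem exchange_isRST (T : Tab μ (n + 1)) (i : Fin n)
    (hr : row T.1 i.castSucc ≠ row T.1 i.succ) (hc : col T.1 i.castSucc ≠ col T.1 i.succ) :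
    IsRST (exchange T.1 i.castSucc i.succ) := by
  have key : ∀ a b : Fin (n + 1), Equiv.swap i.castSucc i.succ b < Equiv.swap i.castSucc i.succ a →
      ¬ (Equiv.swap i.castSucc i.succ b = i.castSucc ∧
        Equiv.swap i.castSucc i.succ a = i.succ) → b < a := by
    intro a b h1 h2
    simp only [Equiv.swap_apply_def, Fin.ext_iff, Fin.lt_def, Fin.val_castSucc,
      Fin.val_succ] at h1 h2 ⊢
    split_ifs at h1 h2 <;> simp_all <;> omega
  constructor
  · intro a b h1 h2
    refine key a b (T.2.1 _ _ h1 h2) ?_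
    rintro ⟨hb, ha⟩
    have h3 : row T.1 (Equiv.swap i.castSucc i.succ a) =
        row T.1 (Equiv.swap i.castSucc i.succ b) := h1
    rw [ha, hb] at h3
    exact hr h3.symm
  · intro a b h1 h2
    refine key a b (T.2.2 _ _ h1 h2) ?_
    rintro ⟨hb, ha⟩
    have h3 : col T.1 (Equiv.swap i.castSucc i.succ a) =
        col T.1 (Equiv.swap i.castSucc i.succ b) := h1
    rw [ha, hb] at h3
    exact hc h3.symm

open Classical in
/-- The image of the basis vector `T` under the generator `T_i` of the Hecke algebra. -/
def heckeOnTab (s : K) (i : Fin n) (T : Tab μ (n + 1)) : V K μ (n + 1) :=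
  if hr : row T.1 i.castSucc = row T.1 i.succ then
    s • Finsupp.single T 1
  else if hc : col T.1 i.castSucc = col T.1 i.succ then
    - Finsupp.single T 1
  else
    let T' : Tab μ (n + 1) := ⟨exchange T.1 i.castSucc i.succ, exchange_isRST T i hr hc⟩
    let m : ℤ := content T.1 i.succ - content T.1 i.castSucc
    if row T.1 i.castSucc < row T.1 i.succ then
      Finsupp.single T' 1 - ((1 - s) / (1 - s ^ m)) • Finsupp.single T 1
    else
      ((s - 1) / (1 - s ^ m)) • Finsupp.single T 1 +
        (s * (1 - s ^ (m + 1)) * (1 - s ^ (m - 1)) / (1 - s ^ m) ^ 2) • Finsupp.single T' 1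

/-- The generator `T_i` acting on `V_μ`. -/
def heckeT (μ : YoungDiagram) (s : K) (i : Fin n) : Module.End K (V K μ (n + 1)) :=
  Finsupp.linearCombination K (heckeOnTab s i)

/-- `S = T_1 ⋯ T_{N-1}` acting on `V_μ`. -/
def heckeS (μ : YoungDiagram) (s : K) (n : ℕ) : Module.End K (V K μ (n + 1)) :=
  rightProd ((List.finRange n).map (heckeT μ s))

/-- Bold `T_i = δ_i^x + s_i^x T_i`. -/
def boldT (μ : YoungDiagram) (s : K) (i : Fin n) : Module.End K (VVPoly K μ n) :=
  TensorProduct.map (deltaX s i) LinearMap.id + TensorProduct.map (sX K i) (heckeT μ s i)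

/-- The inverse `s⁻¹ (T_i + (1 - s))` of bold `T_i`. -/
def boldTinv (μ : YoungDiagram) (s : K) (i : Fin n) : Module.End K (VVPoly K μ n) :=
  s⁻¹ • (boldT μ s i + (1 - s) • LinearMap.id)

/-- Bold `w = τ_1^x s_1^x ⋯ s_{N-1}^x S`. -/
def boldW (μ : YoungDiagram) (q s : K) (n : ℕ) : Module.End K (VVPoly K μ n) :=
  TensorProduct.map (rightProd (tauX q n :: (List.finRange n).map (sX K))) (heckeS μ s n)

/-- The Cherednik operator `ξ_i = s^{i-N} T_{i-1}⁻¹ ⋯ T_1⁻¹ w T_{N-1} ⋯ T_i` (all bold). -/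
def cherednik (μ : YoungDiagram) (q s : K) (i : Fin (n + 1)) : Module.End K (VVPoly K μ n) :=
  s ^ ((i.val : ℤ) - (n : ℤ)) • rightProd
    ((((List.finRange n).filter fun j => j.val < i.val).reverse.map (boldTinv μ s)) ++
      [boldW μ q s n] ++
      (((List.finRange n).filter fun j => i.val ≤ j.val).reverse.map (boldT μ s)))

/-- The raising operator `Φ = T_1⁻¹ ⋯ T_{N-1}⁻¹ x_N` (all bold). -/
def boldPhi (μ : YoungDiagram) (s : K) (n : ℕ) : Module.End K (VVPoly K μ n) :=
  rightProd ((List.finRange n).map (boldTinv μ s) ++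
    [TensorProduct.map (LinearMap.mulLeft K (MvPolynomial.X (Fin.last n))) LinearMap.id])

end Hecke

/-! ### The Yang–Baxter graph -/

/-- A 4-tuple `(T, ζ, v, σ)`. -/
@[ext] structure Vertex (K : Type*) (μ : YoungDiagram) (n : ℕ) where
  tab : Tab μ (n + 1)
  zeta : Fin (n + 1) → K
  v : Fin (n + 1) → ℕ
  sigma : Equiv.Perm (Fin (n + 1))

/-- The labels `s_i` and `Ψ` of the arrows. -/
inductive Label (n : ℕ)
  | transp (i : Fin n)
  | affine

section Graph
variable {K : Type*} [Field K] {μ : YoungDiagram} {n : ℕ}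

open Classical in
/-- The action of `s_i` on 4-tuples. -/
def Vertex.transp (A : Vertex K μ n) (i : Fin n) : Vertex K μ n :=
  if A.v i.succ ≠ A.v i.castSucc then
    { tab := A.tab
      zeta := A.zeta ∘ Equiv.swap i.castSucc i.succ
      v := A.v ∘ Equiv.swap i.castSucc i.succ
      sigma := (Equiv.swap i.castSucc i.succ).trans A.sigma }
  else if h : IsRST (exchange A.tab.1 (A.sigma i.castSucc) (A.sigma i.succ)) then
    { tab := ⟨exchange A.tab.1 (A.sigma i.castSucc) (A.sigma i.succ), h⟩
      zeta := A.zeta ∘ Equiv.swap i.castSucc i.succ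
      v := A.v
      sigma := A.sigma }
  else A

/-- The affine action `Ψ` on 4-tuples:
`(T, [ζ_2, …, ζ_N, q ζ_1], [v_2, …, v_N, v_1 + 1], [σ_2, …, σ_N, σ_1])`. -/
def Vertex.affine (q : K) (A : Vertex K μ n) : Vertex K μ n where
  tab := A.tab
  zeta := Fin.snoc (α := fun _ => K) (fun i : Fin n => A.zeta i.succ) (q * A.zeta 0)
  v := Fin.snoc (α := fun _ => ℕ) (fun i : Fin n => A.v i.succ) (A.v 0 + 1)
  sigma := (finRotate (n + 1)).trans A.sigma

/-- The root `(T_μ, (s^{CT[i]})_i, 0^N, [1, …, N])` of the graph. -/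
def rootVertex (s : K) (h : μ.card = n + 1) : Vertex K μ n where
  tab := rootTab μ h
  zeta := fun i => s ^ content (rootTab μ h).1 i
  v := fun _ => 0
  sigma := Equiv.refl _

/-- The arrows of the graph. The target `none` is the vertex `∅`; the arrows to it are the falls. -/
inductive Arrow (q : K) : Vertex K μ n → Label n → Option (Vertex K μ n) → Prop
  | step (A : Vertex K μ n) (i : Fin n) (h : A.v i.castSucc < A.v i.succ) :
      Arrow q A (Label.transp i) (some (A.transp i))
  | jump (A : Vertex K μ n) (i : Fin n) (h : A.v i.castSucc = A.v i.succ)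
      (k l : Fin (n + 1)) (hkl : k < l)
      (hT : (A.transp i).tab.1 = exchange A.tab.1 k l)
      (hct : content A.tab.1 l + 2 ≤ content A.tab.1 k) :
      Arrow q A (Label.transp i) (some (A.transp i))
  | affine (A : Vertex K μ n) : Arrow q A Label.affine (some (A.affine q))
  | fall (A : Vertex K μ n) (i : Fin n) (h : A.transp i = A) :
      Arrow q A (Label.transp i) none

/-- `IsPath q s h p W`: the vector of labels `p` is a path from the root to `W`. No arrow starts at
`∅`, so the paths without fall are exactly those with `W = some A`. -/
inductive IsPath (q s : K) (h : μ.card = n + 1) :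
    List (Label n) → Option (Vertex K μ n) → Prop
  | nil : IsPath q s h [] (some (rootVertex s h))
  | snoc (p : List (Label n)) (A : Vertex K μ n) (a : Label n) (W : Option (Vertex K μ n))
      (hp : IsPath q s h p (some A)) (ha : Arrow q A a W) : IsPath q s h (p ++ [a]) W

/-- One step of the recurrence for the polynomials: the current 4-tuple is carried along, since its
vector `ζ` enters the operator attached to `s_i`. -/
def pathStep (q s : K) (x : Vertex K μ n × VVPoly K μ n) :
    Label n → Vertex K μ n × VVPoly K μ n
  | Label.transp i =>
      (x.1.transp i,
        boldT μ s i x.2 +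
          ((1 - s) / (1 - x.1.zeta i.succ / x.1.zeta i.castSucc)) • x.2)
  | Label.affine => (x.1.affine q, boldPhi μ s n x.2)

/-- The polynomial `P_p` attached to the vector of labels `p`. -/
def pathPoly (q s : K) (h : μ.card = n + 1) (p : List (Label n)) : VVPoly K μ n :=
  (p.foldl (pathStep q s)
    (rootVertex s h, (1 : MvPolynomial (Fin (n + 1)) K) ⊗ₜ[K] Finsupp.single (rootTab μ h) 1)).2

end Graph

end VVMacdonald

end

/-!
The operators on vector valued polynomials form a representation of a double affine Hecke algebra,
and the arrows of the Yang–Baxter graph are its intertwiners.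

*The Hecke algebra on tableaux.* The coefficients of `T_i` in the basis of tableaux are functions of
the contents of `i` and `i + 1`, and a tableau is determined by its vector of contents
(`IsRST.ext_content`). Thus `V_μ` embeds into the space with basis all integer vectors, where `T_i` is
the restriction of an operator `pairOp` with a uniform formula; the quadratic, commutation and braid
relations become identities of rational functions in the powers of `s`.

*Relations.* Together with the corresponding relations for divided differences this gives the braid
and quadratic relations for the bold `T_i` and their relations with `w` and with the variables.
Everything else that is needed about the `ξ_i` and `Φ` follows from these relations alone:
`IsDoubleAffine` lists them, and its consequences are `T_i ξ_{i+1} T_i = s ξ_i`, the commutation of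
`T_i` with the other `ξ_j`, `ξ_i` moved through `Φ`, `T_{i+1} Φ = Φ T_i` and
`T_1 Φ² = Φ² T_{N-1}` (in the notation for right operators).

*Eigenfunctions.* A vertex is controlled by the exponents `(v[i], CT[σ[i]])` of the powers of `q` and
`s` in `ζ[i]`: in the graph the permutation `σ` is the standardization of `v`
(`Vertex.IsStandard`), so that a vertex is determined by its exponents. An arrow exchanges two
exponents or rotates them, and the relations show by induction on the path that the polynomials are
eigenfunctions (`Reach.eigen`); a step never gives zero because the eigenvalues involved never have
ratio `s` or `s⁻¹`. In degree `0` the `ξ_i` are the Jucys–Murphy operators, which are diagonal in the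
basis of tableaux.

*Independence of the path.* Eigenspaces are not known to be one-dimensional in advance, so this is
shown by Newman's argument, read backwards: two arrows into the same vertex can be completed to two
paths of the same length from a common vertex, along which the operators agree by the Yang–Baxter
equation, by commutation, or by the relations between `T_i` and `Φ` (`joinable_of_ne`). As every
arrow lengthens the path by one, induction on the length gives uniqueness (`Reach.unique`).

*Basis.* Nonzero joint eigenvectors with distinct eigenvalues are linearly independent, and the
spectral vector determines the vertex. The polynomial of `(v, T)` is homogeneous of degree `∑ v[i]`,
and in each degree there are as many of them as tensors of a monomial and a tableau, whence they
span (`top_le_span_of_graded`).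
-/

noncomputable section

namespace VVMacdonald

/-! ### Contents of reverse standard tableaux -/

section Tableaux
variable {μ : YoungDiagram} {N n : ℕ}

theorem exists_entry (f : Filling μ N) {r c : ℕ} (h : (r, c) ∈ μ) :
    ∃ i, row f i = r ∧ col f i = c := by
  refine ⟨f.symm ⟨(r, c), h⟩, ?_, ?_⟩ <;> simp [row, col]

theorem entry_mem (f : Filling μ N) (i : Fin N) : (row f i, col f i) ∈ μ := (f i).2

theorem entry_ext (f g : Filling μ N) {i j : Fin N} (hr : row f i = row g j)
    (hc : col f i = col g j) : f i = g j :=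
  Subtype.ext (Prod.ext hr hc)

theorem entry_inj (f : Filling μ N) {i j : Fin N} (hr : row f i = row f j)
    (hc : col f i = col f j) : i = j :=
  f.injective (entry_ext f f hr hc)

/-- Entries weakly decrease in the componentwise order of the cells. -/
theorem IsRST.le_of_le {f : Filling μ N} (hf : IsRST f) {i j : Fin N} (hr : row f i ≤ row f j)
    (hc : col f i ≤ col f j) : j ≤ i := by
  obtain ⟨k, hk1, hk2⟩ := exists_entry f (μ.up_left_mem hr le_rfl (entry_mem f j))
  have h1 : k ≤ i := by
    rcases hc.eq_or_lt with h | h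
    · exact (entry_inj f hk1 (hk2.trans h.symm)).le
    · exact (hf.1 i k hk1.symm (hk2 ▸ h)).le
  have h2 : j ≤ k := by
    rcases hr.eq_or_lt with h | h
    · exact (entry_inj f (hk1.trans h) hk2).ge
    · exact (hf.2 k j hk2 (hk1 ▸ h)).le
  exact h2.trans h1

theorem IsRST.lt_of_le {f : Filling μ N} (hf : IsRST f) {i j : Fin N} (hr : row f i ≤ row f j)
    (hc : col f i ≤ col f j) (hij : i ≠ j) : j < i :=
  lt_of_le_of_ne (hf.le_of_le hr hc) hij.symm

/-- Two entries on the same diagonal differ by at least `3`, as the other two corners of the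
rectangle spanned by their cells carry entries strictly between them. -/
theorem IsRST.diagonal_gap {f : Filling μ N} (hf : IsRST f) {i j : Fin N}
    (h : content f i = content f j) (hr : row f i < row f j) : j.val + 3 ≤ i.val := by
  unfold content at h
  obtain ⟨a, ha1, ha2⟩ := exists_entry f (μ.up_left_mem hr.le le_rfl (entry_mem f j))
  obtain ⟨b, hb1, hb2⟩ := exists_entry f
    (μ.up_left_mem le_rfl (by omega : col f i ≤ col f j) (entry_mem f j))
  have h1 := hf.1 i a (by omega) (by omega)
  have h2 := hf.2 i b (by omega) (by omega)
  have h3 := hf.2 a j (by omega) (by omega)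
  have h4 := hf.1 b j (by omega) (by omega)
  have h5 : a ≠ b := by rintro rfl; omega
  simp only [Fin.lt_def, ne_eq, Fin.ext_iff] at *
  omega

/-- Entries that differ by at most `2` have different contents. This excludes zero denominators in
the Hecke operators and in their braid relation. -/
theorem IsRST.content_ne {f : Filling μ N} (hf : IsRST f) {i j : Fin N} (hij : i < j)
    (hj : j.val ≤ i.val + 2) : content f i ≠ content f j := by
  intro h
  have hij' := Fin.lt_def.1 hij
  rcases lt_trichotomy (row f i) (row f j) with hr | hr | hr
  · have := hf.diagonal_gap h hr
    omega
  · refine hij.ne (entry_inj f hr ?_)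
    unfold content at h
    omega
  · have := hf.diagonal_gap h.symm hr
    omega

/-- The four possible relative positions of two consecutive entries. -/
theorem IsRST.consecutive {f : Filling μ (n + 1)} (hf : IsRST f) (i : Fin n) :
    (row f i.castSucc = row f i.succ ∧ content f i.castSucc = content f i.succ + 1) ∨
    (row f i.castSucc ≠ row f i.succ ∧ col f i.castSucc = col f i.succ ∧
      content f i.castSucc = content f i.succ - 1) ∨
    (row f i.castSucc < row f i.succ ∧ col f i.succ < col f i.castSucc) ∨
    (row f i.succ < row f i.castSucc ∧ col f i.castSucc < col f i.succ) := by
  have hlt : i.castSucc < i.succ := Fin.castSucc_lt_succ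
  have key : ¬ (row f i.castSucc ≤ row f i.succ ∧ col f i.castSucc ≤ col f i.succ) :=
    fun h => absurd (hf.le_of_le h.1 h.2) (not_le.2 hlt)
  have btw : ∀ k : Fin (n + 1), i.castSucc < k → k < i.succ → False := by
    intro k h1 h2
    simp only [Fin.lt_def, Fin.val_castSucc, Fin.val_succ] at h1 h2
    omega
  by_cases hr : row f i.castSucc = row f i.succ
  · left
    refine ⟨hr, ?_⟩
    have hc : col f i.succ < col f i.castSucc := by omega
    by_contra hne
    unfold content at hne
    obtain ⟨k, h1, h2⟩ := exists_entry f (μ.up_left_mem (le_refl (row f i.castSucc))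
      (by omega : col f i.succ + 1 ≤ col f i.castSucc) (entry_mem f _))
    refine btw k (hf.1 _ _ h1 (by omega)) (hf.1 _ _ (by omega) (by omega))
  right
  by_cases hc : col f i.castSucc = col f i.succ
  · left
    refine ⟨hr, hc, ?_⟩
    by_contra hne
    unfold content at hne
    obtain ⟨k, h1, h2⟩ := exists_entry f (μ.up_left_mem
      (by omega : row f i.succ + 1 ≤ row f i.castSucc) (le_refl (col f i.castSucc))
      (entry_mem f _))
    refine btw k (hf.2 _ _ h2 (by omega)) (hf.2 _ _ (by omega) (by omega))
  right
  by_cases h : row f i.succ < row f i.castSucc ∧ col f i.succ < col f i.castSucc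
  · obtain ⟨k, h1, h2⟩ := exists_entry f (μ.up_left_mem h.1.le le_rfl (entry_mem f i.castSucc))
    exact (btw k (hf.2 _ _ h2 (by omega)) (hf.1 _ _ (by omega) (by omega))).elim
  omega

theorem IsRST.content_last {f : Filling μ (n + 1)} (hf : IsRST f) :
    content f (Fin.last n) = 0 := by
  obtain ⟨k, h1, h2⟩ := exists_entry f (μ.up_left_mem (Nat.zero_le _) (Nat.zero_le _)
    (entry_mem f (Fin.last n)))
  have h3 := hf.le_of_le (i := k) (j := Fin.last n) (by omega) (by omega)
  have h4 : k = Fin.last n := le_antisymm (Fin.le_last k) h3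
  subst h4
  simp [content, h1, h2]

/-- If `f` and `g` have the same contents and agree on the entries larger than `i`, the cell of `i`
in `f` cannot lie below its cell in `g` on their diagonal: it would then carry a larger entry of
`g`, which `f` has at the same cell. -/
theorem IsRST.row_le_of_content {f g : Filling μ N} (hg : IsRST g)
    (h : ∀ i, content f i = content g i) (i : Fin N) (ih : ∀ j, i < j → f j = g j) :
    row g i ≤ row f i := by
  by_contra hlt
  have hi := h i
  unfold content at hi
  obtain ⟨j, h1, h2⟩ := exists_entry g (entry_mem f i)
  have h3 : i < j := hg.lt_of_le (by omega) (by omega) (by rintro rfl; omega)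
  have h4 : f i = g j := entry_ext f g h1.symm h2.symm
  rw [← ih j h3] at h4
  exact h3.ne (f.injective h4)

/-- A reverse standard tableau is determined by the contents of its entries: from the largest
entry on, each entry must occupy the first free cell of its diagonal. -/
theorem IsRST.ext_content {f g : Filling μ N} (hf : IsRST f) (hg : IsRST g)
    (h : ∀ i, content f i = content g i) : f = g := by
  ext1 i
  induction i using WellFoundedGT.induction with
  | _ i ih =>
    have h1 := hg.row_le_of_content h i ih
    have h2 := hf.row_le_of_content (fun i => (h i).symm) i (fun j hj => (ih j hj).symm)
    have hi := h i
    unfold content at hi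
    exact entry_ext f g (by omega) (by omega)

/-- A tableau other than the root tableau has an entry `k + 1` to the right of and below `k`. -/
theorem exists_descent (T : Tab μ (n + 1)) (h : μ.card = n + 1) (hT : T ≠ rootTab μ h) :
    ∃ k : Fin n, row T.1 k.succ < row T.1 k.castSucc ∧ col T.1 k.castSucc < col T.1 k.succ := by
  by_contra hno
  refine hT (Subtype.ext ?_)
  -- a filling without such an entry lists the cells increasingly for `columnKey`, so it is unique
  have key : ∀ f : Filling μ (n + 1), (∀ i j, i < j → col f j < col f i ∨
      (col f j = col f i ∧ row f j < row f i)) →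
      StrictMono fun i : Fin (n + 1) => columnKey (f i.rev).1 := by
    intro f hf i j hij
    have := hf _ _ (Fin.rev_lt_rev.2 hij)
    simpa [columnKey, Prod.Lex.toLex_lt_toLex, row, col] using this
  have hanti : ∀ f : Filling μ (n + 1), (∀ i : Fin n, col f i.succ < col f i.castSucc ∨
      (col f i.succ = col f i.castSucc ∧ row f i.succ < row f i.castSucc)) →
      ∀ i j, i < j → col f j < col f i ∨ (col f j = col f i ∧ row f j < row f i) := by
    intro f hf
    have : StrictAnti fun i : Fin (n + 1) => columnKey (f i).1 := by
      rw [Fin.strictAnti_iff_succ_lt]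
      intro i
      simpa [columnKey, Prod.Lex.toLex_lt_toLex, row, col] using hf i
    intro i j hij
    simpa [columnKey, Prod.Lex.toLex_lt_toLex, row, col] using this hij
  have h1 := key T.1 (hanti T.1 fun i => by
    push Not at hno
    have h1 := hno i
    have h2 := T.2.consecutive i
    unfold content at h2
    omega)
  have h2 := key (rootTab μ h).1 fun i j hij => (rootFilling_lt μ h j i).1 hij
  have hrange : ∀ f : Filling μ (n + 1), Set.range (fun i : Fin (n + 1) => columnKey (f i.rev).1) =
      {x | columnKey.symm x ∈ μ.cells} := by
    intro f
    ext x
    constructor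
    · rintro ⟨i, rfl⟩
      simp
    · intro hx
      exact ⟨(f.symm ⟨_, hx⟩).rev, by simp⟩
  have h3 := (StrictMono.range_inj h1 h2).1 ((hrange _).trans (hrange _).symm)
  ext1 i
  have h4 := congrFun h3 i.rev
  simp only [Fin.rev_rev] at h4
  exact Subtype.ext (columnKey.injective h4)

/-- The root tableau is not the target of an arrow `s_i` from another tableau. -/
theorem root_no_descent (h : μ.card = n + 1) (k : Fin n) :
    content (rootTab μ h).1 k.succ < content (rootTab μ h).1 k.castSucc + 2 := by
  have h1 := (rootFilling_lt μ h k.succ k.castSucc).1 Fin.castSucc_lt_succ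
  have h2 := (rootTab μ h).2.consecutive k
  change (col (rootTab μ h).1 _ < col (rootTab μ h).1 _ ∨ col (rootTab μ h).1 _ =
    col (rootTab μ h).1 _ ∧ row (rootTab μ h).1 _ < row (rootTab μ h).1 _) at h1
  unfold content at *
  omega

theorem content_exchange (f : Filling μ N) (i j k : Fin N) :
    content (exchange f i j) k = content f (Equiv.swap i j k) := rfl

theorem exchange_exchange (f : Filling μ N) (i j : Fin N) :
    exchange (exchange f i j) i j = f := by
  exact Equiv.ext fun k => by simp [exchange]

/-- Two consecutive entries whose contents differ by at least `2` can be exchanged. -/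
theorem exchange_isRST_of_content (T : Tab μ (n + 1)) (i : Fin n)
    (h : content T.1 i.castSucc + 2 ≤ content T.1 i.succ ∨
      content T.1 i.succ + 2 ≤ content T.1 i.castSucc) :
    IsRST (exchange T.1 i.castSucc i.succ) := by
  refine exchange_isRST T i ?_ ?_ <;> intro h' <;> have h2 := T.2.consecutive i <;>
    unfold content at * <;> omega

end Tableaux

/-! ### Relations in a double affine Hecke algebra -/

section Braid
variable {G : Type*} [Group G]

/-- The ascending product `t₀ t₁ ⋯ t_{k-1}`. -/
def ascProd {M : Type*} [Monoid M] (t : ℕ → M) : ℕ → M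
  | 0 => 1
  | k + 1 => ascProd t k * t k

/-- The descending product `t_{k-1} ⋯ t₁ t₀`. -/
def descProd {M : Type*} [Monoid M] (t : ℕ → M) : ℕ → M
  | 0 => 1
  | k + 1 => t k * descProd t k

/-- The elements `t₀, …, t_{n-1}` satisfy the braid relations. -/
structure IsBraid {M : Type*} [Monoid M] (n : ℕ) (t : ℕ → M) : Prop where
  comm : ∀ i j, i + 2 ≤ j → j < n → t i * t j = t j * t i
  braid : ∀ i, i + 1 < n → t i * t (i + 1) * t i = t (i + 1) * t i * t (i + 1)

section Monoid
variable {M : Type*} [Monoid M] {n : ℕ} {t : ℕ → M}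

theorem IsBraid.commute (h : IsBraid n t) {i j : ℕ} (hij : i + 2 ≤ j ∨ j + 2 ≤ i) (hi : i < n)
    (hj : j < n) : Commute (t i) (t j) := by
  rcases hij with hij | hij
  · exact h.comm i j hij hj
  · exact (h.comm j i hij hi).symm

theorem commute_ascProd {a : M} {t : ℕ → M} {k : ℕ} (h : ∀ i < k, Commute a (t i)) :
    Commute a (ascProd t k) := by
  induction k with
  | zero => exact Commute.one_right a
  | succ k ih => exact (ih fun i hi => h i (hi.trans k.lt_succ_self)).mul_right (h k k.lt_succ_self)

theorem commute_descProd {a : M} {t : ℕ → M} {k : ℕ} (h : ∀ i < k, Commute a (t i)) :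
    Commute a (descProd t k) := by
  induction k with
  | zero => exact Commute.one_right a
  | succ k ih =>
    exact (h k k.lt_succ_self).mul_right (ih fun i hi => h i (hi.trans k.lt_succ_self))

/-- Conjugation by the ascending product raises the index of a generator. -/
theorem IsBraid.semiconj_ascProd (h : IsBraid n t) {i k : ℕ} (hik : i + 1 < k) (hk : k ≤ n) :
    SemiconjBy (ascProd t k) (t i) (t (i + 1)) := by
  induction k, (show i + 2 ≤ k from hik) using Nat.le_induction with
  | base =>
    have h1 : Commute (t (i + 1)) (ascProd t i) :=
      commute_ascProd fun j hj => h.commute (by omega) (by omega) (by omega)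
    change ascProd t i * t i * t (i + 1) * t i = t (i + 1) * (ascProd t i * t i * t (i + 1))
    rw [mul_assoc, mul_assoc, ← mul_assoc (t i), h.braid i (by omega)]
    rw [← mul_assoc (t (i + 1)) (ascProd t i * t i), ← mul_assoc (t (i + 1)) (ascProd t i), h1.eq]
    simp only [mul_assoc]
  | succ k hk' ih =>
    exact (ih (by omega) (by omega)).mul_left (h.commute (by omega) (by omega) (by omega))

/-- Conjugation by the descending product lowers the index of a generator. -/
theorem IsBraid.semiconj_descProd (h : IsBraid n t) {i k : ℕ} (hik : i + 1 < k) (hk : k ≤ n) :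
    SemiconjBy (descProd t k) (t (i + 1)) (t i) := by
  induction k, (show i + 2 ≤ k from hik) using Nat.le_induction with
  | base =>
    have h1 : Commute (t (i + 1)) (descProd t i) :=
      commute_descProd fun j hj => h.commute (by omega) (by omega) (by omega)
    change t (i + 1) * (t i * descProd t i) * t (i + 1) = t i * (t (i + 1) * (t i * descProd t i))
    rw [mul_assoc, mul_assoc, ← h1.eq]
    simp only [← mul_assoc]
    rw [h.braid i (by omega)]
  | succ k hk' ih =>
    exact SemiconjBy.mul_left (h.commute (by omega) (by omega) (by omega))
      (ih (by omega) (by omega))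

theorem map_ascProd {M' F : Type*} [Monoid M'] [FunLike F M M'] [MonoidHomClass F M M'] (φ : F)
    (t : ℕ → M) (k : ℕ) : φ (ascProd t k) = ascProd (fun i => φ (t i)) k := by
  induction k with
  | zero => exact map_one φ
  | succ k ih => rw [ascProd, map_mul, ih, ascProd]

theorem map_descProd {M' F : Type*} [Monoid M'] [FunLike F M M'] [MonoidHomClass F M M'] (φ : F)
    (t : ℕ → M) (k : ℕ) : φ (descProd t k) = descProd (fun i => φ (t i)) k := by
  induction k with
  | zero => exact map_one φ
  | succ k ih => rw [descProd, map_mul, ih, descProd]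

end Monoid

theorem ascProd_succ_left {M : Type*} [Monoid M] (t : ℕ → M) (k : ℕ) :
    ascProd t (k + 1) = t 0 * ascProd (fun i => t (i + 1)) k := by
  induction k with
  | zero => simp [ascProd]
  | succ k ih => rw [ascProd, ih, ascProd, mul_assoc]

theorem IsBraid.ascProd_inv_mul_ascProd_inv {n : ℕ} {t : ℕ → G} (h : IsBraid (n + 1) t) :
    (ascProd t n)⁻¹ * (ascProd t (n + 1))⁻¹ =
      (ascProd t (n + 1))⁻¹ * ((ascProd t (n + 1))⁻¹ * t 0) := by
  -- `t₀ ⋯ t_n` conjugates `t₀ ⋯ t_{n-1}` into `t₁ ⋯ t_n = t₀⁻¹ (t₀ ⋯ t_n)`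
  have key : ∀ k, k ≤ n → SemiconjBy (ascProd t (n + 1))
      (ascProd t k) (ascProd (fun i => t (i + 1)) k) := by
    intro k hk
    induction k with
    | zero => exact SemiconjBy.one_right _
    | succ k ih =>
      exact (ih (by omega)).mul_right (h.semiconj_ascProd (by omega) le_rfl)
  have h3 := (key n le_rfl).eq
  have h6 : ascProd (fun i => t (i + 1)) n = (t 0)⁻¹ * ascProd t (n + 1) := by
    rw [ascProd_succ_left]; group
  rw [h6] at h3
  apply inv_injective
  simpa [mul_assoc] using h3

theorem IsBraid.descProd_inv_mul_ascProd_inv {n : ℕ} {t : ℕ → G} (h : IsBraid (n + 1) t) :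
    (descProd t n)⁻¹ * (ascProd t (n + 1))⁻¹ =
      (ascProd t (n + 1))⁻¹ * t 0 * (descProd t (n + 1))⁻¹ := by
  have key : ∀ k, k ≤ n → SemiconjBy (descProd t (n + 1))
      (ascProd (fun i => t (i + 1)) k) (ascProd t k) := by
    intro k hk
    induction k with
    | zero => exact SemiconjBy.one_right _
    | succ k ih =>
      exact (ih (by omega)).mul_right (h.semiconj_descProd (by omega) le_rfl)
  have h3 := (key n le_rfl).eq
  have h5 : ascProd t n = ascProd t (n + 1) * (t n)⁻¹ := by rw [ascProd]; group
  have h6 : ascProd (fun i => t (i + 1)) n = (t 0)⁻¹ * ascProd t (n + 1) := by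
    rw [ascProd_succ_left]; group
  have h7 : descProd t (n + 1) = t n * descProd t n := rfl
  rw [h5, h6] at h3
  apply inv_injective
  simp only [mul_inv_rev, inv_inv, mul_assoc] at h3 ⊢
  rw [h3]
  simp [h7]

end Braid

section DoubleAffine

/-- Generators of a double affine Hecke algebra of type `GL_{n+1}`, in left multiplicative
notation: the braid generators `t i`, the affine element `w`, the multiplications `x i` and the
Cherednik elements `y i`. Products are in the opposite order to that for right operators. Only
`t i` with `i < n` and `x i`, `y i` with `i ≤ n` matter; the indices are natural numbers in order to
allow inductions over them. -/
structure IsDoubleAffine {K A : Type*} [Field K] [Ring A] [Algebra K A] (q s : K) (n : ℕ)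
    (t : ℕ → Aˣ) (w : A) (x y : ℕ → A) : Prop where
  ne_zero : s ≠ 0
  isBraid : IsBraid n t
  quad : ∀ i < n, s • (↑(t i)⁻¹ : A) = t i + (1 - s) • 1
  w_mul_t : ∀ i, i + 1 < n → w * t (i + 1) = t i * w
  t_inv_mul_x : ∀ i < n, s • (↑(t i)⁻¹ * x (i + 1)) = x i * t i
  x_comm_t : ∀ i, i + 1 < n → Commute (x n) (t i : A)
  x_comm_x : ∀ i j, Commute (x i) (x j)
  w_mul_x_zero : w * x 0 = q • (x n * w)
  w_mul_x_last : ∀ i, i + 1 = n → w * x n = x i * w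
  y_zero : s ^ n • y 0 = ↑(ascProd t n) * w
  y_last : y n = w * ↑(descProd t n)⁻¹
  y_rec : ∀ i < n, s • y i = t i * y (i + 1) * t i

namespace IsDoubleAffine
variable {K A : Type*} [Field K] [Ring A] [Algebra K A] {q s : K} {n : ℕ}
  {t : ℕ → Aˣ} {w : A} {x y : ℕ → A}

theorem braid_val (h : IsDoubleAffine q s n t w x y) {i : ℕ} (hi : i + 1 < n) :
    (t i * t (i + 1) * t i : A) = t (i + 1) * t i * t (i + 1) := by
  exact_mod_cast congrArg Units.val (h.isBraid.braid i hi)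

theorem commute_val (h : IsDoubleAffine q s n t w x y) {i j : ℕ} (hij : i + 2 ≤ j ∨ j + 2 ≤ i)
    (hi : i < n) (hj : j < n) : Commute (t i : A) (t j : A) := by
  change (t i * t j : A) = t j * t i
  exact_mod_cast congrArg Units.val (h.isBraid.commute hij hi hj).eq

theorem smul_inj (h : IsDoubleAffine q s n t w x y) {a b : A} (hab : s • a = s • b) : a = b :=
  smul_right_injective A h.ne_zero hab

theorem y_comm_of_lt (h : IsDoubleAffine q s n t w x y) {i j : ℕ} (hij : i + 2 ≤ j)
    (hj : j ≤ n) : Commute (y j) (t i : A) := by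
  induction hj using Nat.decreasingInduction with
  | self =>
    have h1 : ((descProd t n)⁻¹ : Aˣ) * t i = t (i + 1) * (descProd t n)⁻¹ :=
      (h.isBraid.semiconj_descProd (by omega) le_rfl).inv_symm_left.eq
    have h2 := congrArg Units.val h1
    push_cast at h2
    rw [h.y_last, Commute, SemiconjBy, mul_assoc, h2, ← mul_assoc, h.w_mul_t i (by omega),
      mul_assoc]
  | of_succ j hj ih =>
    have h1 : Commute (s • y j) (t i : A) := by
      rw [h.y_rec j hj]
      have h2 := h.commute_val (i := j) (j := i) (by omega) (by omega) (by omega)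
      exact (h2.mul_left (ih (by omega))).mul_left h2
    apply h.smul_inj
    rw [← smul_mul_assoc, h1.eq, mul_smul_comm]

/-- Since `y_k` is a multiple of `t_k t_{k+1} y_{k+2} t_{k+1} t_k`, the commutation of `y_{k+2}`
with `t_k` turns into that of `y_k` with `t_{k+1}` by the braid relation. -/
theorem y_comm_of_gt (h : IsDoubleAffine q s n t w x y) {i j : ℕ} (hij : j < i)
    (hi : i < n) : Commute (y j) (t i : A) := by
  obtain ⟨k, rfl⟩ : ∃ k, i = k + 1 := ⟨i - 1, by omega⟩
  have hjk : j ≤ k := by omega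
  induction hjk using Nat.decreasingInduction with
  | self =>
    have h1 : s • s • y k = t k * t (k + 1) * y (k + 2) * t (k + 1) * t k := by
      rw [h.y_rec k (by omega), ← smul_mul_assoc, ← mul_smul_comm, h.y_rec (k + 1) hi]
      simp only [mul_assoc]
    have h2 := (h.y_comm_of_lt (i := k) (j := k + 2) le_rfl (by omega)).eq
    have h3 := h.braid_val hi
    apply h.smul_inj
    apply h.smul_inj
    rw [← smul_mul_assoc, ← smul_mul_assoc, h1, ← mul_smul_comm, ← mul_smul_comm, h1]
    calc _ = t k * t (k + 1) * y (k + 2) * (t (k + 1) * t k * t (k + 1)) := by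
            simp only [mul_assoc]
      _ = t k * t (k + 1) * (y (k + 2) * t k) * t (k + 1) * t k := by
            rw [← h3]; simp only [mul_assoc]
      _ = (t k * t (k + 1) * t k) * y (k + 2) * t (k + 1) * t k := by
            rw [h2]; simp only [mul_assoc]
      _ = _ := by rw [h3]; simp only [mul_assoc]
  | of_succ j hj ih =>
    have h1 : Commute (s • y j) (t (k + 1) : A) := by
      rw [h.y_rec j (by omega)]
      have h2 := h.commute_val (i := j) (j := k + 1) (by omega) (by omega) (by omega)
      exact (h2.mul_left (ih (by omega))).mul_left h2
    apply h.smul_inj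
    rw [← smul_mul_assoc, h1.eq, mul_smul_comm]

/-- The Cherednik elements `y j` with `j ≠ i, i + 1` commute with `t i`. -/
theorem y_comm (h : IsDoubleAffine q s n t w x y) {i j : ℕ} (hi : i < n) (hj : j ≤ n)
    (h1 : j ≠ i) (h2 : j ≠ i + 1) : Commute (y j) (t i : A) := by
  rcases lt_or_gt_of_ne h1 with h3 | h3
  · exact h.y_comm_of_gt h3 hi
  · exact h.y_comm_of_lt (by omega) hj

theorem y_succ_mul_t (h : IsDoubleAffine q s n t w x y) {i : ℕ} (hi : i < n) :
    y (i + 1) * t i = t i * y i + (1 - s) • y i := by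
  have h1 : s • (↑(t i)⁻¹ * y i) = y (i + 1) * t i := by
    rw [← mul_smul_comm, h.y_rec i hi, ← mul_assoc, ← mul_assoc, Units.inv_mul, one_mul]
  rw [← h1, ← smul_mul_assoc, h.quad i hi, add_mul, smul_mul_assoc, one_mul]

theorem y_mul_t (h : IsDoubleAffine q s n t w x y) {i : ℕ} (hi : i < n) :
    y i * t i = t i * y (i + 1) - (1 - s) • y i := by
  have h1 : s • (y i * ↑(t i)⁻¹) = t i * y (i + 1) := by
    rw [← smul_mul_assoc, h.y_rec i hi, mul_assoc, Units.mul_inv, mul_one]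
  rw [← h1, ← mul_smul_comm, h.quad i hi, mul_add, mul_smul_comm, mul_one, add_sub_cancel_right]

theorem x_succ_mul_t_inv (h : IsDoubleAffine q s n t w x y) {i : ℕ} (hi : i < n) :
    s • (x (i + 1) * ↑(t i)⁻¹) = t i * x i := by
  have h1 := congrArg (fun a => (t i : A) * a * ↑(t i)⁻¹) (h.t_inv_mul_x i hi)
  simp only [mul_smul_comm, smul_mul_assoc] at h1
  rw [← mul_assoc (t i : A), Units.mul_inv, one_mul] at h1
  rw [h1, mul_assoc, mul_assoc, Units.mul_inv, mul_one]

/-- The raising element `x_n t_{n-1}⁻¹ ⋯ t₀⁻¹`. -/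
def phi (n : ℕ) (t : ℕ → Aˣ) (x : ℕ → A) : A := x n * ↑(ascProd t n)⁻¹

theorem t_mul_phi (h : IsDoubleAffine q s n t w x y) {i : ℕ} (hi : i + 1 < n) :
    t i * phi n t x = phi n t x * t (i + 1) := by
  have h1 : ((ascProd t n)⁻¹ : Aˣ) * t (i + 1) = t i * (ascProd t n)⁻¹ :=
    (h.isBraid.semiconj_ascProd hi le_rfl).inv_symm_left.eq
  have h2 := congrArg Units.val h1
  push_cast at h2
  rw [phi, mul_assoc, h2, ← mul_assoc, ← mul_assoc, (h.x_comm_t i hi).eq]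

/-- The relation closing the affine diagram: `Φ²` takes the last generator to the first one. -/
theorem t_mul_phi_sq (h : IsDoubleAffine q s (n + 1) t w x y) :
    t n * (phi (n + 1) t x * phi (n + 1) t x) =
      phi (n + 1) t x * phi (n + 1) t x * t 0 := by
  have h1 := congrArg Units.val h.isBraid.ascProd_inv_mul_ascProd_inv
  push_cast at h1
  have h2 : (↑(ascProd t (n + 1))⁻¹ : A) = ↑(t n)⁻¹ * ↑(ascProd t n)⁻¹ := by
    rw [← Units.val_mul, ← mul_inv_rev]; rfl
  have h3 : Commute (x (n + 1)) (↑(ascProd t n)⁻¹ : A) := by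
    apply Commute.units_inv_right
    have := map_ascProd (Units.coeHom A) t n
    simp only [Units.coeHom_apply] at this
    rw [this]
    exact commute_ascProd fun i hi => h.x_comm_t i (by omega)
  have h4 := h.x_succ_mul_t_inv (Nat.lt_succ_self n)
  set X := x (n + 1)
  set P : A := ↑(ascProd t (n + 1))⁻¹
  set P' : A := ↑(ascProd t n)⁻¹
  have h5 : P * X = ↑(t n)⁻¹ * X * P' := by
    rw [h2, mul_assoc, ← h3.eq, mul_assoc]
  have h6 : s • (X * ↑(t n)⁻¹ * X) = t n * X * x n := by
    rw [← smul_mul_assoc, h4, mul_assoc, mul_assoc, (h.x_comm_x n (n + 1)).eq]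
  have h7 : P' * (P * t 0) = ↑(t n : A) * (P' * P) := by
    rw [h1, h2]
    simp only [← mul_assoc, Units.mul_inv, one_mul]
  apply h.smul_inj
  unfold phi
  calc s • (t n * (X * P * (X * P))) = t n * X * (s • (P * X)) * P := by
        simp only [mul_smul_comm, smul_mul_assoc, mul_assoc]
    _ = t n * X * (s • (↑(t n)⁻¹ * X)) * P' * P := by
        rw [h5]; simp only [mul_smul_comm, smul_mul_assoc, mul_assoc]
    _ = t n * X * x n * (t n * (P' * P)) := by
        rw [h.t_inv_mul_x n n.lt_succ_self]; simp only [mul_assoc]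
    _ = s • (X * (P * X) * (P * t 0)) := by
        rw [← h7, ← h6, h5]; simp only [smul_mul_assoc, mul_assoc]
    _ = s • (X * P * (X * P) * t 0) := by simp only [mul_assoc]

theorem y_last_mul_phi (h : IsDoubleAffine q s n t w x y) :
    y n * phi n t x = q • (phi n t x * y 0) := by
  -- the variable `x k` is obtained from `x 0` by the braid generators below `k`
  have key : ∀ k ≤ n, s ^ k • ((↑(descProd t k)⁻¹ : A) * x k * ↑(ascProd t k)⁻¹) = x 0 := by
    intro k hk
    induction k with
    | zero => simp [descProd, ascProd]
    | succ k ih =>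
      have h1 : s • ((↑(t k)⁻¹ : A) * x (k + 1) * ↑(t k)⁻¹) = x k := by
        rw [← smul_mul_assoc, h.t_inv_mul_x k hk, mul_assoc, Units.mul_inv, mul_one]
      rw [← ih (by omega), ← h1, descProd, ascProd, mul_inv_rev, mul_inv_rev, Units.val_mul,
        Units.val_mul, pow_succ, mul_smul]
      simp only [mul_smul_comm, smul_mul_assoc, mul_assoc]
  have h1 : s ^ n • (y n * phi n t x) = s ^ n • (q • (phi n t x * y 0)) := by
    have h2 : s ^ n • (y n * phi n t x) = w * x 0 := by
      rw [← key n le_rfl, h.y_last, phi]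
      simp only [mul_smul_comm, mul_assoc]
    rw [h2, h.w_mul_x_zero, smul_comm, ← mul_smul_comm (s ^ n), h.y_zero, phi, mul_assoc,
      ← mul_assoc _ _ w, Units.inv_mul, one_mul]
  exact smul_right_injective A (pow_ne_zero n h.ne_zero) h1

/-- The relation of `Φ` with the last two Cherednik elements; it is the only one that involves
`w x_n = x_{n-1} w`. -/
theorem y_mul_phi_base (h : IsDoubleAffine q s (n + 1) t w x y) :
    y n * phi (n + 1) t x = phi (n + 1) t x * y (n + 1) := by
  have h1 := congrArg Units.val h.isBraid.descProd_inv_mul_ascProd_inv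
  push_cast at h1
  have h3 : Commute (x (n + 1)) (↑(descProd t n)⁻¹ : A) := by
    apply Commute.units_inv_right
    have := map_descProd (Units.coeHom A) t n
    simp only [Units.coeHom_apply] at this
    rw [this]
    exact commute_descProd fun i hi => h.x_comm_t i (by omega)
  have h4 := h.x_succ_mul_t_inv (Nat.lt_succ_self n)
  have h5 : (↑(descProd t (n + 1))⁻¹ : A) * t n = ↑(descProd t n)⁻¹ := by
    rw [← Units.val_mul, descProd]; simp
  have h6 : (↑(ascProd t (n + 1))⁻¹ : A) * w = ↑(t n)⁻¹ * w * ↑(ascProd t (n + 1))⁻¹ * t 0 := by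
    have h7 : ∀ k ≤ n, w * ↑(ascProd (fun i => t (i + 1)) k) = ↑(ascProd t k) * w := by
      intro k hk
      induction k with
      | zero => simp [ascProd]
      | succ k ih =>
        rw [ascProd, ascProd, Units.val_mul, Units.val_mul, ← mul_assoc, ih (by omega),
          mul_assoc, h.w_mul_t k (by omega), mul_assoc]
    have h8 : ascProd (fun i => t (i + 1)) n = (t 0)⁻¹ * ascProd t (n + 1) := by
      rw [ascProd_succ_left, inv_mul_cancel_left]
    have h9 := h7 n le_rfl
    rw [h8] at h9
    have h10 : w = ↑(ascProd t n) * w * ↑(ascProd t (n + 1))⁻¹ * t 0 := by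
      rw [← h9, Units.val_mul]
      simp [mul_assoc]
    have h11 : (↑(ascProd t (n + 1))⁻¹ : A) = ↑(t n)⁻¹ * ↑(ascProd t n)⁻¹ := by
      rw [← Units.val_mul, ← mul_inv_rev]; rfl
    calc (↑(ascProd t (n + 1))⁻¹ : A) * w
        = ↑(t n)⁻¹ * ↑(ascProd t n)⁻¹ *
            (↑(ascProd t n) * w * ↑(ascProd t (n + 1))⁻¹ * t 0) := by rw [← h10, h11]
      _ = _ := by simp only [← mul_assoc, Units.inv_mul_cancel_right]
  apply h.smul_inj
  calc s • (y n * phi (n + 1) t x)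
      = t n * w * (↑(descProd t (n + 1))⁻¹ * t n) * x (n + 1) * ↑(ascProd t (n + 1))⁻¹ := by
        rw [← smul_mul_assoc, h.y_rec n n.lt_succ_self, h.y_last, phi]
        simp only [mul_assoc]
    _ = t n * (w * x (n + 1)) * (↑(descProd t n)⁻¹ * ↑(ascProd t (n + 1))⁻¹) := by
        rw [h5]
        simp only [mul_assoc]
        rw [← mul_assoc (↑(descProd t n)⁻¹ : A), ← h3.eq]
        simp only [mul_assoc]
    _ = s • (x (n + 1) * (↑(t n)⁻¹ * w * ↑(ascProd t (n + 1))⁻¹ * t 0) *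
          ↑(descProd t (n + 1))⁻¹) := by
        rw [h1, h.w_mul_x_last n rfl, ← mul_assoc (t n : A), ← h4]
        simp only [smul_mul_assoc, mul_assoc]
    _ = s • (phi (n + 1) t x * y (n + 1)) := by
        rw [← h6, h.y_last, phi]
        simp only [mul_assoc]

theorem y_mul_phi (h : IsDoubleAffine q s n t w x y) {i : ℕ} (hi : i < n) :
    y i * phi n t x = phi n t x * y (i + 1) := by
  obtain ⟨m, rfl⟩ : ∃ m, n = m + 1 := ⟨n - 1, by omega⟩
  have hi' : i ≤ m := by omega
  induction hi' using Nat.decreasingInduction with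
  | self => exact h.y_mul_phi_base
  | of_succ i hi' ih =>
    have h1 := h.t_mul_phi (i := i) (by omega)
    apply h.smul_inj
    rw [← smul_mul_assoc, h.y_rec i hi, ← mul_smul_comm, h.y_rec (i + 1) (by omega)]
    rw [mul_assoc, h1, ← mul_assoc, mul_assoc (t i : A), ih (by omega), ← mul_assoc, h1]
    simp only [mul_assoc]

end IsDoubleAffine
end DoubleAffine

/-! ### The Hecke algebra acting on tableaux -/

section Coefficients
variable {K : Type*} [Field K] {s : K}

/-- The constant `(1 - s) / (1 - s ^ m)` attached to a difference `m` of contents. -/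
def beta (s : K) (m : ℤ) : K := (1 - s) / (1 - s ^ m)

/-- The coefficient of the exchanged tableau in the action of a generator; `m` is the difference
of contents. It vanishes for `m = 1` and `m = -1`, that is, for adjacent cells. -/
def kappa (s : K) (m : ℤ) : K :=
  if m = -1 then 0 else if m < 0 then 1 else
    s * (1 - s ^ (m + 1)) * (1 - s ^ (m - 1)) / (1 - s ^ m) ^ 2

theorem one_sub_zpow_ne_zero (hs1 : ∀ m : ℤ, s ^ m = 1 → m = 0) {m : ℤ} (hm : m ≠ 0) :
    1 - s ^ m ≠ 0 := fun h => hm (hs1 m (sub_eq_zero.1 h).symm)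

theorem beta_neg (hs : s ≠ 0) (hs1 : ∀ m : ℤ, s ^ m = 1 → m = 0) {m : ℤ} (hm : m ≠ 0) :
    beta s (-m) = 1 - s - beta s m := by
  have h1 := one_sub_zpow_ne_zero hs1 hm
  have h2 : s ^ m - 1 ≠ 0 := by rwa [← neg_sub, neg_ne_zero]
  have h3 : s ^ m ≠ 0 := zpow_ne_zero m hs
  have h4 : 1 - (s ^ m)⁻¹ ≠ 0 := by
    intro h; apply h1; field_simp at h; linear_combination -h
  unfold beta
  rw [zpow_neg]
  field_simp
  ring

/-- The relation between the diagonal coefficients behind the Yang–Baxter equation. -/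
theorem beta_mul_beta (hs1 : ∀ m : ℤ, s ^ m = 1 → m = 0) (hs : s ≠ 0) {a b : ℤ} (ha : a ≠ 0)
    (hb : b ≠ 0) (hab : a + b ≠ 0) :
    beta s a * beta s b = beta s (a + b) * (beta s a + beta s b - (1 - s)) := by
  have h1 := one_sub_zpow_ne_zero hs1 ha
  have h2 := one_sub_zpow_ne_zero hs1 hb
  have h3 := one_sub_zpow_ne_zero hs1 hab
  unfold beta
  rw [zpow_add₀ hs] at *
  field_simp
  ring

theorem kappa_mul_kappa_of_neg (hs : s ≠ 0) (hs1 : ∀ m : ℤ, s ^ m = 1 → m = 0) {m : ℤ}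
    (hm : m < 0) : kappa s m * kappa s (-m) = s + beta s m * beta s (-m) := by
  have h1 := one_sub_zpow_ne_zero hs1 hm.ne
  have h3 : s ^ m ≠ 0 := zpow_ne_zero m hs
  have h4 : 1 - (s ^ m)⁻¹ ≠ 0 := by
    intro h; apply h1; field_simp at h; linear_combination -h
  have h5 : s ^ m - 1 ≠ 0 := by rwa [← neg_sub, neg_ne_zero]
  by_cases h : m = -1
  · subst h
    have h6 : 1 - s ≠ 0 := by simpa using one_sub_zpow_ne_zero hs1 (one_ne_zero)
    have h7 : s - 1 ≠ 0 := by rwa [← neg_sub, neg_ne_zero]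
    simp [kappa, beta]
    field_simp
    ring
  · rw [kappa, if_neg h, if_pos hm, kappa, if_neg (by omega), if_neg (by omega), beta, beta,
      zpow_add₀ hs, zpow_sub₀ hs, zpow_neg, zpow_one]
    field_simp
    ring

theorem kappa_mul_kappa (hs : s ≠ 0) (hs1 : ∀ m : ℤ, s ^ m = 1 → m = 0) {m : ℤ} (hm : m ≠ 0) :
    kappa s m * kappa s (-m) = s + beta s m * beta s (-m) := by
  rcases lt_or_gt_of_ne hm with h | h
  · exact kappa_mul_kappa_of_neg hs hs1 h
  · have := kappa_mul_kappa_of_neg hs hs1 (neg_lt_zero.2 h)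
    rw [neg_neg] at this
    rw [mul_comm, this, mul_comm]

end Coefficients

section Swap
variable {ι : Type*} [DecidableEq ι]

theorem swap_swap_comm {p r u v : ι} (h1 : p ≠ u) (h2 : p ≠ v) (h3 : r ≠ u) (h4 : r ≠ v) (x : ι) :
    Equiv.swap p r (Equiv.swap u v x) = Equiv.swap u v (Equiv.swap p r x) := by
  refine DFunLike.congr_fun (Equiv.Perm.Disjoint.commute (f := Equiv.swap p r)
    (g := Equiv.swap u v) fun x => ?_).eq x
  by_cases hx : x = p ∨ x = r
  · right; rcases hx with rfl | rfl <;> exact Equiv.swap_apply_of_ne_of_ne ‹_› ‹_›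
  · left; push Not at hx; exact Equiv.swap_apply_of_ne_of_ne hx.1 hx.2

theorem swap_swap_swap {p r u : ι} (hpr : p ≠ r) (hru : r ≠ u) (hpu : p ≠ u) (x : ι) :
    Equiv.swap p r (Equiv.swap r u (Equiv.swap p r x)) =
      Equiv.swap r u (Equiv.swap p r (Equiv.swap r u x)) := by
  have h4 := Equiv.swap_mul_swap_mul_swap hru.symm hpu.symm
  have h5 := Equiv.swap_mul_swap_mul_swap hpr hpu
  rw [Equiv.swap_comm p u, ← h5, Equiv.swap_comm r p, Equiv.swap_comm u r] at h4
  exact DFunLike.congr_fun h4 x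

end Swap

section DiagOp
variable {K : Type*} [Field K] {ι : Type*}

/-- The operator acting on the basis vector `c` by `s ^ (c p)`. -/
def diagOp (s : K) (p : ι) : Module.End K ((ι → ℤ) →₀ K) :=
  Finsupp.linearCombination K fun c => s ^ c p • Finsupp.single c 1

theorem diagOp_single (s : K) (p : ι) (c : ι → ℤ) :
    diagOp s p (Finsupp.single c 1) = s ^ c p • Finsupp.single c 1 := by
  simp [diagOp]

end DiagOp

section PairOp
variable {K : Type*} [Field K] {s : K} {ι : Type*} [DecidableEq ι]

/-- The model of a Hecke generator on the vector space with basis the integer vectors `c` (to be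
thought of as vectors of contents), at the pair of positions `p, r`. -/
def pairOp (s : K) (p r : ι) : Module.End K ((ι → ℤ) →₀ K) :=
  Finsupp.linearCombination K fun c =>
    kappa s (c r - c p) • Finsupp.single (c ∘ Equiv.swap p r) 1 -
      beta s (c r - c p) • Finsupp.single c 1

theorem pairOp_single (s : K) (p r : ι) (c : ι → ℤ) :
    pairOp s p r (Finsupp.single c 1) =
      kappa s (c r - c p) • Finsupp.single (c ∘ Equiv.swap p r) 1 -
        beta s (c r - c p) • Finsupp.single c 1 := by
  simp [pairOp]

theorem comp_swap_comp_swap (c : ι → ℤ) (p r : ι) :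
    (c ∘ Equiv.swap p r) ∘ Equiv.swap p r = c := by
  ext x; simp

theorem pairOp_single_swap (s : K) (p r : ι) (c : ι → ℤ) :
    pairOp s p r (Finsupp.single (c ∘ Equiv.swap p r) 1) =
      kappa s (-(c r - c p)) • Finsupp.single c 1 -
        beta s (-(c r - c p)) • Finsupp.single (c ∘ Equiv.swap p r) 1 := by
  rw [pairOp_single, comp_swap_comp_swap]
  simp

theorem pairOp_quad (hs : s ≠ 0) (hs1 : ∀ m : ℤ, s ^ m = 1 → m = 0) {p r : ι} {c : ι → ℤ}
    (h : c p ≠ c r) : pairOp s p r (pairOp s p r (Finsupp.single c 1)) =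
      (s - 1) • pairOp s p r (Finsupp.single c 1) + s • Finsupp.single c 1 := by
  have hm : c r - c p ≠ 0 := sub_ne_zero.2 h.symm
  rw [pairOp_single, map_sub, map_smul, map_smul, pairOp_single_swap, pairOp_single]
  have h1 := kappa_mul_kappa hs hs1 hm
  rw [beta_neg hs hs1 hm] at *
  match_scalars
  · linear_combination h1
  · ring

/-- The recursion `T_i L_{i+1} T_i = s L_i` of the Jucys–Murphy operators, on one basis vector. -/
theorem pairOp_diagOp (hs : s ≠ 0) (hs1 : ∀ m : ℤ, s ^ m = 1 → m = 0) {p r : ι} {c : ι → ℤ}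
    (h : c p ≠ c r) : pairOp s p r (diagOp s r (pairOp s p r (Finsupp.single c 1))) =
      s • diagOp s p (Finsupp.single c 1) := by
  have hm : c r - c p ≠ 0 := sub_ne_zero.2 h.symm
  have h0 : beta s (c r - c p) * s ^ c r + beta s (-(c r - c p)) * s ^ c p = 0 := by
    have h1 := one_sub_zpow_ne_zero hs1 hm
    have h2 : s ^ c r = s ^ (c r - c p) * s ^ c p := by rw [← zpow_add₀ hs]; simp
    rw [beta_neg hs hs1 hm, h2, beta]
    field_simp
    ring
  rw [pairOp_single, map_sub, map_smul, map_smul, diagOp_single, diagOp_single, diagOp_single,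
    map_sub, map_smul, map_smul, map_smul, map_smul, pairOp_single_swap, pairOp_single]
  have h1 := kappa_mul_kappa hs hs1 hm
  simp only [Function.comp, Equiv.swap_apply_right]
  match_scalars
  · linear_combination s ^ c p * h1 + beta s (c r - c p) * h0
  · linear_combination -kappa s (c r - c p) * h0

theorem pairOp_comm (s : K) {p r u v : ι} (h1 : p ≠ u) (h2 : p ≠ v) (h3 : r ≠ u) (h4 : r ≠ v)
    (c : ι → ℤ) : pairOp s p r (pairOp s u v (Finsupp.single c 1)) =
      pairOp s u v (pairOp s p r (Finsupp.single c 1)) := by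
  have h : (c ∘ Equiv.swap p r) ∘ Equiv.swap u v = (c ∘ Equiv.swap u v) ∘ Equiv.swap p r := by
    ext x
    exact congrArg c (swap_swap_comm h1 h2 h3 h4 x)
  simp only [pairOp_single, map_sub, map_smul, h, Function.comp_apply,
    Equiv.swap_apply_of_ne_of_ne h1 h2, Equiv.swap_apply_of_ne_of_ne h3 h4,
    Equiv.swap_apply_of_ne_of_ne h1.symm h3.symm, Equiv.swap_apply_of_ne_of_ne h2.symm h4.symm]
  module

/-- The braid relation on a vector whose three relevant entries are distinct: a form of the
Yang–Baxter equation. -/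
theorem pairOp_braid (hs : s ≠ 0) (hs1 : ∀ m : ℤ, s ^ m = 1 → m = 0) {p r u : ι} (hpr : p ≠ r)
    (hru : r ≠ u) (hpu : p ≠ u) {c : ι → ℤ} (h1 : c p ≠ c r) (h2 : c r ≠ c u) (h3 : c p ≠ c u) :
    pairOp s p r (pairOp s r u (pairOp s p r (Finsupp.single c 1))) =
      pairOp s r u (pairOp s p r (pairOp s r u (Finsupp.single c 1))) := by
  have hm1 : c r - c p ≠ 0 := sub_ne_zero.2 h1.symm
  have hm2 : c u - c r ≠ 0 := sub_ne_zero.2 h2.symm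
  have hm3 : c r - c p + (c u - c r) ≠ 0 := by
    rw [sub_add_sub_cancel']; exact sub_ne_zero.2 h3.symm
  have hb := beta_mul_beta hs1 hs hm1 hm2 hm3
  rw [sub_add_sub_cancel'] at hb
  have hk1 := kappa_mul_kappa hs hs1 hm1
  have hk2 := kappa_mul_kappa hs hs1 hm2
  rw [beta_neg hs hs1 hm1] at hk1
  rw [beta_neg hs hs1 hm2] at hk2
  have e0 : (((c ∘ Equiv.swap p r) ∘ Equiv.swap r u) ∘ Equiv.swap p r) =
      (((c ∘ Equiv.swap r u) ∘ Equiv.swap p r) ∘ Equiv.swap r u) := by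
    ext x
    exact congrArg c (swap_swap_swap hpr hru hpu x)
  simp only [pairOp_single, map_sub, map_smul, comp_swap_comp_swap, e0, Function.comp_apply,
    Equiv.swap_apply_left, Equiv.swap_apply_right, Equiv.swap_apply_of_ne_of_ne hpr hpu,
    Equiv.swap_apply_of_ne_of_ne hpu.symm hru.symm]
  have n1 : c p - c r = -(c r - c p) := by ring
  have n2 : c r - c u = -(c u - c r) := by ring
  rw [n1, n2, beta_neg hs hs1 hm1, beta_neg hs hs1 hm2]
  generalize kappa s (-(c r - c p)) = k1' at *
  generalize kappa s (-(c u - c r)) = k2' at *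
  generalize kappa s (c r - c p) = k1 at *
  generalize kappa s (c u - c r) = k2 at *
  generalize kappa s (c u - c p) = k3 at *
  generalize beta s (c r - c p) = b1 at *
  generalize beta s (c u - c r) = b2 at *
  generalize beta s (c u - c p) = b3 at *
  match_scalars
  · ring
  · ring
  · linear_combination -b3 * hk1 + b3 * hk2 + (b2 - b1) * hb
  · linear_combination k1 * hb
  · ring
  · linear_combination -k2 * hb

end PairOp

section Transfer
variable {K : Type*} [Field K] {s : K} {μ : YoungDiagram} {n : ℕ}

/-- The embedding of `V` sending a tableau to its vector of contents. -/
def contentEmb (K : Type*) [Field K] (μ : YoungDiagram) (N : ℕ) :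
    V K μ N →ₗ[K] ((Fin N → ℤ) →₀ K) :=
  Finsupp.lmapDomain K K fun T => content T.1

theorem contentEmb_single (T : Tab μ (n + 1)) :
    contentEmb K μ (n + 1) (Finsupp.single T 1) = Finsupp.single (content T.1) 1 := by
  simp [contentEmb]

theorem contentEmb_injective : Function.Injective (contentEmb K μ (n + 1)) :=
  Finsupp.mapDomain_injective fun T T' h =>
    Subtype.ext (T.2.ext_content T'.2 fun i => congrFun h i)

theorem heckeT_single (T : Tab μ (n + 1)) (i : Fin n) :
    heckeT μ s i (Finsupp.single T 1) = heckeOnTab s i T := by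
  simp [heckeT]

/-- The generators of the Hecke algebra act on the vectors of contents by the uniform operators
`pairOp`. Entries in the same row or column have contents that differ by `1`, and there the vector
of the exchanged contents, which belongs to no tableau, has coefficient `0`. -/
theorem contentEmb_heckeT (hs : s ≠ 0) (hs1 : ∀ m : ℤ, s ^ m = 1 → m = 0) (i : Fin n)
    (v : V K μ (n + 1)) :
    contentEmb K μ (n + 1) (heckeT μ s i v) =
      pairOp s i.castSucc i.succ (contentEmb K μ (n + 1) v) := by
  have h1 : 1 - s ≠ 0 := by simpa using one_sub_zpow_ne_zero hs1 one_ne_zero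
  have h1' : s - 1 ≠ 0 := by rwa [← neg_sub, neg_ne_zero]
  suffices contentEmb K μ (n + 1) ∘ₗ heckeT μ s i =
      pairOp s i.castSucc i.succ ∘ₗ contentEmb K μ (n + 1) from LinearMap.congr_fun this v
  ext1 T
  apply LinearMap.ext_ring
  simp only [LinearMap.comp_apply, Finsupp.lsingle_apply]
  rw [heckeT_single, contentEmb_single, pairOp_single]
  have h2 := T.2.consecutive i
  by_cases hr : row T.1 i.castSucc = row T.1 i.succ
  · rw [heckeOnTab, dif_pos hr, map_smul, contentEmb_single,
      show content T.1 i.succ - content T.1 i.castSucc = -1 by unfold content at *; omega]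
    have : beta s (-1) = -s := by
      simp [beta]; field_simp; ring
    simp [kappa, this]
  by_cases hc : col T.1 i.castSucc = col T.1 i.succ
  · rw [heckeOnTab, dif_neg hr, dif_pos hc, map_neg, contentEmb_single,
      show content T.1 i.succ - content T.1 i.castSucc = 1 by unfold content at *; omega]
    simp [beta, h1, kappa]
  rw [heckeOnTab, dif_neg hr, dif_neg hc]
  dsimp only
  split_ifs with hlt
  · rw [map_sub, map_smul, contentEmb_single, contentEmb_single, kappa, if_neg, if_pos, one_smul]
    · rfl
    all_goals unfold content; omega
  · rw [map_add, map_smul, map_smul, contentEmb_single, contentEmb_single, kappa, if_neg, if_neg,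
      beta, ← neg_sub 1 s, neg_div, neg_smul, neg_add_eq_sub]
    · rfl
    all_goals unfold content; omega

theorem hecke_ext {f g : Module.End K (V K μ (n + 1))}
    (h : ∀ T : Tab μ (n + 1), contentEmb K μ (n + 1) (f (Finsupp.single T 1)) =
      contentEmb K μ (n + 1) (g (Finsupp.single T 1))) : f = g := by
  ext1 T
  apply LinearMap.ext_ring
  exact contentEmb_injective (h T)

theorem heckeT_quad (hs : s ≠ 0) (hs1 : ∀ m : ℤ, s ^ m = 1 → m = 0) (i : Fin n) :
    heckeT μ s i * heckeT μ s i = (s - 1) • heckeT μ s i + s • 1 := by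
  refine hecke_ext fun T => ?_
  simp only [Module.End.mul_apply, LinearMap.add_apply, LinearMap.smul_apply, map_add, map_smul,
    contentEmb_heckeT hs hs1, contentEmb_single, Module.End.one_apply]
  exact pairOp_quad hs hs1 (T.2.content_ne Fin.castSucc_lt_succ (by simp))

theorem heckeT_comm (hs : s ≠ 0) (hs1 : ∀ m : ℤ, s ^ m = 1 → m = 0) {i j : Fin n}
    (hij : i.val + 2 ≤ j.val) :
    heckeT μ s i * heckeT μ s j = heckeT μ s j * heckeT μ s i := by
  refine hecke_ext fun T => ?_
  simp only [Module.End.mul_apply, contentEmb_heckeT hs hs1, contentEmb_single]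
  apply pairOp_comm <;> simp [Fin.ext_iff] <;> omega

theorem heckeT_braid (hs : s ≠ 0) (hs1 : ∀ m : ℤ, s ^ m = 1 → m = 0) {i j : Fin n}
    (hij : i.val + 1 = j.val) :
    heckeT μ s i * heckeT μ s j * heckeT μ s i = heckeT μ s j * heckeT μ s i * heckeT μ s j := by
  refine hecke_ext fun T => ?_
  simp only [Module.End.mul_apply, contentEmb_heckeT hs hs1, contentEmb_single]
  have e : j.castSucc = i.succ := by ext; simp [hij]
  rw [e]
  apply pairOp_braid hs hs1
  · exact Fin.castSucc_lt_succ.ne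
  · simp [Fin.ext_iff]; omega
  · simp [Fin.ext_iff]; omega
  · exact T.2.content_ne Fin.castSucc_lt_succ (by simp)
  · exact T.2.content_ne (by rw [Fin.lt_def]; simp; omega) (by simp; omega)
  · exact T.2.content_ne (by rw [Fin.lt_def]; simp; omega) (by simp; omega)

/-- The Jucys–Murphy operator, diagonal in the basis of tableaux. -/
def jucysMurphy (μ : YoungDiagram) (s : K) (p : Fin (n + 1)) : Module.End K (V K μ (n + 1)) :=
  Finsupp.linearCombination K fun T => s ^ content T.1 p • Finsupp.single T 1

theorem contentEmb_jucysMurphy (p : Fin (n + 1)) (v : V K μ (n + 1)) :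
    contentEmb K μ (n + 1) (jucysMurphy μ s p v) = diagOp s p (contentEmb K μ (n + 1) v) := by
  suffices contentEmb K μ (n + 1) ∘ₗ jucysMurphy μ s p =
      diagOp s p ∘ₗ contentEmb K μ (n + 1) from LinearMap.congr_fun this v
  ext1 T
  apply LinearMap.ext_ring
  simp only [LinearMap.comp_apply, Finsupp.lsingle_apply, jucysMurphy,
    Finsupp.linearCombination_single, one_smul, map_smul, contentEmb_single, diagOp_single]

theorem heckeT_jucysMurphy (hs : s ≠ 0) (hs1 : ∀ m : ℤ, s ^ m = 1 → m = 0) (i : Fin n) :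
    heckeT μ s i * jucysMurphy μ s i.succ * heckeT μ s i = s • jucysMurphy μ s i.castSucc := by
  refine hecke_ext fun T => ?_
  simp only [Module.End.mul_apply, LinearMap.smul_apply, map_smul,
    contentEmb_heckeT hs hs1, contentEmb_jucysMurphy, contentEmb_single]
  exact pairOp_diagOp hs hs1 (T.2.content_ne Fin.castSucc_lt_succ (by simp))

theorem jucysMurphy_last : jucysMurphy μ s (Fin.last n) = 1 := by
  ext1 T
  apply LinearMap.ext_ring
  simp [jucysMurphy, T.2.content_last]

end Transfer

/-! ### Divided differences -/

section FieldIdentities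
variable {L : Type*} [Field L]

/-- The Demazure–Lusztig part `(1 - c) y (f - g f) / (x - y)` over a field, for a ring
endomorphism `g` exchanging `x` and `y`. -/
def fieldDelta (c x y : L) (g : L →+* L) (f : L) : L := (1 - c) * (y * ((f - g f) / (x - y)))

variable {c x y z u : L} {g h : L →+* L}

theorem fieldDelta_sq (hc : g c = c) (hx : g x = y) (hy : g y = x) (hg : ∀ f, g (g f) = f)
    (hxy : x - y ≠ 0) (f : L) :
    fieldDelta c x y g (fieldDelta c x y g f) = (c - 1) * fieldDelta c x y g f := by
  have hyx : y - x ≠ 0 := by rwa [← neg_sub, neg_ne_zero]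
  simp only [fieldDelta, map_mul, map_sub, map_div₀, map_one, hc, hx, hy, hg]
  field_simp
  ring

theorem fieldDelta_swap (hc : g c = c) (hx : g x = y) (hy : g y = x) (hg : ∀ f, g (g f) = f)
    (hxy : x - y ≠ 0) (f : L) :
    fieldDelta c x y g (g f) + g (fieldDelta c x y g f) = (c - 1) * (g f - f) := by
  have hyx : y - x ≠ 0 := by rwa [← neg_sub, neg_ne_zero]
  simp only [fieldDelta, map_mul, map_sub, map_div₀, map_one, hc, hx, hy, hg]
  field_simp
  ring

theorem fieldDelta_comm (hc : g c = c) (hc' : h c = c) (hz : g z = z) (hu : g u = u)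
    (hx : h x = x) (hy : h y = y) (hgh : ∀ f, g (h f) = h (g f))
    (hxy : x - y ≠ 0) (hzu : z - u ≠ 0) (f : L) :
    fieldDelta c x y g (fieldDelta c z u h f) = fieldDelta c z u h (fieldDelta c x y g f) := by
  simp only [fieldDelta, map_mul, map_sub, map_div₀, map_one, hc, hc', hx, hy, hz, hu, hgh]
  field_simp
  ring

/-- The part of the braid relation that is linear in the first generator. -/
theorem fieldDelta_braid_one (hc : g c = c) (hc' : h c = c) (hgx : g x = y) (hgy : g y = x)
    (hgz : g z = z) (hhx : h x = x) (hhy : h y = z) (hhz : h z = y) (hg : ∀ f, g (g f) = f)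
    (hgh : ∀ f, g (h (g f)) = h (g (h f)))
    (hxy : x - y ≠ 0) (hyz : y - z ≠ 0) (hxz : x - z ≠ 0) (f : L) :
    fieldDelta c x y g (fieldDelta c y z h (g f)) + g (fieldDelta c y z h (fieldDelta c x y g f)) +
      (c - 1) * g (fieldDelta c y z h (g f)) =
      fieldDelta c y z h (g (fieldDelta c y z h f)) := by
  have hyx : y - x ≠ 0 := by rwa [← neg_sub, neg_ne_zero]
  have hzy : z - y ≠ 0 := by rwa [← neg_sub, neg_ne_zero]
  have hzx : z - x ≠ 0 := by rwa [← neg_sub, neg_ne_zero]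
  simp only [fieldDelta, map_mul, map_sub, map_div₀, map_one, hc, hc', hgx, hgy, hgz, hhx, hhy,
    hhz, hg, hgh]
  field_simp
  ring

/-- The part of the braid relation that is linear in the second generator. -/
theorem fieldDelta_braid_two (hc : g c = c) (hc' : h c = c) (hgx : g x = y) (hgy : g y = x)
    (hgz : g z = z) (hhx : h x = x) (hhy : h y = z) (hhz : h z = y)
    (hh : ∀ f, h (h f) = f) (hgh : ∀ f, g (h (g f)) = h (g (h f)))
    (hxy : x - y ≠ 0) (hyz : y - z ≠ 0) (hxz : x - z ≠ 0) (f : L) :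
    fieldDelta c y z h (fieldDelta c x y g (h f)) + h (fieldDelta c x y g (fieldDelta c y z h f)) +
      (c - 1) * h (fieldDelta c x y g (h f)) =
      fieldDelta c x y g (h (fieldDelta c x y g f)) := by
  have hyx : y - x ≠ 0 := by rwa [← neg_sub, neg_ne_zero]
  have hzy : z - y ≠ 0 := by rwa [← neg_sub, neg_ne_zero]
  have hzx : z - x ≠ 0 := by rwa [← neg_sub, neg_ne_zero]
  simp only [fieldDelta, map_mul, map_sub, map_div₀, map_one, hc, hc', hgx, hgy, hgz, hhx, hhy,
    hhz, hh, hgh]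
  field_simp
  ring

/-- The constant part of the braid relation. -/
theorem fieldDelta_braid_const (hc : g c = c) (hc' : h c = c) (hgx : g x = y) (hgy : g y = x)
    (hgz : g z = z) (hhx : h x = x) (hhy : h y = z) (hhz : h z = y) (hg : ∀ f, g (g f) = f)
    (hh : ∀ f, h (h f) = f) (hgh : ∀ f, g (h (g f)) = h (g (h f)))
    (hxy : x - y ≠ 0) (hyz : y - z ≠ 0) (hxz : x - z ≠ 0) (f : L) :
    fieldDelta c x y g (fieldDelta c y z h (fieldDelta c x y g f)) +
      c * g (fieldDelta c y z h (g f)) =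
    fieldDelta c y z h (fieldDelta c x y g (fieldDelta c y z h f)) +
      c * h (fieldDelta c x y g (h f)) := by
  have hyx : y - x ≠ 0 := by rwa [← neg_sub, neg_ne_zero]
  have hzy : z - y ≠ 0 := by rwa [← neg_sub, neg_ne_zero]
  have hzx : z - x ≠ 0 := by rwa [← neg_sub, neg_ne_zero]
  simp only [fieldDelta, map_mul, map_sub, map_div₀, map_one, hc, hc', hgx, hgy, hgz, hhx, hhy,
    hhz, hg, hh, hgh]
  field_simp
  ring

end FieldIdentities

section Polynomial
variable {K : Type*} [Field K] {n : ℕ}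

open MvPolynomial

theorem sX_apply (i : Fin n) (f : MvPolynomial (Fin (n + 1)) K) :
    sX K i f = rename (Equiv.swap i.castSucc i.succ) f := rfl

theorem sX_X (i : Fin n) (j : Fin (n + 1)) :
    sX K i (X j) = X (Equiv.swap i.castSucc i.succ j) := by simp [sX_apply]

theorem sX_mul (i : Fin n) (f g : MvPolynomial (Fin (n + 1)) K) :
    sX K i (f * g) = sX K i f * sX K i g := by simp [sX_apply]

theorem sX_sX (i : Fin n) (f : MvPolynomial (Fin (n + 1)) K) : sX K i (sX K i f) = f := by
  rw [sX_apply, sX_apply, rename_rename]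
  have : (Equiv.swap i.castSucc i.succ : Fin (n + 1) → Fin (n + 1)) ∘
      Equiv.swap i.castSucc i.succ = id := by ext x; simp
  rw [this, rename_id_apply]

theorem sX_comm {i j : Fin n} (hij : i.val + 2 ≤ j.val) (f : MvPolynomial (Fin (n + 1)) K) :
    sX K i (sX K j f) = sX K j (sX K i f) := by
  simp only [sX_apply, rename_rename]
  congr 2
  ext1 x
  apply swap_swap_comm <;>
    simp only [ne_eq, Fin.ext_iff, Fin.val_castSucc, Fin.val_succ] <;> omega

theorem castSucc_eq_succ {i j : Fin n} (hij : i.val + 1 = j.val) : j.castSucc = i.succ := by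
  ext; simp [hij]

theorem swap_apply_adjacent {i j : Fin n} (hij : i.val + 1 = j.val) :
    Equiv.swap i.castSucc i.succ j.succ = j.succ ∧
      Equiv.swap i.succ j.succ i.castSucc = i.castSucc := by
  constructor <;> apply Equiv.swap_apply_of_ne_of_ne <;>
    simp only [ne_eq, Fin.ext_iff, Fin.val_castSucc, Fin.val_succ] <;> omega

theorem sX_braid {i j : Fin n} (hij : i.val + 1 = j.val) (f : MvPolynomial (Fin (n + 1)) K) :
    sX K i (sX K j (sX K i f)) = sX K j (sX K i (sX K j f)) := by
  simp only [sX_apply, rename_rename]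
  congr 2
  rw [castSucc_eq_succ hij]
  ext1 x
  apply swap_swap_swap <;>
    simp only [ne_eq, Fin.ext_iff, Fin.val_castSucc, Fin.val_succ] <;> omega

theorem deltaX_apply (s : K) (i : Fin n) (f : MvPolynomial (Fin (n + 1)) K) :
    deltaX s i f = (1 - s) • (X i.succ * divDiff K i f) := by
  simp [deltaX, rightProd]

/-- An algebra endomorphism that intertwines two exchanges of variables intertwines the
corresponding operators `δ`. -/
theorem map_deltaX (s : K) {i j : Fin n}
    (φ : MvPolynomial (Fin (n + 1)) K →ₐ[K] MvPolynomial (Fin (n + 1)) K)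
    (h0 : φ (X i.castSucc) = X j.castSucc) (h1 : φ (X i.succ) = X j.succ)
    (hφ : ∀ f, φ (sX K i f) = sX K j (φ f)) (f : MvPolynomial (Fin (n + 1)) K) :
    φ (deltaX s i f) = deltaX s j (φ f) := by
  have h2 : φ (divDiff K i f) = divDiff K j (φ f) := by
    apply mul_left_cancel₀ (X_sub_X_ne_zero K j)
    rw [divDiff_spec, ← h0, ← h1, ← map_sub, ← map_mul, divDiff_spec, map_sub, hφ]
  rw [deltaX_apply, deltaX_apply, map_smul, map_mul, h1, h2]

/-- The extension of `s_i^x` to rational functions. -/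
def sFrac (K : Type*) [Field K] (i : Fin n) : FractionRing (MvPolynomial (Fin (n + 1)) K) →+*
    FractionRing (MvPolynomial (Fin (n + 1)) K) :=
  IsFractionRing.lift (A := MvPolynomial (Fin (n + 1)) K)
    (g := (algebraMap (MvPolynomial (Fin (n + 1)) K)
      (FractionRing (MvPolynomial (Fin (n + 1)) K))).comp
        (rename (R := K) (Equiv.swap i.castSucc i.succ)).toRingHom)
    (by
      rw [RingHom.coe_comp]
      exact (IsFractionRing.injective (MvPolynomial (Fin (n + 1)) K) _).comp
        (rename_injective _ (Equiv.injective _)))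

/-- The embedding of polynomials in rational functions. -/
local notation "frac" => algebraMap (MvPolynomial (Fin (n + 1)) K)
  (FractionRing (MvPolynomial (Fin (n + 1)) K))

theorem sFrac_algebraMap (i : Fin n) (f : MvPolynomial (Fin (n + 1)) K) :
    sFrac K i (frac f) = frac (sX K i f) := by
  rw [sFrac, IsFractionRing.lift_algebraMap]
  rfl

theorem frac_X_sub_X {i j : Fin (n + 1)} (hij : i ≠ j) :
    frac (X i) - frac (X j) ≠ 0 := by
  rw [sub_ne_zero]
  exact fun h => hij (X_injective (IsFractionRing.injective _ _ h))

theorem algebraMap_deltaX (s : K) (i : Fin n) (f : MvPolynomial (Fin (n + 1)) K) :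
    frac (deltaX s i f) = fieldDelta (frac (C s)) (frac (X i.castSucc)) (frac (X i.succ))
      (sFrac K i) (frac f) := by
  have h1 := congrArg frac (divDiff_spec K i f)
  rw [map_mul, map_sub, map_sub] at h1
  have h2 := frac_X_sub_X (K := K) (Fin.castSucc_lt_succ (i := i)).ne
  rw [deltaX_apply, smul_eq_C_mul, map_mul, map_mul, fieldDelta, sFrac_algebraMap, ← h1,
    mul_div_cancel_left₀ _ h2]
  simp

theorem sFrac_C (i : Fin n) (c : K) : sFrac K i (frac (C c)) = frac (C c) := by
  rw [sFrac_algebraMap]; simp [sX_apply]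

theorem sFrac_X (i : Fin n) (j : Fin (n + 1)) :
    sFrac K i (frac (X j)) = frac (X (Equiv.swap i.castSucc i.succ j)) := by
  rw [sFrac_algebraMap, sX_X]

theorem sFrac_sFrac (i : Fin n) (f) : sFrac K i (sFrac K i f) = f := by
  suffices (sFrac K i).comp (sFrac K i) = RingHom.id _ from RingHom.congr_fun this f
  refine IsFractionRing.ringHom_ext (A := MvPolynomial (Fin (n + 1)) K) fun x => ?_
  simp [sFrac_algebraMap, sX_sX]

theorem sFrac_comm {i j : Fin n} (hij : i.val + 2 ≤ j.val) (f) :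
    sFrac K i (sFrac K j f) = sFrac K j (sFrac K i f) := by
  suffices (sFrac K i).comp (sFrac K j) = (sFrac K j).comp (sFrac K i) from RingHom.congr_fun this f
  refine IsFractionRing.ringHom_ext (A := MvPolynomial (Fin (n + 1)) K) fun x => ?_
  simp [sFrac_algebraMap, sX_comm hij]

theorem sFrac_braid {i j : Fin n} (hij : i.val + 1 = j.val) (f) :
    sFrac K i (sFrac K j (sFrac K i f)) = sFrac K j (sFrac K i (sFrac K j f)) := by
  suffices (sFrac K i).comp ((sFrac K j).comp (sFrac K i)) =
    (sFrac K j).comp ((sFrac K i).comp (sFrac K j)) from RingHom.congr_fun this f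
  refine IsFractionRing.ringHom_ext (A := MvPolynomial (Fin (n + 1)) K) fun x => ?_
  simp [sFrac_algebraMap, sX_braid hij]

theorem deltaX_deltaX (s : K) (i : Fin n) (f : MvPolynomial (Fin (n + 1)) K) :
    deltaX s i (deltaX s i f) = (s - 1) • deltaX s i f := by
  apply IsFractionRing.injective _ (FractionRing (MvPolynomial (Fin (n + 1)) K))
  simp only [smul_eq_C_mul, map_mul, map_sub, map_one, algebraMap_deltaX]
  apply fieldDelta_sq <;> simp [sFrac_C, sFrac_X, sFrac_sFrac]
  exact frac_X_sub_X (Fin.castSucc_lt_succ (i := i)).ne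

theorem deltaX_sX (s : K) (i : Fin n) (f : MvPolynomial (Fin (n + 1)) K) :
    deltaX s i (sX K i f) + sX K i (deltaX s i f) = (s - 1) • (sX K i f - f) := by
  apply IsFractionRing.injective _ (FractionRing (MvPolynomial (Fin (n + 1)) K))
  simp only [smul_eq_C_mul, map_mul, map_add, map_sub, map_one, algebraMap_deltaX,
    ← sFrac_algebraMap]
  apply fieldDelta_swap <;> simp [sFrac_C, sFrac_X, sFrac_sFrac]
  exact frac_X_sub_X (Fin.castSucc_lt_succ (i := i)).ne

theorem deltaX_X_succ_mul (s : K) (i : Fin n) (f : MvPolynomial (Fin (n + 1)) K) :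
    deltaX s i (X i.succ * f) + (1 - s) • (X i.succ * f) = X i.castSucc * deltaX s i f := by
  apply IsFractionRing.injective _ (FractionRing (MvPolynomial (Fin (n + 1)) K))
  have h := frac_X_sub_X (K := K) (Fin.castSucc_lt_succ (i := i)).ne
  simp only [smul_eq_C_mul, map_mul, map_add, map_sub, map_one, algebraMap_deltaX, fieldDelta,
    sFrac_X, Equiv.swap_apply_right]
  field_simp
  ring

theorem swap_apply_far {i j : Fin n} (hij : i.val + 2 ≤ j.val ∨ j.val + 2 ≤ i.val) :
    Equiv.swap i.castSucc i.succ j.castSucc = j.castSucc ∧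
      Equiv.swap i.castSucc i.succ j.succ = j.succ := by
  constructor <;> apply Equiv.swap_apply_of_ne_of_ne <;>
    simp only [ne_eq, Fin.ext_iff, Fin.val_castSucc, Fin.val_succ] <;> omega

theorem deltaX_sX_far (s : K) {i j : Fin n} (hij : i.val + 2 ≤ j.val ∨ j.val + 2 ≤ i.val)
    (f : MvPolynomial (Fin (n + 1)) K) :
    sX K i (deltaX s j f) = deltaX s j (sX K i f) := by
  have h := swap_apply_far hij
  refine map_deltaX s (rename (Equiv.swap i.castSucc i.succ)) (by simp [h.1]) (by simp [h.2]) ?_ f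
  intro f
  rcases hij with hij | hij
  · exact sX_comm hij f
  · exact (sX_comm hij f).symm

theorem deltaX_comm (s : K) {i j : Fin n} (hij : i.val + 2 ≤ j.val)
    (f : MvPolynomial (Fin (n + 1)) K) :
    deltaX s i (deltaX s j f) = deltaX s j (deltaX s i f) := by
  apply IsFractionRing.injective _ (FractionRing (MvPolynomial (Fin (n + 1)) K))
  have h1 := swap_apply_far (Or.inl hij)
  have h2 := swap_apply_far (Or.inr hij)
  simp only [algebraMap_deltaX]
  apply fieldDelta_comm <;> simp [sFrac_C, sFrac_X, h1, h2, sFrac_comm hij]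
  · exact frac_X_sub_X (Fin.castSucc_lt_succ (i := i)).ne
  · exact frac_X_sub_X (Fin.castSucc_lt_succ (i := j)).ne

theorem sX_sX_deltaX (s : K) {i j : Fin n} (hij : i.val + 1 = j.val)
    (f : MvPolynomial (Fin (n + 1)) K) :
    sX K j (sX K i (deltaX s j f)) = deltaX s i (sX K j (sX K i f)) := by
  have h := swap_apply_adjacent hij
  have e := castSucc_eq_succ hij
  refine map_deltaX s ((rename (Equiv.swap j.castSucc j.succ)).comp
    (rename (Equiv.swap i.castSucc i.succ))) (by simp [e, h]) (by simp [e, h]) ?_ f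
  intro f
  exact (sX_braid hij _).symm

theorem sX_sX_deltaX' (s : K) {i j : Fin n} (hij : i.val + 1 = j.val)
    (f : MvPolynomial (Fin (n + 1)) K) :
    sX K i (sX K j (deltaX s i f)) = deltaX s j (sX K i (sX K j f)) := by
  have h := swap_apply_adjacent hij
  have e := castSucc_eq_succ hij
  refine map_deltaX s ((rename (Equiv.swap i.castSucc i.succ)).comp
    (rename (Equiv.swap j.castSucc j.succ))) (by simp [e, h]) (by simp [e, h]) ?_ f
  intro f
  exact sX_braid hij _

theorem deltaX_braid_one (s : K) {i j : Fin n} (hij : i.val + 1 = j.val)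
    (f : MvPolynomial (Fin (n + 1)) K) :
    deltaX s i (deltaX s j (sX K i f)) + sX K i (deltaX s j (deltaX s i f)) +
      (s - 1) • sX K i (deltaX s j (sX K i f)) = deltaX s j (sX K i (deltaX s j f)) := by
  apply IsFractionRing.injective _ (FractionRing (MvPolynomial (Fin (n + 1)) K))
  have h := swap_apply_adjacent hij
  have e := castSucc_eq_succ hij
  simp only [smul_eq_C_mul, map_mul, map_add, map_sub, map_one, algebraMap_deltaX,
    ← sFrac_algebraMap, e]
  apply fieldDelta_braid_one <;> simp [sFrac_C, sFrac_X, e, h, sFrac_sFrac, sFrac_braid hij] <;>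
    apply frac_X_sub_X <;> simp only [ne_eq, Fin.ext_iff, Fin.val_castSucc, Fin.val_succ] <;> omega

theorem deltaX_braid_two (s : K) {i j : Fin n} (hij : i.val + 1 = j.val)
    (f : MvPolynomial (Fin (n + 1)) K) :
    deltaX s j (deltaX s i (sX K j f)) + sX K j (deltaX s i (deltaX s j f)) +
      (s - 1) • sX K j (deltaX s i (sX K j f)) = deltaX s i (sX K j (deltaX s i f)) := by
  apply IsFractionRing.injective _ (FractionRing (MvPolynomial (Fin (n + 1)) K))
  have h := swap_apply_adjacent hij
  have e := castSucc_eq_succ hij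
  simp only [smul_eq_C_mul, map_mul, map_add, map_sub, map_one, algebraMap_deltaX,
    ← sFrac_algebraMap, e]
  apply fieldDelta_braid_two <;> simp [sFrac_C, sFrac_X, e, h, sFrac_sFrac, sFrac_braid hij] <;>
    apply frac_X_sub_X <;> simp only [ne_eq, Fin.ext_iff, Fin.val_castSucc, Fin.val_succ] <;> omega

theorem deltaX_braid_const (s : K) {i j : Fin n} (hij : i.val + 1 = j.val)
    (f : MvPolynomial (Fin (n + 1)) K) :
    deltaX s i (deltaX s j (deltaX s i f)) + s • sX K i (deltaX s j (sX K i f)) =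
      deltaX s j (deltaX s i (deltaX s j f)) + s • sX K j (deltaX s i (sX K j f)) := by
  apply IsFractionRing.injective _ (FractionRing (MvPolynomial (Fin (n + 1)) K))
  have h := swap_apply_adjacent hij
  have e := castSucc_eq_succ hij
  simp only [smul_eq_C_mul, map_mul, map_add, algebraMap_deltaX,
    ← sFrac_algebraMap, e]
  apply fieldDelta_braid_const <;> simp [sFrac_C, sFrac_X, e, h, sFrac_sFrac, sFrac_braid hij] <;>
    apply frac_X_sub_X <;> simp only [ne_eq, Fin.ext_iff, Fin.val_castSucc, Fin.val_succ] <;> omega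

end Polynomial

/-! ### Operators on vector valued polynomials -/

section Lists
variable {M : Type*} [Monoid M] {n : ℕ}

/-- A family indexed by `Fin n`, extended by `1` to all natural numbers. -/
def extendOne (f : Fin n → M) (k : ℕ) : M := if h : k < n then f ⟨k, h⟩ else 1

theorem extendOne_of_lt (f : Fin n → M) {k : ℕ} (h : k < n) : extendOne f k = f ⟨k, h⟩ := dif_pos h

theorem extendOne_val (f : Fin n → M) (i : Fin n) : extendOne f i = f i := dif_pos i.2

theorem filter_finRange_map (f : Fin n → M) (p : ℕ → Bool) :
    ((List.finRange n).filter fun j => p j.val).map f =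
      ((List.range n).filter p).map (extendOne f) := by
  have h : f = extendOne f ∘ Fin.val := by ext i; simp [extendOne_val]
  conv_lhs => rw [h, ← List.map_map]
  rw [← List.map_coe_finRange_eq_range, List.filter_map]
  rfl

theorem finRange_map (f : Fin n → M) :
    (List.finRange n).map f = (List.range n).map (extendOne f) := by
  simpa using filter_finRange_map f fun _ => true

theorem prod_map_range (t : ℕ → M) (k : ℕ) : ((List.range k).map t).prod = ascProd t k := by
  induction k with
  | zero => rfl
  | succ k ih => simp [List.range_succ, ih, ascProd]

theorem reverse_prod_map_range (t : ℕ → M) (k : ℕ) :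
    ((List.range k).map t).reverse.prod = descProd t k := by
  induction k with
  | zero => rfl
  | succ k ih => simp [List.range_succ, ih, descProd]

theorem filter_range_lt {n i : ℕ} (h : i ≤ n) :
    (List.range n).filter (fun j => decide (j < i)) = List.range i := by
  obtain ⟨m, rfl⟩ := Nat.exists_eq_add_of_le h
  rw [List.range_add, List.filter_append, List.filter_eq_self.2, List.filter_eq_nil_iff.2,
    List.append_nil]
  · simp
  · simp

theorem filter_range_add (i m : ℕ) :
    (List.range (i + m)).filter (fun j => decide (i ≤ j)) = (List.range m).map (i + ·) := by
  rw [List.range_add, List.filter_append, List.filter_eq_nil_iff.2, List.filter_eq_self.2,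
    List.nil_append]
  · simp
  · simp

theorem filter_range_ge {n i : ℕ} (h : i < n) :
    (List.range n).filter (fun j => decide (i ≤ j)) =
      i :: (List.range n).filter (fun j => decide (i + 1 ≤ j)) := by
  obtain ⟨m, rfl⟩ := Nat.exists_eq_add_of_le (Nat.succ_le_of_lt h)
  rw [filter_range_add (i + 1) m, show i.succ + m = i + (m + 1) by omega, filter_range_add,
    List.range_succ_eq_map]
  simp [Function.comp_def, Nat.add_assoc, Nat.add_comm 1]

end Lists

section Bold
variable {K : Type*} [Field K] {s : K} {μ : YoungDiagram} {n : ℕ}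

open MvPolynomial

theorem boldT_tmul (i : Fin n) (f : MvPolynomial (Fin (n + 1)) K) (u : V K μ (n + 1)) :
    boldT μ s i (f ⊗ₜ u) = deltaX s i f ⊗ₜ u + sX K i f ⊗ₜ heckeT μ s i u := by
  simp [boldT]

theorem end_ext {f g : Module.End K (VVPoly K μ n)}
    (h : ∀ p u, f (p ⊗ₜ u) = g (p ⊗ₜ u)) : f = g := TensorProduct.ext' h

theorem boldT_quad (hs : s ≠ 0) (hs1 : ∀ m : ℤ, s ^ m = 1 → m = 0) (i : Fin n) :
    boldT μ s i * boldT μ s i = (s - 1) • boldT μ s i + s • 1 := by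
  refine end_ext fun f u => ?_
  have h1 := LinearMap.congr_fun (heckeT_quad (μ := μ) hs hs1 i) u
  simp only [Module.End.mul_apply, LinearMap.add_apply, LinearMap.smul_apply,
    Module.End.one_apply] at h1
  have h2 : sX K i (deltaX s i f) = (s - 1) • (sX K i f - f) - deltaX s i (sX K i f) := by
    rw [← deltaX_sX]; abel
  simp only [Module.End.mul_apply, LinearMap.add_apply, LinearMap.smul_apply,
    Module.End.one_apply, boldT_tmul, map_add, h1, sX_sX, h2, deltaX_deltaX,
    TensorProduct.tmul_add, TensorProduct.tmul_smul, TensorProduct.sub_tmul,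
    ← TensorProduct.smul_tmul']
  module

theorem boldT_comm (hs : s ≠ 0) (hs1 : ∀ m : ℤ, s ^ m = 1 → m = 0) {i j : Fin n}
    (hij : i.val + 2 ≤ j.val) :
    boldT μ s i * boldT μ s j = boldT μ s j * boldT μ s i := by
  refine end_ext fun f u => ?_
  have h1 := LinearMap.congr_fun (heckeT_comm (μ := μ) hs hs1 hij) u
  simp only [Module.End.mul_apply] at h1
  simp only [Module.End.mul_apply, boldT_tmul, map_add, h1, sX_comm hij, deltaX_comm s hij,
    deltaX_sX_far s (Or.inl hij), deltaX_sX_far s (Or.inr hij)]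
  abel

theorem boldT_braid (hs : s ≠ 0) (hs1 : ∀ m : ℤ, s ^ m = 1 → m = 0) {i j : Fin n}
    (hij : i.val + 1 = j.val) :
    boldT μ s i * boldT μ s j * boldT μ s i = boldT μ s j * boldT μ s i * boldT μ s j := by
  refine end_ext fun f u => ?_
  have h1 := LinearMap.congr_fun (heckeT_braid (μ := μ) hs hs1 hij) u
  have h2 := LinearMap.congr_fun (heckeT_quad (μ := μ) hs hs1 i) u
  have h3 := LinearMap.congr_fun (heckeT_quad (μ := μ) hs hs1 j) u
  simp only [Module.End.mul_apply, LinearMap.add_apply, LinearMap.smul_apply,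
    Module.End.one_apply] at h1 h2 h3
  have e1 := deltaX_braid_one s hij f
  have e2 := deltaX_braid_two s hij f
  have e3 := eq_sub_of_add_eq (deltaX_braid_const s hij f)
  simp only [Module.End.mul_apply, boldT_tmul, map_add, h1, h2, h3, sX_braid hij,
    sX_sX_deltaX s hij, sX_sX_deltaX' s hij, ← e1, ← e2, e3,
    TensorProduct.tmul_add, TensorProduct.tmul_smul, TensorProduct.sub_tmul,
    TensorProduct.add_tmul, ← TensorProduct.smul_tmul']
  module

theorem boldT_mul_boldTinv (hs : s ≠ 0) (hs1 : ∀ m : ℤ, s ^ m = 1 → m = 0) (i : Fin n) :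
    boldT μ s i * boldTinv μ s i = 1 := by
  have h := boldT_quad (μ := μ) hs hs1 i
  rw [boldTinv, mul_smul_comm, mul_add, h, mul_smul_comm, ← Module.End.one_eq_id, mul_one]
  rw [show (s - 1) • boldT μ s i + s • 1 + (1 - s) • boldT μ s i = s • 1 by module,
    inv_smul_smul₀ hs]

theorem boldTinv_mul_boldT (hs : s ≠ 0) (hs1 : ∀ m : ℤ, s ^ m = 1 → m = 0) (i : Fin n) :
    boldTinv μ s i * boldT μ s i = 1 := by
  have h := boldT_quad (μ := μ) hs hs1 i
  rw [boldTinv, smul_mul_assoc, add_mul, h, smul_mul_assoc, ← Module.End.one_eq_id, one_mul]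
  rw [show (s - 1) • boldT μ s i + s • 1 + (1 - s) • boldT μ s i = s • 1 by module,
    inv_smul_smul₀ hs]

/-- Bold `T_i` as an invertible operator. -/
def boldUnit (μ : YoungDiagram) (hs : s ≠ 0) (hs1 : ∀ m : ℤ, s ^ m = 1 → m = 0) (i : Fin n) :
    (Module.End K (VVPoly K μ n))ˣ :=
  ⟨boldT μ s i, boldTinv μ s i, boldT_mul_boldTinv hs hs1 i, boldTinv_mul_boldT hs hs1 i⟩

/-- The multiplication by a variable. -/
def mulX (K : Type*) [Field K] (μ : YoungDiagram) (j : Fin (n + 1)) :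
    Module.End K (VVPoly K μ n) :=
  TensorProduct.map (LinearMap.mulLeft K (X j)) LinearMap.id

theorem mulX_tmul (j : Fin (n + 1)) (f : MvPolynomial (Fin (n + 1)) K) (u : V K μ (n + 1)) :
    mulX K μ j (f ⊗ₜ u) = (X j * f) ⊗ₜ u := by
  simp [mulX]

theorem boldTinv_mul_mulX (hs : s ≠ 0) (i : Fin n) :
    s • (boldTinv μ s i * mulX K μ i.succ) = mulX K μ i.castSucc * boldT μ s i := by
  refine end_ext fun f u => ?_
  rw [boldTinv, smul_mul_assoc, smul_inv_smul₀ hs]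
  simp only [Module.End.mul_apply, LinearMap.add_apply, LinearMap.smul_apply,
    LinearMap.id_apply, boldT_tmul, mulX_tmul, map_add, sX_mul, sX_X, Equiv.swap_apply_right,
    ← deltaX_X_succ_mul, TensorProduct.add_tmul, TensorProduct.smul_tmul']
  abel

theorem divDiff_X_mul {i : Fin n} {j : Fin (n + 1)} (h1 : j ≠ i.castSucc) (h2 : j ≠ i.succ)
    (f : MvPolynomial (Fin (n + 1)) K) :
    divDiff K i (X j * f) = X j * divDiff K i f := by
  apply mul_left_cancel₀ (X_sub_X_ne_zero K i)
  rw [divDiff_spec, mul_left_comm, divDiff_spec, sX_mul, sX_X,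
    Equiv.swap_apply_of_ne_of_ne h1 h2, mul_sub]

theorem mulX_boldT {i : Fin n} {j : Fin (n + 1)} (h1 : j ≠ i.castSucc) (h2 : j ≠ i.succ) :
    Commute (mulX K μ j) (boldT μ s i) := by
  refine end_ext fun f u => ?_
  simp only [Module.End.mul_apply, boldT_tmul, mulX_tmul, map_add, sX_mul, sX_X,
    Equiv.swap_apply_of_ne_of_ne h1 h2, deltaX_apply, divDiff_X_mul h1 h2, mul_smul_comm,
    mul_left_comm]

/-- The algebra endomorphism `x₀ ↦ q x_n`, `x_{j+1} ↦ x_j`. -/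
def rotHom (q : K) (n : ℕ) : MvPolynomial (Fin (n + 1)) K →ₐ[K] MvPolynomial (Fin (n + 1)) K :=
  aeval fun j => Fin.cases (C q * X (Fin.last n)) (fun i => X i.castSucc) j

theorem rotHom_X_zero (q : K) : rotHom q n (X 0) = C q * X (Fin.last n) := by simp [rotHom]

theorem rotHom_X_succ (q : K) (i : Fin n) : rotHom q n (X i.succ) = X i.castSucc := by
  simp [rotHom]

theorem rename_list (L : List (Fin n)) :
    rightProd (L.map (sX K)) = (rename (R := K)
      ((L.map fun i : Fin n => Equiv.swap i.castSucc i.succ).reverse.prod)).toLinearMap := by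
  refine LinearMap.ext fun f => ?_
  induction L generalizing f with
  | nil => simp [rightProd]
  | cons i L ih =>
    have h : rightProd ((i :: L).map (sX K)) = rightProd (L.map (sX K)) * sX K i := by
      simp [rightProd]
    rw [h, Module.End.mul_apply, ih]
    simp [sX_apply, rename_rename]

/-- The product of the first `k` transpositions is the cycle `0 ↦ k ↦ k - 1 ↦ ⋯ ↦ 0`. -/
theorem cycle_apply {k : ℕ} (hk : k ≤ n) (j : Fin (n + 1)) :
    (descProd (extendOne fun i : Fin n => Equiv.swap i.castSucc i.succ) k j).val =
      if j.val = 0 then k else if j.val ≤ k then j.val - 1 else j.val := by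
  induction k with
  | zero =>
    simp only [descProd, Equiv.Perm.one_apply]
    split_ifs <;> omega
  | succ k ih =>
    have h := ih (by omega)
    rw [descProd, Equiv.Perm.mul_apply, extendOne_of_lt _ (by omega), Equiv.swap_apply_def]
    split_ifs at h ⊢ <;>
      simp only [Fin.ext_iff, Fin.val_castSucc, Fin.val_succ] at * <;> omega

/-- The polynomial part of `w` is the ring endomorphism `x₀ ↦ q x_n`, `x_{j+1} ↦ x_j`. -/
theorem rightProd_tauX (q : K) :
    rightProd (tauX q n :: (List.finRange n).map (sX K)) = (rotHom q n).toLinearMap := by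
  have h : rightProd (tauX q n :: (List.finRange n).map (sX K)) =
      rightProd ((List.finRange n).map (sX K)) * tauX q n := by
    simp [rightProd]
  rw [h, rename_list, finRange_map, reverse_prod_map_range, tauX, Module.End.mul_eq_comp,
    ← AlgHom.comp_toLinearMap]
  congr 1
  ext1 j
  refine Fin.cases ?_ (fun i => ?_) j
  · have h0 : descProd (extendOne fun i : Fin n => Equiv.swap i.castSucc i.succ) n 0 =
        Fin.last n := by
      ext; simp [cycle_apply le_rfl]
    simp [rotHom, h0]
  · have h0 : descProd (extendOne fun i : Fin n => Equiv.swap i.castSucc i.succ) n i.succ =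
        i.castSucc := by
      ext; rw [cycle_apply le_rfl]; simp
    simp [rotHom, h0]

theorem heckeS_mul (hs : s ≠ 0) (hs1 : ∀ m : ℤ, s ^ m = 1 → m = 0) {i j : Fin n}
    (hij : i.val + 1 = j.val) : heckeS μ s n * heckeT μ s j = heckeT μ s i * heckeS μ s n := by
  have hb : IsBraid n (extendOne (heckeT (n := n) μ s)) := by
    constructor
    · intro a b hab hb
      rw [extendOne_of_lt _ hb, extendOne_of_lt _ (by omega : a < n)]
      exact heckeT_comm hs hs1 hab
    · intro a ha
      rw [extendOne_of_lt _ ha, extendOne_of_lt _ (by omega : a < n)]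
      exact heckeT_braid hs hs1 rfl
  have h := (hb.semiconj_descProd (i := i.val) (k := n) (by omega) le_rfl).eq
  rw [heckeS, rightProd, finRange_map, reverse_prod_map_range]
  rw [hij, extendOne_val, extendOne_val] at h
  exact h

theorem boldW_tmul (q : K) (f : MvPolynomial (Fin (n + 1)) K) (u : V K μ (n + 1)) :
    boldW μ q s n (f ⊗ₜ u) = rotHom q n f ⊗ₜ heckeS μ s n u := by
  rw [boldW, rightProd_tauX]; simp

theorem boldW_mul_boldT (q : K) (hs : s ≠ 0) (hs1 : ∀ m : ℤ, s ^ m = 1 → m = 0) {i j : Fin n}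
    (hij : i.val + 1 = j.val) :
    boldW μ q s n * boldT μ s j = boldT μ s i * boldW μ q s n := by
  refine end_ext fun f u => ?_
  have e := castSucc_eq_succ hij
  have h1 := LinearMap.congr_fun (heckeS_mul (μ := μ) hs hs1 hij) u
  simp only [Module.End.mul_apply] at h1
  have h2 : ∀ f, rotHom q n (sX K j f) = sX K i (rotHom q n f) := by
    intro f
    suffices (rotHom q n).comp (rename (Equiv.swap j.castSucc j.succ)) =
      (rename (Equiv.swap i.castSucc i.succ)).comp (rotHom q n) from DFunLike.congr_fun this f
    ext1 k
    refine Fin.cases ?_ (fun k => ?_) k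
    · have h4 : Equiv.swap j.castSucc j.succ 0 = 0 := by
        apply Equiv.swap_apply_of_ne_of_ne <;>
          simp only [ne_eq, Fin.ext_iff, Fin.val_castSucc, Fin.val_succ, Fin.val_zero] <;> omega
      have h5 : Equiv.swap i.castSucc i.succ (Fin.last n) = Fin.last n := by
        apply Equiv.swap_apply_of_ne_of_ne <;>
          simp only [ne_eq, Fin.ext_iff, Fin.val_castSucc, Fin.val_succ, Fin.val_last] <;> omega
      simp [h4, h5, rotHom_X_zero]
    · rcases eq_or_ne k i with rfl | hki
      · simp [e, rotHom_X_succ]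
      rcases eq_or_ne k j with rfl | hkj
      · rw [AlgHom.comp_apply, AlgHom.comp_apply, rename_X, rotHom_X_succ, rename_X,
          Equiv.swap_apply_right, e, rotHom_X_succ, Equiv.swap_apply_right]
      · have h4 : Equiv.swap j.castSucc j.succ k.succ = k.succ := by
          rw [e]
          exact Equiv.swap_apply_of_ne_of_ne (by simpa using hki) (by simpa using hkj)
        have h5 : Equiv.swap i.castSucc i.succ k.castSucc = k.castSucc := by
          rw [← e]
          exact Equiv.swap_apply_of_ne_of_ne (by simpa using hki) (by simpa using hkj)
        simp [h4, h5, rotHom_X_succ]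
  have h3 := map_deltaX s (i := j) (j := i) (rotHom q n) (by rw [e, rotHom_X_succ])
    (by rw [rotHom_X_succ, e]) h2 f
  simp only [Module.End.mul_apply, boldT_tmul, boldW_tmul, map_add, h1, h2, h3]

theorem boldW_mul_mulX_zero (q : K) :
    boldW μ q s n * mulX K μ 0 = q • (mulX K μ (Fin.last n) * boldW μ q s n) := by
  refine end_ext fun f u => ?_
  simp only [Module.End.mul_apply, LinearMap.smul_apply, boldW_tmul, mulX_tmul, map_mul,
    rotHom_X_zero, TensorProduct.smul_tmul', smul_eq_C_mul, mul_assoc]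

theorem boldW_mul_mulX_succ (q : K) (i : Fin n) :
    boldW μ q s n * mulX K μ i.succ = mulX K μ i.castSucc * boldW μ q s n := by
  refine end_ext fun f u => ?_
  simp only [Module.End.mul_apply, boldW_tmul, mulX_tmul, map_mul, rotHom_X_succ]

/-- The Cherednik operator as a product of operators composed from right to left. -/
theorem cherednik_eq (q : K) {k : ℕ} (hk : k < n + 1) :
    cherednik μ q s ⟨k, hk⟩ = s ^ ((k : ℤ) - (n : ℤ)) •
      ((((List.range n).filter fun j => decide (k ≤ j)).map (extendOne (boldT μ s))).prod *
        boldW μ q s n * ascProd (extendOne (boldTinv (n := n) μ s)) k) := by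
  rw [cherednik, rightProd]
  simp only [List.reverse_append, List.reverse_singleton, List.map_reverse, List.reverse_reverse,
    List.prod_append, List.prod_singleton]
  rw [filter_finRange_map (boldT μ s) fun j => decide (k ≤ j),
    filter_finRange_map (boldTinv μ s) fun j => decide (j < k), filter_range_lt (by omega),
    prod_map_range, mul_assoc]

/-- The operators on vector valued polynomials satisfy the relations of the double affine Hecke
algebra. -/
theorem isDoubleAffine (q : K) (hs : s ≠ 0) (hs1 : ∀ m : ℤ, s ^ m = 1 → m = 0) :
    IsDoubleAffine q s n (extendOne (boldUnit (n := n) μ hs hs1)) (boldW μ q s n)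
      (fun k => if h : k < n + 1 then mulX K μ ⟨k, h⟩ else 0)
      (fun k => if h : k < n + 1 then cherednik μ q s ⟨k, h⟩ else 0) where
  ne_zero := hs
  isBraid := by
    constructor
    · intro a b hab hb
      rw [extendOne_of_lt _ hb, extendOne_of_lt _ (by omega : a < n)]
      exact Units.ext (boldT_comm hs hs1 hab)
    · intro a ha
      rw [extendOne_of_lt _ ha, extendOne_of_lt _ (by omega : a < n)]
      exact Units.ext (boldT_braid hs hs1 rfl)
  quad i hi := by
    rw [extendOne_of_lt _ hi]
    exact smul_inv_smul₀ hs _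
  w_mul_t i hi := by
    rw [extendOne_of_lt _ hi, extendOne_of_lt _ (by omega : i < n)]
    exact boldW_mul_boldT q hs hs1 rfl
  t_inv_mul_x i hi := by
    rw [extendOne_of_lt _ hi, dif_pos (by omega), dif_pos (by omega)]
    exact boldTinv_mul_mulX hs ⟨i, hi⟩
  x_comm_t i hi := by
    rw [extendOne_of_lt _ (by omega : i < n), dif_pos (by omega)]
    apply mulX_boldT <;> simp [Fin.ext_iff] <;> omega
  x_comm_x i j := by
    split_ifs with hi hj
    · refine end_ext fun f u => ?_
      simp only [Module.End.mul_apply, mulX_tmul, mul_left_comm]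
    · exact Commute.zero_right _
    · exact Commute.zero_left _
    · exact Commute.zero_left _
  w_mul_x_zero := by
    rw [dif_pos (by omega), dif_pos (by omega)]
    exact boldW_mul_mulX_zero q
  w_mul_x_last i hi := by
    subst hi
    rw [dif_pos (by omega), dif_pos (by omega)]
    exact boldW_mul_mulX_succ q (Fin.last i)
  y_zero := by
    have h : ∀ k ≤ n, ascProd (extendOne (boldT (n := n) μ s)) k =
        ↑(ascProd (extendOne (boldUnit (n := n) μ hs hs1)) k) := by
      intro k hk
      induction k with
      | zero => rfl
      | succ k ih =>
        rw [ascProd, ascProd, ih (by omega), Units.val_mul, extendOne_of_lt _ hk,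
          extendOne_of_lt _ hk]
        rfl
    rw [dif_pos (by omega), cherednik_eq, ← h n le_rfl, List.filter_eq_self.2 (by simp),
      prod_map_range, smul_smul, ← zpow_natCast, ← zpow_add₀ hs]
    simp [ascProd]
  y_last := by
    have h : ∀ k ≤ n, ascProd (extendOne (boldTinv (n := n) μ s)) k =
        ↑(descProd (extendOne (boldUnit (n := n) μ hs hs1)) k)⁻¹ := by
      intro k hk
      induction k with
      | zero => rfl
      | succ k ih =>
        rw [ascProd, descProd, ih (by omega), mul_inv_rev, Units.val_mul, extendOne_of_lt _ hk,
          extendOne_of_lt _ hk]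
        rfl
    rw [dif_pos (by omega), cherednik_eq, h n le_rfl, List.filter_eq_nil_iff.2 (by simp)]
    simp
  y_rec i hi := by
    rw [dif_pos (by omega), dif_pos (by omega), cherednik_eq, cherednik_eq, filter_range_ge hi,
      ascProd, extendOne_of_lt (boldTinv μ s) hi, extendOne_of_lt (boldUnit μ hs hs1) hi]
    have h1 : (↑(boldUnit μ hs hs1 ⟨i, hi⟩) : Module.End K (VVPoly K μ n)) =
        boldT μ s ⟨i, hi⟩ := rfl
    rw [List.map_cons, List.prod_cons, extendOne_of_lt (boldT μ s) hi, h1, mul_smul_comm,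
      smul_mul_assoc]
    simp only [mul_assoc]
    rw [boldTinv_mul_boldT hs hs1, mul_one, smul_smul]
    congr 1
    rw [← zpow_one_add₀ hs]
    congr 1
    push_cast
    ring

theorem boldPhi_eq (hs : s ≠ 0) (hs1 : ∀ m : ℤ, s ^ m = 1 → m = 0) :
    boldPhi μ s n = IsDoubleAffine.phi n (extendOne (boldUnit (n := n) μ hs hs1))
      (fun k => if h : k < n + 1 then mulX K μ ⟨k, h⟩ else 0) := by
  have h : ∀ k ≤ n, descProd (extendOne (boldTinv (n := n) μ s)) k =
      ↑(ascProd (extendOne (boldUnit (n := n) μ hs hs1)) k)⁻¹ := by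
    intro k hk
    induction k with
    | zero => rfl
    | succ k ih =>
      rw [ascProd, descProd, ih (by omega), mul_inv_rev, Units.val_mul, extendOne_of_lt _ hk,
        extendOne_of_lt _ hk]
      rfl
  rw [IsDoubleAffine.phi, dif_pos (by omega), ← h n le_rfl, boldPhi, rightProd, finRange_map,
    List.reverse_append, List.prod_append, reverse_prod_map_range]
  simp [mulX, Fin.last]

end Bold

/-! ### The vertices of the Yang–Baxter graph -/

section Swaps
variable {n : ℕ}

/-- The exchange of two consecutive places preserves the order except at these two places. -/
theorem swap_castSucc_succ_lt (i : Fin n) {a b : Fin (n + 1)}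
    (h1 : ¬ (a = i.castSucc ∧ b = i.succ)) (h2 : ¬ (a = i.succ ∧ b = i.castSucc)) :
    Equiv.swap i.castSucc i.succ a < Equiv.swap i.castSucc i.succ b ↔ a < b := by
  simp only [Equiv.swap_apply_def]
  simp only [Fin.ext_iff, Fin.val_castSucc, Fin.val_succ] at h1 h2
  split_ifs <;> simp only [Fin.ext_iff, Fin.lt_def, Fin.val_castSucc, Fin.val_succ] at * <;> omega

theorem swap_eq_swap_of_lt {N : ℕ} {a b k l : Fin N} (hab : a < b) (hkl : k < l)
    (h : Equiv.swap a b = Equiv.swap k l) : k = a ∧ l = b := by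
  have h1 := DFunLike.congr_fun h k
  rw [Equiv.swap_apply_left, Equiv.swap_apply_def] at h1
  split_ifs at h1 with h2 h3
  · exact ⟨h2, h1.symm⟩
  · rw [h3, ← h1] at hkl
    exact absurd hab hkl.asymm
  · exact absurd h1 hkl.ne

theorem exchange_injective {μ : YoungDiagram} {N : ℕ} (f : Filling μ N) {a b k l : Fin N}
    (h : exchange f a b = exchange f k l) : Equiv.swap a b = Equiv.swap k l := by
  ext1 x
  exact f.injective (DFunLike.congr_fun h x)

end Swaps

section Transp
variable {K : Type*} {μ : YoungDiagram} {n : ℕ}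

theorem Vertex.transp_of_ne {A : Vertex K μ n} {i : Fin n} (h : A.v i.succ ≠ A.v i.castSucc) :
    A.transp i = { tab := A.tab
                   zeta := A.zeta ∘ Equiv.swap i.castSucc i.succ
                   v := A.v ∘ Equiv.swap i.castSucc i.succ
                   sigma := (Equiv.swap i.castSucc i.succ).trans A.sigma } := if_pos h

theorem Vertex.transp_of_isRST {A : Vertex K μ n} {i : Fin n} (h : A.v i.succ = A.v i.castSucc)
    (hT : IsRST (exchange A.tab.1 (A.sigma i.castSucc) (A.sigma i.succ))) :
    A.transp i = { tab := ⟨exchange A.tab.1 (A.sigma i.castSucc) (A.sigma i.succ), hT⟩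
                   zeta := A.zeta ∘ Equiv.swap i.castSucc i.succ
                   v := A.v
                   sigma := A.sigma } := by
  rw [Vertex.transp, if_neg (not_not.2 h), dif_pos hT]

theorem Vertex.transp_of_not_isRST {A : Vertex K μ n} {i : Fin n}
    (h : A.v i.succ = A.v i.castSucc)
    (hT : ¬ IsRST (exchange A.tab.1 (A.sigma i.castSucc) (A.sigma i.succ))) :
    A.transp i = A := by
  rw [Vertex.transp, if_neg (not_not.2 h), dif_neg hT]

/-- The exponents of `q` and `s` in the spectral vector. -/
def Vertex.spec (A : Vertex K μ n) (i : Fin (n + 1)) : ℕ × ℤ :=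
  (A.v i, content A.tab.1 (A.sigma i))

theorem swap_map {α β : Type*} [DecidableEq α] [DecidableEq β] (σ : α ≃ β) (a b x : α) :
    Equiv.swap (σ a) (σ b) (σ x) = σ (Equiv.swap a b x) := by
  simp [Equiv.swap_apply_def]
  split_ifs <;> rfl

theorem Vertex.spec_transp_of_ne {A : Vertex K μ n} {i : Fin n}
    (h : A.v i.succ ≠ A.v i.castSucc) :
    (A.transp i).spec = A.spec ∘ Equiv.swap i.castSucc i.succ := by
  rw [Vertex.transp_of_ne h]; rfl

theorem Vertex.spec_transp_of_isRST {A : Vertex K μ n} {i : Fin n}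
    (h : A.v i.succ = A.v i.castSucc)
    (hT : IsRST (exchange A.tab.1 (A.sigma i.castSucc) (A.sigma i.succ))) :
    (A.transp i).spec = A.spec ∘ Equiv.swap i.castSucc i.succ := by
  rw [Vertex.transp_of_isRST h hT]
  ext1 j
  refine Prod.ext ?_ ?_
  · change A.v j = A.v (Equiv.swap i.castSucc i.succ j)
    rw [Equiv.swap_apply_def]
    split_ifs with h1 h2 <;> simp [*]
  · change content (exchange _ _ _) _ = content _ _
    rw [content_exchange, swap_map]

theorem Vertex.zeta_transp {A : Vertex K μ n} {i : Fin n} (h : A.v i.succ ≠ A.v i.castSucc ∨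
    IsRST (exchange A.tab.1 (A.sigma i.castSucc) (A.sigma i.succ))) :
    (A.transp i).zeta = A.zeta ∘ Equiv.swap i.castSucc i.succ := by
  by_cases hv : A.v i.succ = A.v i.castSucc
  · rw [Vertex.transp_of_isRST hv (h.resolve_left (not_not.2 hv))]
  · rw [Vertex.transp_of_ne hv]

end Transp

section Vertices
variable {K : Type*} [Field K] {q s : K} {μ : YoungDiagram} {n : ℕ}

/-- The compatibility conditions satisfied by the vertices of the graph: `σ` is the
standardization of `v` (largest entries first, equal entries from left to right), and the spectral
vector is given by `v` and by the contents of the tableau. -/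
structure Vertex.IsStandard (q s : K) (A : Vertex K μ n) : Prop where
  zeta_eq : ∀ i, A.zeta i = q ^ A.v i * s ^ content A.tab.1 (A.sigma i)
  sigma_lt : ∀ i j, A.sigma i < A.sigma j ↔ A.v j < A.v i ∨ (A.v i = A.v j ∧ i < j)

/-- The relation between the exponents at the places `i` and `i + 1` for which there is an
arrow `s_i` to another vertex. -/
def Prec (e e' : ℕ × ℤ) : Prop := e.1 < e'.1 ∨ (e.1 = e'.1 ∧ e'.2 + 2 ≤ e.2)

theorem Prec.trans {a b c : ℕ × ℤ} (h1 : Prec a b) (h2 : Prec b c) : Prec a c := by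
  unfold Prec at *; omega

/-- The action of `Ψ` on the exponents. -/
def rotSpec (e : Fin (n + 1) → ℕ × ℤ) : Fin (n + 1) → ℕ × ℤ :=
  Fin.snoc (α := fun _ => ℕ × ℤ) (fun i : Fin n => e i.succ) ((e 0).1 + 1, (e 0).2)

theorem rotSpec_castSucc (e : Fin (n + 1) → ℕ × ℤ) (i : Fin n) :
    rotSpec e i.castSucc = e i.succ := by simp [rotSpec]

theorem rotSpec_last (e : Fin (n + 1) → ℕ × ℤ) :
    rotSpec e (Fin.last n) = ((e 0).1 + 1, (e 0).2) := by simp [rotSpec]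

theorem rotSpec_injective : Function.Injective (rotSpec (n := n)) := by
  intro e e' h
  ext1 i
  refine Fin.cases ?_ (fun i => ?_) i
  · have := congrFun h (Fin.last n)
    simpa [rotSpec_last, Prod.ext_iff] using this
  · have := congrFun h i.castSucc
    simpa only [rotSpec_castSucc] using this

/-- A permutation is determined by the relative order of its values. -/
theorem perm_ext_of_lt {N : ℕ} {σ τ : Equiv.Perm (Fin N)}
    (h : ∀ i j, σ i < σ j ↔ τ i < τ j) : σ = τ := by
  have h1 : StrictMono (fun x => τ (σ.symm x)) := by
    intro a b hab
    rw [← h]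
    simpa using hab
  have h2 := (StrictMono.range_inj h1 strictMono_id).1 (by
    rw [Set.range_id]
    exact (σ.symm.trans τ).surjective.range_eq)
  ext1 i
  simpa using (congrFun h2 (σ i)).symm

theorem Vertex.IsStandard.ext {A B : Vertex K μ n} (hA : A.IsStandard q s)
    (hB : B.IsStandard q s) (hv : A.v = B.v) (hT : A.tab = B.tab) : A = B := by
  have hσ : A.sigma = B.sigma := perm_ext_of_lt fun i j => by
    rw [hA.sigma_lt, hB.sigma_lt, hv]
  refine Vertex.ext hT ?_ hv hσ
  ext1 i
  rw [hA.zeta_eq, hB.zeta_eq, hv, hT, hσ]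

/-- A vertex is determined by its exponents: `v` determines `σ`, and the contents determine the
tableau. -/
theorem Vertex.IsStandard.ext_spec {A B : Vertex K μ n} (hA : A.IsStandard q s)
    (hB : B.IsStandard q s) (h : A.spec = B.spec) : A = B := by
  have hv : A.v = B.v := by
    ext1 i
    exact congrArg Prod.fst (congrFun h i)
  have hσ : A.sigma = B.sigma := perm_ext_of_lt fun i j => by
    rw [hA.sigma_lt, hB.sigma_lt, hv]
  refine hA.ext hB hv (Subtype.ext (A.tab.2.ext_content B.tab.2 fun i => ?_))
  have := congrArg Prod.snd (congrFun h (A.sigma.symm i))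
  simpa [Vertex.spec, ← hσ] using this

theorem Vertex.IsStandard.spec_eq_of_zeta (hqs : ∀ a b : ℤ, q ^ a * s ^ b = 1 → a = 0 ∧ b = 0)
    (hq : q ≠ 0) (hs : s ≠ 0) {A B : Vertex K μ n} (hA : A.IsStandard q s)
    (hB : B.IsStandard q s) {i j : Fin (n + 1)} (h : A.zeta i = B.zeta j) :
    A.spec i = B.spec j := by
  rw [hA.zeta_eq, hB.zeta_eq, ← zpow_natCast, ← zpow_natCast] at h
  have h1 := hqs ((A.v i : ℤ) - B.v j)
    (content A.tab.1 (A.sigma i) - content B.tab.1 (B.sigma j)) (by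
      rw [zpow_sub₀ hq, zpow_sub₀ hs, div_mul_div_comm, h, div_self]
      exact mul_ne_zero (zpow_ne_zero _ hq) (zpow_ne_zero _ hs))
  unfold Vertex.spec
  ext <;> simp <;> omega

/-- At consecutive places with equal entries of `v` the values of `σ` are consecutive. -/
theorem Vertex.IsStandard.consecutive {A : Vertex K μ n} (hA : A.IsStandard q s) {i : Fin n}
    (hv : A.v i.castSucc = A.v i.succ) :
    ∃ k : Fin n, A.sigma i.castSucc = k.castSucc ∧ A.sigma i.succ = k.succ := by
  have h1 : A.sigma i.castSucc < A.sigma i.succ :=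
    (hA.sigma_lt _ _).2 (Or.inr ⟨hv, Fin.castSucc_lt_succ⟩)
  have hk : (A.sigma i.castSucc).val < n := by
    have := (A.sigma i.succ).2
    rw [Fin.lt_def] at h1
    omega
  refine ⟨⟨_, hk⟩, rfl, ?_⟩
  by_contra hne
  have h2 : (⟨_, hk⟩ : Fin n).succ < A.sigma i.succ := by
    simp only [Fin.ext_iff, Fin.lt_def, Fin.val_succ] at h1 hne ⊢
    omega
  -- the place of the value between the two would lie strictly between two consecutive places
  obtain ⟨m, hm⟩ := A.sigma.surjective (⟨_, hk⟩ : Fin n).succ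
  rw [← hm, hA.sigma_lt] at h2
  have h3 : A.sigma i.castSucc < A.sigma m := by rw [hm, Fin.lt_def]; simp
  rw [hA.sigma_lt] at h3
  simp only [Fin.lt_def, Fin.val_castSucc, Fin.val_succ] at h2 h3
  omega

theorem Vertex.IsStandard.zeta_spec {A : Vertex K μ n} (hA : A.IsStandard q s)
    (i : Fin (n + 1)) : A.zeta i = q ^ (A.spec i).1 * s ^ (A.spec i).2 := hA.zeta_eq i

theorem Vertex.IsStandard.transp {A : Vertex K μ n} (hA : A.IsStandard q s) (i : Fin n) :
    (A.transp i).IsStandard q s := by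
  by_cases hv : A.v i.succ = A.v i.castSucc
  · by_cases hT : IsRST (exchange A.tab.1 (A.sigma i.castSucc) (A.sigma i.succ))
    · have h1 := Vertex.spec_transp_of_isRST hv hT
      have h2 := Vertex.zeta_transp (Or.inr hT)
      refine ⟨fun j => ?_, ?_⟩
      · change _ = q ^ ((A.transp i).spec j).1 * s ^ ((A.transp i).spec j).2
        rw [h1, h2]
        exact hA.zeta_eq _
      · rw [Vertex.transp_of_isRST hv hT]
        exact hA.sigma_lt
    · rwa [Vertex.transp_of_not_isRST hv hT]
  · rw [Vertex.transp_of_ne hv]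
    refine ⟨fun j => hA.zeta_eq _, fun a b => ?_⟩
    change A.sigma _ < A.sigma _ ↔ A.v _ < A.v _ ∨ (A.v _ = A.v _ ∧ a < b)
    rw [hA.sigma_lt]
    refine or_congr_right (and_congr_right fun h => swap_castSucc_succ_lt i ?_ ?_)
    · rintro ⟨rfl, rfl⟩
      simp at h
      exact hv h
    · rintro ⟨rfl, rfl⟩
      simp at h
      exact hv h.symm

theorem finRotate_castSucc (i : Fin n) : finRotate (n + 1) i.castSucc = i.succ := by
  rw [finRotate_apply, Fin.coeSucc_eq_succ]

theorem Vertex.spec_affine (A : Vertex K μ n) : (A.affine q).spec = rotSpec A.spec := by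
  ext1 i
  refine Fin.lastCases ?_ (fun i => ?_) i
  · rw [rotSpec_last]
    simp [Vertex.spec, Vertex.affine]
  · rw [rotSpec_castSucc]
    simp [Vertex.spec, Vertex.affine]

theorem Vertex.IsStandard.affine {A : Vertex K μ n} (hA : A.IsStandard q s) :
    (A.affine q).IsStandard q s := by
  refine ⟨fun i => ?_, fun i j => ?_⟩
  · refine Fin.lastCases ?_ (fun i => ?_) i
    · simp [Vertex.affine, hA.zeta_eq, pow_succ']
      ring
    · simp [Vertex.affine, hA.zeta_eq]
  · refine Fin.lastCases ?_ (fun i => ?_) i <;> refine Fin.lastCases ?_ (fun j => ?_) j <;>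
      simp only [Vertex.affine, Equiv.trans_apply, finRotate_castSucc, finRotate_last,
        hA.sigma_lt, Fin.snoc_castSucc, Fin.snoc_last, Fin.lt_def, Fin.val_last, Fin.val_castSucc,
        Fin.val_succ, Fin.val_zero] <;> omega

theorem rootVertex_isStandard (h : μ.card = n + 1) :
    (rootVertex s h).IsStandard q s := by
  refine ⟨fun i => ?_, fun i j => ?_⟩ <;> simp [rootVertex]

/-- An arrow `s_i` to a vertex exchanges the exponents at the places `i` and `i + 1`, which are
related by `Prec`. -/
theorem Vertex.IsStandard.of_arrow_transp {A B : Vertex K μ n} (hA : A.IsStandard q s) {i : Fin n}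
    (h : Arrow q A (Label.transp i) (some B)) :
    B = A.transp i ∧ Prec (A.spec i.castSucc) (A.spec i.succ) ∧
      B.spec = A.spec ∘ Equiv.swap i.castSucc i.succ := by
  cases h with
  | step _ h => exact ⟨rfl, Or.inl h, Vertex.spec_transp_of_ne h.ne'⟩
  | jump _ h k l hkl hT hct =>
    by_cases hR : IsRST (exchange A.tab.1 (A.sigma i.castSucc) (A.sigma i.succ))
    · refine ⟨rfl, Or.inr ⟨h, ?_⟩, Vertex.spec_transp_of_isRST h.symm hR⟩
      rw [Vertex.transp_of_isRST h.symm hR] at hT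
      have h1 : A.sigma i.castSucc < A.sigma i.succ :=
        (hA.sigma_lt _ _).2 (Or.inr ⟨h, Fin.castSucc_lt_succ⟩)
      obtain ⟨rfl, rfl⟩ := swap_eq_swap_of_lt h1 hkl (exchange_injective _ hT)
      exact hct
    · rw [Vertex.transp_of_not_isRST h.symm hR] at hT
      have h2 : exchange A.tab.1 k k = exchange A.tab.1 k l := by
        rw [← hT]
        ext1 x
        simp [exchange]
      have h3 := DFunLike.congr_fun (exchange_injective _ h2) k
      simp at h3
      exact absurd h3 hkl.ne

theorem Vertex.IsStandard.isRST_of_spec {A : Vertex K μ n} (hA : A.IsStandard q s) {i : Fin n}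
    (hv : A.v i.succ = A.v i.castSucc)
    (h : (A.spec i.castSucc).2 + 2 ≤ (A.spec i.succ).2 ∨
      (A.spec i.succ).2 + 2 ≤ (A.spec i.castSucc).2) :
    IsRST (exchange A.tab.1 (A.sigma i.castSucc) (A.sigma i.succ)) := by
  obtain ⟨k, hk1, hk2⟩ := hA.consecutive hv.symm
  rw [Vertex.spec, Vertex.spec, hk1, hk2] at h
  rw [hk1, hk2]
  exact exchange_isRST_of_content _ k h

/-- If the exponents at the places `i + 1` and `i` are related by `Prec`, then the vertex is the
end point of an arrow `s_i`. -/
theorem Vertex.IsStandard.arrow_of_prec {B : Vertex K μ n} (hB : B.IsStandard q s) {i : Fin n}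
    (h : Prec (B.spec i.succ) (B.spec i.castSucc)) :
    Arrow q (B.transp i) (Label.transp i) (some B) ∧
      (B.transp i).spec = B.spec ∘ Equiv.swap i.castSucc i.succ := by
  have hA := hB.transp i
  by_cases hv : B.v i.succ = B.v i.castSucc
  · have h1 : (B.spec i.castSucc).2 + 2 ≤ (B.spec i.succ).2 := by
      rcases h with h | h
      · exact absurd hv h.ne
      · exact h.2
    have hR := hB.isRST_of_spec hv (Or.inl h1)
    have h2 := Vertex.spec_transp_of_isRST hv hR
    have hvA : (B.transp i).v = B.v := by rw [Vertex.transp_of_isRST hv hR]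
    have hσA : (B.transp i).sigma = B.sigma := by rw [Vertex.transp_of_isRST hv hR]
    have h3 : (B.transp i).v i.succ = (B.transp i).v i.castSucc := by rw [hvA, hv]
    have h1' : ((B.transp i).spec i.succ).2 + 2 ≤ ((B.transp i).spec i.castSucc).2 := by
      rw [h2]; simpa using h1
    have hR' := hA.isRST_of_spec h3 (Or.inr h1')
    have h4 := Vertex.spec_transp_of_isRST h3 hR'
    have h5 : (B.transp i).transp i = B := by
      refine (hA.transp i).ext_spec hB ?_
      rw [h4, h2]
      ext1 j
      simp
    refine ⟨?_, h2⟩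
    have h6 := Arrow.jump (q := q) (B.transp i) i h3.symm ((B.transp i).sigma i.castSucc)
      ((B.transp i).sigma i.succ)
      ((hA.sigma_lt _ _).2 (Or.inr ⟨h3.symm, Fin.castSucc_lt_succ⟩))
      (by rw [Vertex.transp_of_isRST h3 hR']) h1'
    rwa [h5] at h6
  · have h1 : B.v i.succ < B.v i.castSucc := by
      rcases h with h | h
      · exact h
      · exact absurd h.1 hv
    have h2 := Vertex.spec_transp_of_ne hv
    have hvA : (B.transp i).v = B.v ∘ Equiv.swap i.castSucc i.succ := by
      rw [Vertex.transp_of_ne hv]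
    have h3 : (B.transp i).v i.castSucc < (B.transp i).v i.succ := by
      rw [hvA]; simpa using h1
    have h5 : (B.transp i).transp i = B := by
      refine (hA.transp i).ext_spec hB ?_
      rw [Vertex.spec_transp_of_ne h3.ne', h2]
      ext1 j
      simp
    refine ⟨?_, h2⟩
    have h6 := Arrow.step (q := q) (B.transp i) i h3
    rwa [h5] at h6

theorem Vertex.IsStandard.of_arrow {A B : Vertex K μ n} (hA : A.IsStandard q s) {a : Label n}
    (h : Arrow q A a (some B)) : B.IsStandard q s := by
  cases a with
  | transp i =>
    rw [(hA.of_arrow_transp h).1]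
    exact hA.transp i
  | affine =>
    cases h
    exact hA.affine

variable {h : μ.card = n + 1}

theorem isStandard_of_isPath {p : List (Label n)} {W : Option (Vertex K μ n)}
    (hp : IsPath q s h p W) : ∀ A, W = some A → A.IsStandard q s := by
  induction hp with
  | nil =>
    rintro A ⟨⟩
    exact rootVertex_isStandard h
  | snoc p A a W hp ha ih =>
    rintro B rfl
    exact (ih A rfl).of_arrow ha

/-- A vertex of the graph other than `∅`. -/
def Reachable (q s : K) (h : μ.card = n + 1) (A : Vertex K μ n) : Prop :=
  ∃ p, IsPath q s h p (some A)

theorem Reachable.isStandard {A : Vertex K μ n} (hA : Reachable q s h A) : A.IsStandard q s :=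
  isStandard_of_isPath hA.choose_spec A rfl

theorem Reachable.snoc {A B : Vertex K μ n} (hA : Reachable q s h A) {a : Label n}
    (ha : Arrow q A a (some B)) : Reachable q s h B :=
  ⟨_, IsPath.snoc _ _ _ _ hA.choose_spec ha⟩

/-- The statistic `∑ j * col j` decreases when `k` and `k + 1` are exchanged so as to bring
the tableau nearer to the root tableau. -/
theorem sum_mul_col_exchange (T : Tab μ (n + 1)) (k : Fin n)
    (hc : col T.1 k.castSucc < col T.1 k.succ) :
    ∑ j : Fin (n + 1), j.val * col (exchange T.1 k.castSucc k.succ) j <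
      ∑ j : Fin (n + 1), j.val * col T.1 j := by
  have hne : k.castSucc ≠ k.succ := Fin.castSucc_lt_succ.ne
  have key : ∀ f : Fin (n + 1) → ℕ, ∑ j, f j =
      f k.castSucc + f k.succ + ∑ j ∈ (Finset.univ.erase k.castSucc).erase k.succ, f j := by
    intro f
    rw [add_assoc, Finset.add_sum_erase _ _ (by simp [hne.symm]),
      Finset.add_sum_erase _ _ (Finset.mem_univ _)]
  rw [key, key fun j => j.val * col T.1 j]
  have h1 : ∑ j ∈ (Finset.univ.erase k.castSucc).erase k.succ,
      j.val * col (exchange T.1 k.castSucc k.succ) j =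
      ∑ j ∈ (Finset.univ.erase k.castSucc).erase k.succ, j.val * col T.1 j := by
    refine Finset.sum_congr rfl fun j hj => ?_
    simp only [Finset.mem_erase, Finset.mem_univ, and_true] at hj
    simp [col, exchange, Equiv.swap_apply_of_ne_of_ne hj.2 hj.1]
  have h2 : col (exchange T.1 k.castSucc k.succ) k.castSucc = col T.1 k.succ := by
    simp [col, exchange]
  have h3 : col (exchange T.1 k.castSucc k.succ) k.succ = col T.1 k.castSucc := by
    simp [col, exchange]
  rw [h1, h2, h3]
  simp only [Fin.val_castSucc, Fin.val_succ]
  nlinarith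

/-- All tableaux occur at the vertices with `v = 0`. -/
theorem exists_reachable_zero (T : Tab μ (n + 1)) :
    ∃ A, Reachable q s h A ∧ A.v = 0 ∧ A.tab = T := by
  induction hm : ∑ j : Fin (n + 1), j.val * col T.1 j using Nat.strong_induction_on
    generalizing T with
  | _ m ih =>
    by_cases hT : T = rootTab μ h
    · exact ⟨rootVertex s h, ⟨[], IsPath.nil⟩, rfl, hT.symm⟩
    obtain ⟨k, hr, hc⟩ := exists_descent T h hT
    have hR := exchange_isRST T k hr.ne' hc.ne
    obtain ⟨A, hA, hv, hAT⟩ := ih _ (by rw [← hm]; exact sum_mul_col_exchange T k hc)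
      ⟨_, hR⟩ rfl
    have hstd := hA.isStandard
    have hσ : A.sigma = Equiv.refl _ := perm_ext_of_lt fun i j => by
      rw [hstd.sigma_lt, hv]; simp
    have hAT' : A.tab.1 = exchange T.1 k.castSucc k.succ := by rw [hAT]
    have hback : exchange A.tab.1 (A.sigma k.castSucc) (A.sigma k.succ) = T.1 := by
      rw [hσ, hAT']
      exact exchange_exchange _ _ _
    have hv' : A.v k.succ = A.v k.castSucc := by rw [hv]; rfl
    have hR' : IsRST (exchange A.tab.1 (A.sigma k.castSucc) (A.sigma k.succ)) := by
      rw [hback]; exact T.2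
    have htr := Vertex.transp_of_isRST hv' hR'
    refine ⟨A.transp k, hA.snoc (Arrow.jump A k hv'.symm k.castSucc k.succ
      Fin.castSucc_lt_succ ?_ ?_), ?_, ?_⟩
    · rw [htr]
      change exchange A.tab.1 (A.sigma _) (A.sigma _) = _
      rw [hσ]
      rfl
    · rw [hAT', content_exchange, content_exchange, Equiv.swap_apply_left, Equiv.swap_apply_right]
      unfold content
      omega
    · rw [htr]; exact hv
    · rw [htr]; exact Subtype.ext hback

/-- Every pair `(v, T)` occurs at some vertex. -/
theorem exists_reachable (v : Fin (n + 1) → ℕ) (T : Tab μ (n + 1)) :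
    ∃ A, Reachable q s h A ∧ A.v = v ∧ A.tab = T := by
  induction hm : ∑ j, v j using Nat.strong_induction_on generalizing v with
  | _ m ih =>
    by_cases hv : v = 0
    · subst hv
      exact exists_reachable_zero T
    -- a nonzero entry is moved to the last place, where `Ψ` produces it
    have key : ∀ k ≤ n, ∀ w : Fin (n + 1) → ℕ, ∑ j, w j = m →
        (∃ j : Fin (n + 1), j.val + k = n ∧ w j ≠ 0) →
        ∃ A, Reachable q s h A ∧ A.v = w ∧ A.tab = T := by
      intro k
      induction k with
      | zero =>
        rintro - w hw ⟨j, hj, hj0⟩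
        obtain rfl : j = Fin.last n := Fin.ext hj
        rw [Fin.sum_univ_castSucc] at hw
        obtain ⟨A, hA, hAv, hAT⟩ := ih (∑ i, (Fin.cons (w (Fin.last n) - 1)
          (fun i : Fin n => w i.castSucc) : Fin (n + 1) → ℕ) i)
          (by rw [Fin.sum_univ_succ]; simp only [Fin.cons_zero, Fin.cons_succ]; omega) _ rfl
        refine ⟨A.affine q, hA.snoc (Arrow.affine A), ?_, hAT⟩
        ext1 i
        refine Fin.lastCases ?_ (fun i => ?_) i
        · simp [Vertex.affine, hAv]; omega
        · simp [Vertex.affine, hAv]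
      | succ k ihk =>
        rintro hk w hw ⟨j, hj, hj0⟩
        by_cases hw0 : w ⟨j.val + 1, by omega⟩ ≠ 0
        · exact ihk (by omega) w hw ⟨_, by simp; omega, hw0⟩
        let i : Fin n := ⟨j.val, by omega⟩
        have hi : i.castSucc = j := rfl
        push Not at hw0
        have hi' : w i.succ = 0 := hw0
        obtain ⟨A, hA, hAv, hAT⟩ := ihk (by omega) (w ∘ Equiv.swap i.castSucc i.succ)
          (by rw [← hw]; exact Equiv.sum_comp (Equiv.swap i.castSucc i.succ) w)
          ⟨i.succ, by simp [i]; omega, by simpa [hi] using hj0⟩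
        have hlt : A.v i.castSucc < A.v i.succ := by
          rw [hAv]
          simp [hi, hi']
          omega
        refine ⟨A.transp i, hA.snoc (Arrow.step A i hlt), ?_, ?_⟩
        · rw [Vertex.transp_of_ne hlt.ne', hAv]
          ext1 x
          simp
        · rw [Vertex.transp_of_ne hlt.ne', hAT]
    obtain ⟨j, hj⟩ := Function.ne_iff.1 hv
    exact key (n - j.val) (by omega) v hm ⟨j, by omega, hj⟩

/-- The compatibility conditions characterize the vertices of the graph. -/
theorem Vertex.IsStandard.reachable {A : Vertex K μ n} (hA : A.IsStandard q s) :
    Reachable q s h A := by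
  obtain ⟨B, hB, hv, hT⟩ := exists_reachable (q := q) (s := s) (h := h) A.v A.tab
  rwa [← hB.isStandard.ext hA hv hT]

theorem existsUnique_reachable (v : Fin (n + 1) → ℕ) (T : Tab μ (n + 1)) :
    ∃! A, Reachable q s h A ∧ A.v = v ∧ A.tab = T := by
  obtain ⟨A, hA, hv, hT⟩ := exists_reachable (q := q) (s := s) (h := h) v T
  refine ⟨A, ⟨hA, hv, hT⟩, fun B hB => ?_⟩
  exact hB.1.isStandard.ext hA.isStandard (hB.2.1.trans hv.symm) (hB.2.2.trans hT.symm)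

/-- A vertex whose last entry of `v` is nonzero is the end point of an arrow `Ψ`. -/
theorem Vertex.IsStandard.exists_affine {B : Vertex K μ n} (hB : B.IsStandard q s)
    (h : μ.card = n + 1) (h0 : B.v (Fin.last n) ≠ 0) :
    ∃ A : Vertex K μ n, A.IsStandard q s ∧ A.affine q = B := by
  obtain ⟨A, hA, hv, hT⟩ := exists_reachable (q := q) (s := s) (h := h)
    (Fin.cons (B.v (Fin.last n) - 1) fun i : Fin n => B.v i.castSucc) B.tab
  refine ⟨A, hA.isStandard, hA.isStandard.affine.ext hB ?_ hT⟩
  ext1 i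
  refine Fin.lastCases ?_ (fun i => ?_) i
  · simp [Vertex.affine, hv]; omega
  · simp [Vertex.affine, hv]

end Vertices

/-! ### Eigenfunctions -/

section Relations
variable {K : Type*} [Field K] {q s : K} {μ : YoungDiagram} {n : ℕ}

theorem cherednik_boldT (q : K) (hs : s ≠ 0) (hs1 : ∀ m : ℤ, s ^ m = 1 → m = 0) {i : Fin n}
    {j : Fin (n + 1)} (h1 : j ≠ i.castSucc) (h2 : j ≠ i.succ) (P : VVPoly K μ n) :
    cherednik μ q s j (boldT μ s i P) = boldT μ s i (cherednik μ q s j P) := by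
  have h := ((isDoubleAffine (n := n) (μ := μ) q hs hs1).y_comm i.2 (Nat.le_of_lt_succ j.2)
    (fun h => h1 (Fin.ext h)) (fun h => h2 (Fin.ext h))).eq
  rw [extendOne_val, dif_pos j.2] at h
  exact LinearMap.congr_fun h P

theorem cherednik_succ_boldT (q : K) (hs : s ≠ 0) (hs1 : ∀ m : ℤ, s ^ m = 1 → m = 0) (i : Fin n)
    (P : VVPoly K μ n) :
    cherednik μ q s i.succ (boldT μ s i P) = boldT μ s i (cherednik μ q s i.castSucc P) +
      (1 - s) • cherednik μ q s i.castSucc P := by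
  have h := (isDoubleAffine (n := n) (μ := μ) q hs hs1).y_succ_mul_t i.2
  rw [extendOne_val, dif_pos (by omega), dif_pos (by omega)] at h
  exact LinearMap.congr_fun h P

theorem cherednik_castSucc_boldT (q : K) (hs : s ≠ 0) (hs1 : ∀ m : ℤ, s ^ m = 1 → m = 0)
    (i : Fin n) (P : VVPoly K μ n) :
    cherednik μ q s i.castSucc (boldT μ s i P) = boldT μ s i (cherednik μ q s i.succ P) -
      (1 - s) • cherednik μ q s i.castSucc P := by
  have h := (isDoubleAffine (n := n) (μ := μ) q hs hs1).y_mul_t i.2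
  rw [extendOne_val, dif_pos (by omega), dif_pos (by omega)] at h
  exact LinearMap.congr_fun h P

theorem cherednik_castSucc_boldPhi (q : K) (hs : s ≠ 0) (hs1 : ∀ m : ℤ, s ^ m = 1 → m = 0)
    (i : Fin n) (P : VVPoly K μ n) :
    cherednik μ q s i.castSucc (boldPhi μ s n P) =
      boldPhi μ s n (cherednik μ q s i.succ P) := by
  have h := (isDoubleAffine (n := n) (μ := μ) q hs hs1).y_mul_phi i.2
  rw [← boldPhi_eq, dif_pos (by omega), dif_pos (by omega)] at h
  exact LinearMap.congr_fun h P

theorem cherednik_last_boldPhi (q : K) (hs : s ≠ 0) (hs1 : ∀ m : ℤ, s ^ m = 1 → m = 0)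
    (P : VVPoly K μ n) :
    cherednik μ q s (Fin.last n) (boldPhi μ s n P) =
      q • boldPhi μ s n (cherednik μ q s 0 P) := by
  have h := (isDoubleAffine (n := n) (μ := μ) q hs hs1).y_last_mul_phi
  rw [← boldPhi_eq, dif_pos (by omega), dif_pos (by omega)] at h
  exact LinearMap.congr_fun h P

theorem boldT_boldPhi (hs : s ≠ 0) (hs1 : ∀ m : ℤ, s ^ m = 1 → m = 0) {i j : Fin n}
    (hij : i.val + 1 = j.val) (P : VVPoly K μ n) :
    boldT μ s i (boldPhi μ s n P) = boldPhi μ s n (boldT μ s j P) := by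
  have h := (isDoubleAffine (n := n) (μ := μ) 1 hs hs1).t_mul_phi (i := i.val) (by omega)
  rw [← boldPhi_eq, hij, extendOne_val, extendOne_val] at h
  exact LinearMap.congr_fun h P

theorem boldT_boldPhi_boldPhi (hs : s ≠ 0) (hs1 : ∀ m : ℤ, s ^ m = 1 → m = 0)
    (P : VVPoly K μ (n + 1)) :
    boldT μ s (Fin.last n) (boldPhi μ s (n + 1) (boldPhi μ s (n + 1) P)) =
      boldPhi μ s (n + 1) (boldPhi μ s (n + 1) (boldT μ s 0 P)) := by
  have h := (isDoubleAffine (n := n + 1) (μ := μ) 1 hs hs1).t_mul_phi_sq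
  rw [← boldPhi_eq, extendOne_of_lt _ (by omega), extendOne_of_lt _ (by omega)] at h
  exact LinearMap.congr_fun h P

theorem mulX_injective (j : Fin (n + 1)) : Function.Injective (mulX K μ j) := by
  have h : Function.Injective
      (LinearMap.mulLeft K (MvPolynomial.X j : MvPolynomial (Fin (n + 1)) K)) :=
    fun a b hab => mul_left_cancel₀ (MvPolynomial.X_ne_zero j) hab
  exact Module.Flat.rTensor_preserves_injective_linearMap _ h

theorem boldPhi_injective (hs : s ≠ 0) (hs1 : ∀ m : ℤ, s ^ m = 1 → m = 0) :
    Function.Injective (boldPhi μ s n) := by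
  rw [boldPhi_eq hs hs1, IsDoubleAffine.phi, dif_pos (by omega)]
  intro a b hab
  have h1 := mulX_injective _ hab
  have h2 := congrArg
    (↑(ascProd (extendOne (boldUnit (n := n) μ hs hs1)) n) : Module.End K (VVPoly K μ n)) h1
  simpa only [← Module.End.mul_apply, Units.mul_inv, Module.End.one_apply] using h2

theorem boldT_one_tmul (i : Fin n) (u : V K μ (n + 1)) :
    boldT μ s i ((1 : MvPolynomial (Fin (n + 1)) K) ⊗ₜ u) = 1 ⊗ₜ heckeT μ s i u := by
  have h : divDiff K i 1 = 0 := by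
    apply mul_left_cancel₀ (X_sub_X_ne_zero K i)
    rw [divDiff_spec, mul_zero]
    simp [sX_apply]
  rw [boldT_tmul, deltaX_apply, h]
  simp [sX_apply]

/-- In degree `0` the Cherednik operators act by the Jucys–Murphy operators. -/
theorem cherednik_one_tmul (q : K) (hs : s ≠ 0) (hs1 : ∀ m : ℤ, s ^ m = 1 → m = 0)
    (i : Fin (n + 1)) (u : V K μ (n + 1)) :
    cherednik μ q s i ((1 : MvPolynomial (Fin (n + 1)) K) ⊗ₜ u) = 1 ⊗ₜ jucysMurphy μ s i u := by
  have hD := isDoubleAffine (n := n) (μ := μ) q hs hs1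
  induction i using Fin.reverseInduction generalizing u with
  | last =>
    have h1 : ∀ k ≤ n, ∀ v : V K μ (n + 1),
        (↑(descProd (extendOne (boldUnit (n := n) μ hs hs1)) k) : Module.End K (VVPoly K μ n))
          (1 ⊗ₜ v) = 1 ⊗ₜ descProd (extendOne (heckeT (n := n) μ s)) k v := by
      intro k hk v
      induction k with
      | zero => rfl
      | succ k ih =>
        rw [descProd, descProd, Units.val_mul, Module.End.mul_apply, ih (by omega),
          extendOne_of_lt _ hk, extendOne_of_lt _ hk]
        exact boldT_one_tmul _ _
    have h2 : ∀ k ≤ n, ∀ v : V K μ (n + 1), ∃ v' : V K μ (n + 1),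
        (↑(descProd (extendOne (boldUnit (n := n) μ hs hs1)) k)⁻¹ : Module.End K (VVPoly K μ n))
          (1 ⊗ₜ v) = 1 ⊗ₜ v' := by
      intro k hk
      induction k with
      | zero => exact fun v => ⟨v, rfl⟩
      | succ k ih =>
        intro v
        obtain ⟨v', hv'⟩ := ih (by omega) (s⁻¹ • (heckeT μ s ⟨k, hk⟩ v + (1 - s) • v))
        refine ⟨v', ?_⟩
        rw [← hv', descProd, mul_inv_rev, Units.val_mul, Module.End.mul_apply, extendOne_of_lt _ hk]
        congr 1
        change boldTinv μ s ⟨k, hk⟩ _ = _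
        simp [boldTinv, boldT_one_tmul, TensorProduct.tmul_add, TensorProduct.tmul_smul]
    have h3 := hD.y_last
    rw [dif_pos (by omega)] at h3
    obtain ⟨v, hv⟩ := h2 n le_rfl u
    have h4 : (↑(descProd (extendOne (boldUnit (n := n) μ hs hs1)) n) : Module.End K (VVPoly K μ n))
        (1 ⊗ₜ v) = 1 ⊗ₜ u := by
      rw [← hv, ← Module.End.mul_apply, Units.mul_inv, Module.End.one_apply]
    change cherednik μ q s ⟨n, _⟩ _ = _
    rw [h3, Module.End.mul_apply, hv, boldW_tmul, map_one, jucysMurphy_last, Module.End.one_apply,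
      ← h4, h1 n le_rfl, heckeS, rightProd, finRange_map, reverse_prod_map_range]
  | cast i ih =>
    have h1 := hD.y_rec i i.2
    rw [extendOne_val, dif_pos (by omega), dif_pos (by omega)] at h1
    have h2 := LinearMap.congr_fun h1 (1 ⊗ₜ u)
    have h3 := LinearMap.congr_fun (heckeT_jucysMurphy (μ := μ) hs hs1 i) u
    apply smul_right_injective _ hs
    refine h2.trans ?_
    change boldT μ s i (cherednik μ q s i.succ (boldT μ s i _)) = _
    rw [boldT_one_tmul, ih, boldT_one_tmul]
    simp only [← TensorProduct.tmul_smul]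
    exact congrArg _ h3

end Relations

section Scalars
variable {K : Type*} [Field K] {q s : K}

/-- The eigenvalue `q ^ a s ^ b` with exponents `(a, b)`. -/
def specValue (q s : K) (e : ℕ × ℤ) : K := q ^ e.1 * s ^ e.2

theorem specValue_ne_zero (hq : q ≠ 0) (hs : s ≠ 0) (e : ℕ × ℤ) : specValue q s e ≠ 0 :=
  mul_ne_zero (pow_ne_zero _ hq) (zpow_ne_zero _ hs)

theorem specValue_succ (e : ℕ × ℤ) : specValue q s (e.1 + 1, e.2) = q * specValue q s e := by
  simp [specValue, pow_succ']; ring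

/-- The scalar `(1 - s) / (1 - y / x)` in the operator attached to an arrow `s_i`. -/
def stepCoeff (s x y : K) : K := (1 - s) / (1 - y / x)

theorem stepCoeff_mul_left (hq : q ≠ 0) (s x y : K) :
    stepCoeff s (q * x) (q * y) = stepCoeff s x y := by
  rw [stepCoeff, mul_div_mul_left _ _ hq, stepCoeff]

theorem Prec.zpow_ne (hq : q ≠ 0) (hs : s ≠ 0)
    (hqs : ∀ a b : ℤ, q ^ a * s ^ b = 1 → a = 0 ∧ b = 0) {e e' : ℕ × ℤ} (h : Prec e e') {c : ℤ}
    (hc : c ≤ 1) : specValue q s e' * s ^ c ≠ specValue q s e := by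
  intro h1
  have h2 := hqs ((e'.1 : ℤ) - e.1) (e'.2 + c - e.2) (by
    rw [zpow_sub₀ hq, zpow_sub₀ hs, zpow_add₀ hs, div_mul_div_comm, ← mul_assoc,
      zpow_natCast, zpow_natCast]
    exact (div_eq_one_iff_eq (specValue_ne_zero hq hs e)).2 h1)
  unfold Prec at h
  omega

theorem Prec.one_sub_ne_zero (hq : q ≠ 0) (hs : s ≠ 0)
    (hqs : ∀ a b : ℤ, q ^ a * s ^ b = 1 → a = 0 ∧ b = 0) {e e' : ℕ × ℤ} (h : Prec e e') :
    1 - specValue q s e' / specValue q s e ≠ 0 := by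
  intro h1
  have h2 := h.zpow_ne hq hs hqs (c := 0) (by omega)
  rw [sub_eq_zero, eq_comm, div_eq_one_iff_eq (specValue_ne_zero hq hs e)] at h1
  simp [h1] at h2

theorem stepCoeff_mul_sub {x y : K} (hx : x ≠ 0) (hxy : 1 - y / x ≠ 0) :
    stepCoeff s x y * (x - y) = (1 - s) * x := by
  have h1 : x - y = x * (1 - y / x) := by field_simp
  rw [h1, stepCoeff, mul_left_comm, div_mul_cancel₀ _ hxy, mul_comm]

/-- The relation between the scalars behind the Yang–Baxter equation. -/
theorem stepCoeff_mul {x y z : K} (hx : x ≠ 0) (hy : y ≠ 0) (hxy : 1 - y / x ≠ 0)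
    (hyz : 1 - z / y ≠ 0) (hxz : 1 - z / x ≠ 0) :
    stepCoeff s x y * stepCoeff s y z =
      stepCoeff s x z * (stepCoeff s x y + stepCoeff s y z - (1 - s)) := by
  have h1 : x - y ≠ 0 := by
    intro h; apply hxy; rw [sub_eq_zero.1 h, div_self hy, sub_self]
  have h2 : y - z ≠ 0 := by
    intro h; apply hyz; rw [← sub_eq_zero.1 h, div_self hy, sub_self]
  have h3 : x - z ≠ 0 := by
    intro h; apply hxz; rw [← sub_eq_zero.1 h, div_self hx, sub_self]
  unfold stepCoeff
  field_simp
  ring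

end Scalars

section Steps
variable {K : Type*} [Field K] {q s : K} {μ : YoungDiagram} {n : ℕ} {h : μ.card = n + 1}

/-- `Reach q s h m A P`: the polynomial of some path of length `m` from the root to `A` is `P`. -/
inductive Reach (q s : K) (h : μ.card = n + 1) : ℕ → Vertex K μ n → VVPoly K μ n → Prop
  | root : Reach q s h 0 (rootVertex s h)
      ((1 : MvPolynomial (Fin (n + 1)) K) ⊗ₜ[K] Finsupp.single (rootTab μ h) 1)
  | snoc {m : ℕ} {A B : Vertex K μ n} {P : VVPoly K μ n} {a : Label n} (hA : Reach q s h m A P)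
      (ha : Arrow q A a (some B)) : Reach q s h (m + 1) B (pathStep q s (A, P) a).2

theorem pathStep_fst_of_arrow {A B : Vertex K μ n} {a : Label n} (ha : Arrow q A a (some B))
    (P : VVPoly K μ n) : (pathStep q s (A, P) a).1 = B := by
  cases ha <;> rfl

theorem pathPoly_snoc {p : List (Label n)} {A : Vertex K μ n} (a : Label n)
    (hA : (p.foldl (pathStep q s) (rootVertex s h,
      (1 : MvPolynomial (Fin (n + 1)) K) ⊗ₜ[K] Finsupp.single (rootTab μ h) 1)).1 = A) :
    pathPoly q s h (p ++ [a]) = (pathStep q s (A, pathPoly q s h p) a).2 := by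
  subst hA
  rw [pathPoly, List.foldl_append]
  rfl

theorem isPath_foldl {p : List (Label n)} {W : Option (Vertex K μ n)} (hp : IsPath q s h p W) :
    ∀ A, W = some A → (p.foldl (pathStep q s) (rootVertex s h,
      (1 : MvPolynomial (Fin (n + 1)) K) ⊗ₜ[K] Finsupp.single (rootTab μ h) 1)).1 = A := by
  induction hp with
  | nil => rintro A ⟨⟩; rfl
  | snoc p A a W hp ha ih =>
    rintro B rfl
    rw [List.foldl_append]
    have h1 := ih A rfl
    generalize p.foldl _ _ = x at h1
    subst h1
    exact pathStep_fst_of_arrow ha x.2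

theorem IsPath.reach {p : List (Label n)} {W : Option (Vertex K μ n)} (hp : IsPath q s h p W) :
    ∀ A, W = some A → Reach q s h p.length A (pathPoly q s h p) := by
  induction hp with
  | nil => rintro A ⟨⟩; exact Reach.root
  | snoc p A a W hp ha ih =>
    rintro B rfl
    rw [pathPoly_snoc a (isPath_foldl hp A rfl), List.length_append]
    exact (ih A rfl).snoc ha

theorem Reach.isStandard {m : ℕ} {A : Vertex K μ n} {P : VVPoly K μ n}
    (hA : Reach q s h m A P) : A.IsStandard q s := by
  induction hA with
  | root => exact rootVertex_isStandard h
  | snoc hA ha ih => exact ih.of_arrow ha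

theorem pathStep_transp {A : Vertex K μ n} (hA : A.IsStandard q s) (P : VVPoly K μ n) (i : Fin n) :
    (pathStep q s (A, P) (Label.transp i)).2 = boldT μ s i P +
      stepCoeff s (specValue q s (A.spec i.castSucc)) (specValue q s (A.spec i.succ)) • P := by
  have h1 := hA.zeta_spec
  simp only [pathStep, stepCoeff, specValue, h1]

theorem pathStep_affine (A : Vertex K μ n) (P : VVPoly K μ n) :
    (pathStep q s (A, P) Label.affine).2 = boldPhi μ s n P := rfl

/-- The operator attached to an arrow `s_i` does not annihilate a nonzero vector: by the quadratic
relation this would force the quotient of the two eigenvalues to be `s` or `s⁻¹`, which `Prec`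
excludes. -/
theorem boldT_add_ne_zero (hq : q ≠ 0) (hs : s ≠ 0)
    (hqs : ∀ a b : ℤ, q ^ a * s ^ b = 1 → a = 0 ∧ b = 0) (hs1 : ∀ m : ℤ, s ^ m = 1 → m = 0)
    {e e' : ℕ × ℤ} (he : Prec e e') {P : VVPoly K μ n} (hP : P ≠ 0) (i : Fin n) :
    boldT μ s i P + stepCoeff s (specValue q s e) (specValue q s e') • P ≠ 0 := by
  intro h0
  have h1 := LinearMap.congr_fun (boldT_quad (μ := μ) hs hs1 i) P
  simp only [Module.End.mul_apply, LinearMap.add_apply, LinearMap.smul_apply,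
    Module.End.one_apply] at h1
  rw [eq_neg_of_add_eq_zero_left h0, map_neg, map_smul, eq_neg_of_add_eq_zero_left h0] at h1
  replace h1 : (stepCoeff s (specValue q s e) (specValue q s e') ^ 2 + (s - 1) *
      stepCoeff s (specValue q s e) (specValue q s e') - s) • P = 0 := by
    linear_combination (norm := module) h1
  have h2 := (smul_eq_zero.1 h1).resolve_right hP
  have h3 := he.one_sub_ne_zero hq hs hqs
  have h4 := specValue_ne_zero hq hs e
  have h5 := he.zpow_ne hq hs hqs (c := 1) le_rfl
  have h6 := he.zpow_ne hq hs hqs (c := -1) (by omega)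
  rw [zpow_one] at h5
  rw [zpow_neg_one, ← div_eq_mul_inv, ne_eq, div_eq_iff hs] at h6
  generalize specValue q s e = x at *
  generalize specValue q s e' = y at *
  have h7 := stepCoeff_mul_sub (s := s) h4 h3
  have h8 : (x * s - y) * (x - y * s) = 0 := by
    linear_combination (-(x - y) ^ 2) * h2 +
      (stepCoeff s x y * (x - y) + (1 - s) * x + (s - 1) * (x - y)) * h7
  rcases mul_eq_zero.1 h8 with h9 | h9
  · exact h6 (sub_eq_zero.1 h9).symm
  · exact h5 (sub_eq_zero.1 h9).symm

/-- The polynomials of the paths are simultaneous eigenfunctions of the Cherednik operators. -/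
theorem Reach.eigen (hq : q ≠ 0) (hs : s ≠ 0)
    (hqs : ∀ a b : ℤ, q ^ a * s ^ b = 1 → a = 0 ∧ b = 0) (hs1 : ∀ m : ℤ, s ^ m = 1 → m = 0)
    {m : ℕ} {A : Vertex K μ n} {P : VVPoly K μ n} (hA : Reach q s h m A P) :
    P ≠ 0 ∧ ∀ i, cherednik μ q s i P = specValue q s (A.spec i) • P := by
  induction hA with
  | root =>
    constructor
    · have h1 := ((MvPolynomial.basisMonomials (Fin (n + 1)) K).tensorProduct
        (Finsupp.basisSingleOne (R := K) (ι := Tab μ (n + 1)))).ne_zero (0, rootTab μ h)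
      rw [Module.Basis.tensorProduct_apply, MvPolynomial.coe_basisMonomials,
        Finsupp.coe_basisSingleOne] at h1
      exact h1
    · intro i
      rw [cherednik_one_tmul q hs hs1]
      rw [jucysMurphy, Finsupp.linearCombination_single, one_smul, TensorProduct.tmul_smul]
      simp [Vertex.spec, rootVertex, specValue]
  | @snoc m A B P a hA ha ih =>
    obtain ⟨hP, hy⟩ := ih
    have hstd := hA.isStandard
    cases a with
    | transp i =>
      obtain ⟨-, hprec, hspec⟩ := hstd.of_arrow_transp ha
      rw [pathStep_transp hstd]
      refine ⟨boldT_add_ne_zero hq hs hqs hs1 hprec hP i, fun j => ?_⟩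
      have h3 := hprec.one_sub_ne_zero hq hs hqs
      have h4 := specValue_ne_zero hq hs (A.spec i.castSucc)
      have h5 := (stepCoeff_mul_sub (s := s) h4 h3).symm
      rw [hspec, map_add, map_smul, Function.comp_apply]
      by_cases h1 : j = i.castSucc
      · subst h1
        rw [cherednik_castSucc_boldT q hs hs1, hy, hy, map_smul, Equiv.swap_apply_left]
        linear_combination (norm := module) -h5 • P
      by_cases h2 : j = i.succ
      · subst h2
        rw [cherednik_succ_boldT q hs hs1, hy, hy, map_smul, Equiv.swap_apply_right]
        linear_combination (norm := module) h5 • P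
      · rw [cherednik_boldT q hs hs1 h1 h2, hy, map_smul, Equiv.swap_apply_of_ne_of_ne h1 h2]
        module
    | affine =>
      cases ha
      rw [pathStep_affine, Vertex.spec_affine]
      refine ⟨fun h0 => hP (boldPhi_injective hs hs1 (h0.trans (map_zero _).symm)), fun j => ?_⟩
      refine Fin.lastCases ?_ (fun j => ?_) j
      · rw [cherednik_last_boldPhi q hs hs1, hy, rotSpec_last, specValue_succ, map_smul, smul_smul]
      · rw [cherednik_castSucc_boldPhi q hs hs1, hy, rotSpec_castSucc, map_smul]

end Steps

/-! ### Path independence -/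

section Confluence
variable {K : Type*} [Field K] {q s : K} {μ : YoungDiagram} {n : ℕ} {h : μ.card = n + 1}

/-- The operator attached to an arrow `s_i` from a vertex with exponents `e`, `e'` at the places
`i` and `i + 1`. -/
def intertwiner (μ : YoungDiagram) (q s : K) (i : Fin n) (e e' : ℕ × ℤ) :
    Module.End K (VVPoly K μ n) :=
  boldT μ s i + stepCoeff s (specValue q s e) (specValue q s e') • 1

theorem intertwiner_apply (i : Fin n) (e e' : ℕ × ℤ) (P : VVPoly K μ n) :
    intertwiner μ q s i e e' P =
      boldT μ s i P + stepCoeff s (specValue q s e) (specValue q s e') • P := rfl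

theorem Reach.transp_of_prec {A : Vertex K μ n} (hA : A.IsStandard q s) {i : Fin n}
    (hp : Prec (A.spec i.succ) (A.spec i.castSucc)) {m : ℕ} {P : VVPoly K μ n}
    (hR : Reach q s h m (A.transp i) P) :
    Reach q s h (m + 1) A (intertwiner μ q s i (A.spec i.succ) (A.spec i.castSucc) P) := by
  obtain ⟨h1, h2⟩ := hA.arrow_of_prec hp
  have h3 := hR.snoc h1
  rw [pathStep_transp (hA.transp i), h2] at h3
  simpa [intertwiner_apply] using h3

theorem Reach.affine {A : Vertex K μ n} {m : ℕ} {P : VVPoly K μ n} (hR : Reach q s h m A P) :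
    Reach q s h (m + 1) (A.affine q) (boldPhi μ s n P) :=
  hR.snoc (Arrow.affine A)

theorem Vertex.IsStandard.exists_reach (h : μ.card = n + 1) {A : Vertex K μ n}
    (hA : A.IsStandard q s) : ∃ m P, Reach q s h m A P := by
  obtain ⟨p, hp⟩ := hA.reachable (h := h)
  exact ⟨_, _, hp.reach A rfl⟩

/-- An arrow `s_i` is determined by its target. -/
theorem Vertex.IsStandard.of_arrow_transp_target {A B : Vertex K μ n} (hB : B.IsStandard q s)
    {i : Fin n} (ha : Arrow q B (Label.transp i) (some A)) :
    B = A.transp i ∧ Prec (A.spec i.succ) (A.spec i.castSucc) ∧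
      B.spec = A.spec ∘ Equiv.swap i.castSucc i.succ := by
  obtain ⟨h1, h2, h3⟩ := hB.of_arrow_transp ha
  have hA := hB.of_arrow ha
  have h4 : B.spec = A.spec ∘ Equiv.swap i.castSucc i.succ := by
    rw [h3]; ext1 x; simp
  have h5 : Prec (A.spec i.succ) (A.spec i.castSucc) := by
    rw [h3]; simpa using h2
  refine ⟨hB.ext_spec (hA.transp i) ?_, h5, h4⟩
  rw [(hA.arrow_of_prec h5).2, h4]

/-- Arrows `a` from `B` and `b` from `C` to the same vertex are joinable when some paths of the
same length to `B` and to `C`, continued by `a` and by `b`, give the same polynomial. -/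
def Joinable (q s : K) (h : μ.card = n + 1) (B : Vertex K μ n) (a : Label n) (C : Vertex K μ n)
    (b : Label n) : Prop :=
  ∃ m P Q, Reach q s h m B P ∧ Reach q s h m C Q ∧
    (pathStep q s (B, P) a).2 = (pathStep q s (C, Q) b).2

theorem Joinable.symm {B C : Vertex K μ n} {a b : Label n} (hj : Joinable q s h B a C b) :
    Joinable q s h C b B a := by
  obtain ⟨m, P, Q, h1, h2, h3⟩ := hj
  exact ⟨m, Q, P, h2, h1, h3.symm⟩

theorem pathStep_transp_of_prec {A : Vertex K μ n} (hA : A.IsStandard q s) {i : Fin n}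
    (hp : Prec (A.spec i.succ) (A.spec i.castSucc)) (P : VVPoly K μ n) :
    (pathStep q s (A.transp i, P) (Label.transp i)).2 =
      intertwiner μ q s i (A.spec i.succ) (A.spec i.castSucc) P := by
  rw [pathStep_transp (hA.transp i), (hA.arrow_of_prec hp).2]
  simp [intertwiner_apply]

theorem intertwiner_comm (q : K) (hs : s ≠ 0) (hs1 : ∀ m : ℤ, s ^ m = 1 → m = 0) {i j : Fin n}
    (hij : i.val + 2 ≤ j.val) (e e' f f' : ℕ × ℤ)
    (P : VVPoly K μ n) :
    intertwiner μ q s i e e' (intertwiner μ q s j f f' P) =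
      intertwiner μ q s j f f' (intertwiner μ q s i e e' P) := by
  have h1 := LinearMap.congr_fun (boldT_comm (μ := μ) hs hs1 hij) P
  simp only [Module.End.mul_apply] at h1
  simp only [intertwiner_apply, map_add, map_smul, h1]
  module

/-- The Yang–Baxter equation for the operators attached to the arrows `s_i`. -/
theorem intertwiner_braid (hq : q ≠ 0) (hs : s ≠ 0)
    (hqs : ∀ a b : ℤ, q ^ a * s ^ b = 1 → a = 0 ∧ b = 0) (hs1 : ∀ m : ℤ, s ^ m = 1 → m = 0)
    {i j : Fin n} (hij : i.val + 1 = j.val) {e e' e'' : ℕ × ℤ} (h1 : Prec e e') (h2 : Prec e' e'')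
    (P : VVPoly K μ n) :
    intertwiner μ q s i e' e'' (intertwiner μ q s j e e'' (intertwiner μ q s i e e' P)) =
      intertwiner μ q s j e e' (intertwiner μ q s i e e'' (intertwiner μ q s j e' e'' P)) := by
  have h3 := stepCoeff_mul (s := s) (specValue_ne_zero hq hs e) (specValue_ne_zero hq hs e')
    (h1.one_sub_ne_zero hq hs hqs) (h2.one_sub_ne_zero hq hs hqs)
    ((h1.trans h2).one_sub_ne_zero hq hs hqs)
  have hi := LinearMap.congr_fun (boldT_quad (μ := μ) hs hs1 i) P
  have hj := LinearMap.congr_fun (boldT_quad (μ := μ) hs hs1 j) P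
  have hb := LinearMap.congr_fun (boldT_braid (μ := μ) hs hs1 hij) P
  simp only [Module.End.mul_apply, LinearMap.add_apply, LinearMap.smul_apply,
    Module.End.one_apply] at hi hj hb
  simp only [intertwiner_apply, map_add, map_smul, hi, hj, hb]
  generalize stepCoeff s (specValue q s e) (specValue q s e') = a at *
  generalize stepCoeff s (specValue q s e') (specValue q s e'') = b at *
  generalize stepCoeff s (specValue q s e) (specValue q s e'') = c at *
  linear_combination (norm := module) h3 • (boldT μ s j P) - h3 • (boldT μ s i P)

theorem joinable_transp_comm (hs : s ≠ 0) (hs1 : ∀ m : ℤ, s ^ m = 1 → m = 0)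
    (h : μ.card = n + 1) {A : Vertex K μ n} (hA : A.IsStandard q s) {i j : Fin n}
    (hij : i.val + 2 ≤ j.val) (hi : Prec (A.spec i.succ) (A.spec i.castSucc))
    (hj : Prec (A.spec j.succ) (A.spec j.castSucc)) :
    Joinable q s h (A.transp i) (Label.transp i) (A.transp j) (Label.transp j) := by
  have hB := hA.transp i
  have hC := hA.transp j
  have hBs := (hA.arrow_of_prec hi).2
  have hCs := (hA.arrow_of_prec hj).2
  have hd1 : i.succ ≠ j.succ := by simp [Fin.ext_iff]; omega
  have hd2 : i.succ ≠ j.castSucc := by simp [Fin.ext_iff]; omega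
  have hd3 : i.castSucc ≠ j.succ := by simp [Fin.ext_iff]; omega
  have hd4 : i.castSucc ≠ j.castSucc := by simp [Fin.ext_iff]; omega
  have hB1 : (A.transp i).spec j.castSucc = A.spec j.castSucc := by
    rw [hBs, Function.comp_apply, Equiv.swap_apply_of_ne_of_ne hd4.symm hd2.symm]
  have hB2 : (A.transp i).spec j.succ = A.spec j.succ := by
    rw [hBs, Function.comp_apply, Equiv.swap_apply_of_ne_of_ne hd3.symm hd1.symm]
  have hC1 : (A.transp j).spec i.castSucc = A.spec i.castSucc := by
    rw [hCs, Function.comp_apply, Equiv.swap_apply_of_ne_of_ne hd4 hd3]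
  have hC2 : (A.transp j).spec i.succ = A.spec i.succ := by
    rw [hCs, Function.comp_apply, Equiv.swap_apply_of_ne_of_ne hd2 hd1]
  have hBj : Prec ((A.transp i).spec j.succ) ((A.transp i).spec j.castSucc) := by rwa [hB1, hB2]
  have hCi : Prec ((A.transp j).spec i.succ) ((A.transp j).spec i.castSucc) := by rwa [hC1, hC2]
  have hD : (A.transp i).transp j = (A.transp j).transp i := by
    apply (hB.transp j).ext_spec (hC.transp i)
    rw [(hB.arrow_of_prec hBj).2, (hC.arrow_of_prec hCi).2, hBs, hCs]
    ext1 x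
    simp only [Function.comp_apply]
    congr 1
    simp only [Equiv.swap_apply_def]
    split_ifs <;> simp_all
  obtain ⟨m, P, hP⟩ := (hB.transp j).exists_reach h
  refine ⟨m + 1, _, _, hP.transp_of_prec hB hBj, (hD ▸ hP).transp_of_prec hC hCi, ?_⟩
  rw [pathStep_transp_of_prec hA hi, pathStep_transp_of_prec hA hj, hB1, hB2, hC1, hC2,
    intertwiner_comm q hs hs1 hij]

theorem rotSpec_rotSpec_swap (e : Fin (n + 2) → ℕ × ℤ) :
    rotSpec (rotSpec e) ∘ Equiv.swap (Fin.last n).castSucc (Fin.last n).succ =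
      rotSpec (rotSpec (e ∘ Equiv.swap (Fin.castSucc 0) (Fin.succ 0))) := by
  have h1 : ∀ f : Fin (n + 2) → ℕ × ℤ, rotSpec f 0 = f (Fin.succ 0) :=
    fun f => rotSpec_castSucc f 0
  ext1 x
  rw [Function.comp_apply, Fin.succ_last, Fin.castSucc_zero]
  refine Fin.lastCases ?_ (fun x => ?_) x
  · rw [Equiv.swap_apply_right, rotSpec_castSucc, Fin.succ_last, rotSpec_last, rotSpec_last,
      h1, Function.comp_apply, Equiv.swap_apply_right]
  refine Fin.lastCases ?_ (fun x => ?_) x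
  · rw [Equiv.swap_apply_left, rotSpec_last, h1, rotSpec_castSucc, Fin.succ_last, rotSpec_last,
      Function.comp_apply, Equiv.swap_apply_left]
  · rw [Equiv.swap_apply_of_ne_of_ne (by simp [Fin.ext_iff]; omega) (by simp [Fin.ext_iff]; omega),
      rotSpec_castSucc, rotSpec_castSucc, ← Fin.castSucc_succ, rotSpec_castSucc, rotSpec_castSucc,
      Function.comp_apply, Equiv.swap_apply_of_ne_of_ne] <;> simp [Fin.ext_iff]

/-- The common vertex is reached by reversing three consecutive exponents in the two possible
ways. -/
theorem joinable_transp_braid (hq : q ≠ 0) (hs : s ≠ 0)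
    (hqs : ∀ a b : ℤ, q ^ a * s ^ b = 1 → a = 0 ∧ b = 0) (hs1 : ∀ m : ℤ, s ^ m = 1 → m = 0)
    (h : μ.card = n + 1) {A : Vertex K μ n} (hA : A.IsStandard q s) {i j : Fin n}
    (hij : i.val + 1 = j.val) (hi : Prec (A.spec i.succ) (A.spec i.castSucc))
    (hj : Prec (A.spec j.succ) (A.spec j.castSucc)) :
    Joinable q s h (A.transp i) (Label.transp i) (A.transp j) (Label.transp j) := by
  have hB := hA.transp i
  have hC := hA.transp j
  have hBs := (hA.arrow_of_prec hi).2
  have hCs := (hA.arrow_of_prec hj).2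
  have hmid : j.castSucc = i.succ := by simp [Fin.ext_iff]; omega
  rw [hmid] at hj hCs
  have hd1 : i.castSucc ≠ i.succ := Fin.castSucc_lt_succ.ne
  have hd2 : i.succ ≠ j.succ := by simp [Fin.ext_iff]; omega
  have hd3 : i.castSucc ≠ j.succ := by simp [Fin.ext_iff]; omega
  have e1 := Equiv.swap_apply_of_ne_of_ne hd3.symm hd2.symm
  have e2 := Equiv.swap_apply_of_ne_of_ne hd1 hd3
  -- the first and the last of the three exponents are related by transitivity
  have hij' := hj.trans hi
  have hBj : Prec ((A.transp i).spec j.succ) ((A.transp i).spec j.castSucc) := by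
    rw [hBs, hmid]; simpa [e1] using hij'
  have hCi : Prec ((A.transp j).spec i.succ) ((A.transp j).spec i.castSucc) := by
    rw [hCs]; simpa [e2] using hij'
  have hB' := hB.transp j
  have hC' := hC.transp i
  have hBs' := (hB.arrow_of_prec hBj).2
  have hCs' := (hC.arrow_of_prec hCi).2
  rw [hBs, hmid] at hBs'
  rw [hCs] at hCs'
  have hBi : Prec (((A.transp i).transp j).spec i.succ)
      (((A.transp i).transp j).spec i.castSucc) := by
    rw [hBs']; simpa [e1, e2] using hj
  have hCj : Prec (((A.transp j).transp i).spec j.succ)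
      (((A.transp j).transp i).spec j.castSucc) := by
    rw [hCs', hmid]; simpa [e1, e2] using hi
  have hD : ((A.transp i).transp j).transp i = ((A.transp j).transp i).transp j := by
    apply (hB'.transp i).ext_spec (hC'.transp j)
    rw [(hB'.arrow_of_prec hBi).2, (hC'.arrow_of_prec hCj).2, hBs', hCs', hmid]
    ext1 x
    exact congrArg A.spec (swap_swap_swap hd1 hd2 hd3 x)
  obtain ⟨m, P, hP⟩ := (hB'.transp i).exists_reach h
  refine ⟨m + 2, _, _, (hP.transp_of_prec hB' hBi).transp_of_prec hB hBj,
    ((hD ▸ hP).transp_of_prec hC' hCj).transp_of_prec hC hCi, ?_⟩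
  rw [pathStep_transp_of_prec hA hi, pathStep_transp_of_prec hA (by rwa [hmid])]
  have := intertwiner_braid hq hs hqs hs1 hij hj hi P
  rw [hBs', hCs', hBs, hCs, hmid]
  simpa [e1, e2] using this

theorem intertwiner_boldPhi (hs : s ≠ 0) (hs1 : ∀ m : ℤ, s ^ m = 1 → m = 0) {i j : Fin n}
    (hij : i.val + 1 = j.val) (e e' : ℕ × ℤ) (P : VVPoly K μ n) :
    intertwiner μ q s i e e' (boldPhi μ s n P) = boldPhi μ s n (intertwiner μ q s j e e' P) := by
  rw [intertwiner_apply, boldT_boldPhi hs hs1 hij, intertwiner_apply, map_add, map_smul]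

theorem intertwiner_boldPhi_boldPhi (hq : q ≠ 0) (hs : s ≠ 0) (hs1 : ∀ m : ℤ, s ^ m = 1 → m = 0)
    (e e' : ℕ × ℤ) (P : VVPoly K μ (n + 1)) :
    intertwiner μ q s (Fin.last n) (e.1 + 1, e.2) (e'.1 + 1, e'.2)
        (boldPhi μ s (n + 1) (boldPhi μ s (n + 1) P)) =
      boldPhi μ s (n + 1) (boldPhi μ s (n + 1) (intertwiner μ q s 0 e e' P)) := by
  rw [intertwiner_apply, boldT_boldPhi_boldPhi hs hs1, intertwiner_apply, specValue_succ,
    specValue_succ, stepCoeff_mul_left hq]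
  simp only [map_add, map_smul]

theorem joinable_transp_affine (hs : s ≠ 0) (hs1 : ∀ m : ℤ, s ^ m = 1 → m = 0)
    (h : μ.card = n + 1) {C : Vertex K μ n} (hC : C.IsStandard q s) {i j : Fin n}
    (hij : i.val + 1 = j.val)
    (hi : Prec ((C.affine q).spec i.succ) ((C.affine q).spec i.castSucc)) :
    Joinable q s h ((C.affine q).transp i) (Label.transp i) C Label.affine := by
  have hA := hC.affine
  have hBs := (hA.arrow_of_prec hi).2
  have hmid : i.succ = j.castSucc := by simp [Fin.ext_iff]; omega
  have h1 : (C.affine q).spec i.castSucc = C.spec j.castSucc := by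
    rw [Vertex.spec_affine, rotSpec_castSucc, hmid]
  have h2 : (C.affine q).spec i.succ = C.spec j.succ := by
    rw [Vertex.spec_affine, hmid, rotSpec_castSucc]
  have hCj : Prec (C.spec j.succ) (C.spec j.castSucc) := by rwa [h1, h2] at hi
  have hD := hC.transp j
  have hB : (C.affine q).transp i = (C.transp j).affine q := by
    apply (hA.transp i).ext_spec hD.affine
    rw [hBs, Vertex.spec_affine, Vertex.spec_affine, (hC.arrow_of_prec hCj).2]
    ext1 x
    refine Fin.lastCases ?_ (fun x => ?_) x
    · rw [Function.comp_apply, Equiv.swap_apply_of_ne_of_ne, rotSpec_last, rotSpec_last,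
        Function.comp_apply, Equiv.swap_apply_of_ne_of_ne] <;> simp [Fin.ext_iff] <;> omega
    · rw [rotSpec_castSucc, Function.comp_apply, Function.comp_apply]
      have h3 : Equiv.swap i.castSucc i.succ x.castSucc = (Equiv.swap i j x).castSucc := by
        simp only [Equiv.swap_apply_def, hmid, Fin.castSucc_inj]; split_ifs <;> rfl
      have h4 : Equiv.swap j.castSucc j.succ x.succ = (Equiv.swap i j x).succ := by
        simp only [Equiv.swap_apply_def, ← hmid, Fin.succ_inj]; split_ifs <;> rfl
      rw [h3, h4, rotSpec_castSucc]
  obtain ⟨m, P, hP⟩ := hD.exists_reach h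
  refine ⟨m + 1, _, _, hB ▸ hP.affine, hP.transp_of_prec hC hCj, ?_⟩
  rw [pathStep_transp_of_prec hA hi, pathStep_affine, h1, h2, intertwiner_boldPhi hs hs1 hij]

/-- An arrow `s_{N-1}` into the target of `Ψ` exists only if the source of `Ψ` is itself the
target of an arrow `Ψ`, and both arrows come from an arrow `s_1` two steps before. -/
theorem joinable_transp_last_affine (hq : q ≠ 0) (hs : s ≠ 0) (hs1 : ∀ m : ℤ, s ^ m = 1 → m = 0)
    (h : μ.card = n + 1 + 1) {C : Vertex K μ (n + 1)} (hC : C.IsStandard q s)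
    (hi : Prec ((C.affine q).spec (Fin.last n).succ) ((C.affine q).spec (Fin.last n).castSucc)) :
    Joinable q s h ((C.affine q).transp (Fin.last n)) (Label.transp (Fin.last n)) C
      Label.affine := by
  have hA := hC.affine
  have hBs := (hA.arrow_of_prec hi).2
  have h0 : C.v (Fin.last (n + 1)) ≠ 0 := by
    have h1 : Prec ((C.spec 0).1 + 1, (C.spec 0).2) (C.spec (Fin.last (n + 1))) := by
      simpa only [Vertex.spec_affine, rotSpec_castSucc, Fin.succ_last, rotSpec_last] using hi
    have h2 : (C.spec (Fin.last (n + 1))).1 ≠ 0 := by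
      unfold Prec at h1
      omega
    exact h2
  obtain ⟨E, hE, rfl⟩ := hC.exists_affine h h0
  have h1 : ((E.affine q).affine q).spec (Fin.last n).castSucc =
      ((E.spec (Fin.castSucc 0)).1 + 1, (E.spec (Fin.castSucc 0)).2) := by
    rw [Vertex.spec_affine, rotSpec_castSucc, Fin.succ_last, Vertex.spec_affine, rotSpec_last]
    rfl
  have h2 : ((E.affine q).affine q).spec (Fin.last n).succ =
      ((E.spec (Fin.succ 0)).1 + 1, (E.spec (Fin.succ 0)).2) := by
    rw [Vertex.spec_affine, Fin.succ_last, rotSpec_last, Vertex.spec_affine, ← Fin.castSucc_zero,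
      rotSpec_castSucc]
  have hEp : Prec (E.spec (Fin.succ 0)) (E.spec (Fin.castSucc 0)) := by
    rw [h1, h2] at hi
    unfold Prec at hi ⊢
    simp only at hi
    omega
  have hD := hE.transp 0
  have hB : ((E.affine q).affine q).transp (Fin.last n) = ((E.transp 0).affine q).affine q := by
    apply (hA.transp _).ext_spec hD.affine.affine
    rw [hBs, Vertex.spec_affine, Vertex.spec_affine, Vertex.spec_affine, Vertex.spec_affine,
      (hE.arrow_of_prec hEp).2]
    exact rotSpec_rotSpec_swap E.spec
  obtain ⟨m, P, hP⟩ := hD.exists_reach h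
  refine ⟨m + 2, _, _, hB ▸ hP.affine.affine, (hP.transp_of_prec hE hEp).affine, ?_⟩
  rw [pathStep_transp_of_prec hA hi, pathStep_affine, h1, h2, intertwiner_boldPhi_boldPhi hq hs hs1]

theorem not_arrow_rootVertex (h : μ.card = n + 1) {B : Vertex K μ n} (hB : B.IsStandard q s)
    {a : Label n} : ¬ Arrow q B a (some (rootVertex s h)) := by
  intro ha
  cases a with
  | transp i =>
    obtain ⟨-, h1, -⟩ := hB.of_arrow_transp_target ha
    have h2 := root_no_descent h i
    have h3 : ∀ j, (rootVertex (K := K) s h).spec j = (0, content (rootTab μ h).1 j) := fun _ => rfl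
    rw [h3, h3] at h1
    unfold Prec at h1
    simp only at h1
    omega
  | affine =>
    have h1 : rootVertex s h = B.affine q := by
      generalize rootVertex s h = R at ha
      cases ha
      rfl
    have h2 := congrFun (congrArg Vertex.v h1) (Fin.last n)
    simp [rootVertex, Vertex.affine] at h2

/-- Two arrows with different labels and the same target are joinable. -/
theorem joinable_of_ne (hq : q ≠ 0) (hs : s ≠ 0)
    (hqs : ∀ a b : ℤ, q ^ a * s ^ b = 1 → a = 0 ∧ b = 0) (hs1 : ∀ m : ℤ, s ^ m = 1 → m = 0)
    (h : μ.card = n + 1) {A B C : Vertex K μ n} (hB : B.IsStandard q s) (hC : C.IsStandard q s)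
    {a b : Label n} (ha : Arrow q B a (some A)) (hb : Arrow q C b (some A)) (hab : a ≠ b) :
    Joinable q s h B a C b := by
  have hA := hB.of_arrow ha
  have key : ∀ {C : Vertex K μ n} {i : Fin n}, C.IsStandard q s → A = C.affine q →
      Prec (A.spec i.succ) (A.spec i.castSucc) →
      Joinable q s h (A.transp i) (Label.transp i) C Label.affine := by
    rintro C i hC rfl hi
    by_cases hin : i.val + 1 < n
    · exact joinable_transp_affine hs hs1 h hC (j := ⟨i.val + 1, hin⟩) rfl hi
    · obtain _ | n := n
      · exact i.elim0
      obtain rfl : i = Fin.last n := by ext; simp; omega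
      exact joinable_transp_last_affine hq hs hs1 h hC hi
  have key' : ∀ {i j : Fin n}, i < j → Prec (A.spec i.succ) (A.spec i.castSucc) →
      Prec (A.spec j.succ) (A.spec j.castSucc) →
      Joinable q s h (A.transp i) (Label.transp i) (A.transp j) (Label.transp j) := by
    intro i j hij hi hj
    by_cases h1 : i.val + 1 = j.val
    · exact joinable_transp_braid hq hs hqs hs1 h hA h1 hi hj
    · exact joinable_transp_comm hs hs1 h hA (by omega) hi hj
  cases a with
  | transp i =>
    obtain ⟨rfl, hi, -⟩ := hB.of_arrow_transp_target ha
    cases b with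
    | transp j =>
      obtain ⟨rfl, hj, -⟩ := hC.of_arrow_transp_target hb
      rcases lt_trichotomy i j with h1 | h1 | h1
      · exact key' h1 hi hj
      · exact absurd (congrArg _ h1) hab
      · exact (key' h1 hj hi).symm
    | affine =>
      have h1 : A = C.affine q := by cases hb; rfl
      exact key hC h1 hi
  | affine =>
    have h1 : A = B.affine q := by cases ha; rfl
    cases b with
    | transp j =>
      obtain ⟨rfl, hj, -⟩ := hC.of_arrow_transp_target hb
      exact (key hB h1 hj).symm
    | affine => exact absurd rfl hab

theorem eq_of_arrow {A B C : Vertex K μ n} (hB : B.IsStandard q s) (hC : C.IsStandard q s)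
    {a : Label n} (ha : Arrow q B a (some A)) (hb : Arrow q C a (some A)) : B = C := by
  cases a with
  | transp i =>
    rw [(hB.of_arrow_transp_target ha).1, (hC.of_arrow_transp_target hb).1]
  | affine =>
    have h1 : A = B.affine q := by cases ha; rfl
    have h2 : A = C.affine q := by cases hb; rfl
    apply hB.ext_spec hC
    apply rotSpec_injective
    rw [← Vertex.spec_affine (q := q), ← Vertex.spec_affine (q := q), ← h1, ← h2]

/-- All paths without fall to a vertex have the same length and give the same polynomial. -/
theorem Reach.unique (hq : q ≠ 0) (hs : s ≠ 0)
    (hqs : ∀ a b : ℤ, q ^ a * s ^ b = 1 → a = 0 ∧ b = 0) (hs1 : ∀ m : ℤ, s ^ m = 1 → m = 0)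
    {m m' : ℕ} {A : Vertex K μ n} {P P' : VVPoly K μ n} (hP : Reach q s h m A P)
    (hP' : Reach q s h m' A P') : m' = m ∧ P' = P := by
  induction m using Nat.strong_induction_on generalizing m' A P P' with
  | _ m ih =>
    cases hP with
    | root =>
      cases hP' with
      | root => exact ⟨rfl, rfl⟩
      | snoc hB ha => exact absurd ha (not_arrow_rootVertex h hB.isStandard)
    | @snoc k B _ P a hB ha =>
      cases hP' with
      | root => exact absurd ha (not_arrow_rootVertex h hB.isStandard)
      | @snoc k' C _ P' b hC hb =>
        by_cases hab : a = b
        · subst hab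
          obtain rfl := eq_of_arrow hB.isStandard hC.isStandard ha hb
          obtain ⟨rfl, rfl⟩ := ih k (by omega) hB hC
          exact ⟨rfl, rfl⟩
        · obtain ⟨l, Q, Q', h1, h2, h3⟩ :=
            joinable_of_ne hq hs hqs hs1 h hB.isStandard hC.isStandard ha hb hab
          obtain ⟨rfl, rfl⟩ := ih k (by omega) hB h1
          obtain ⟨rfl, rfl⟩ := ih l (by omega) h2 hC
          exact ⟨rfl, h3.symm⟩

end Confluence

/-! ### The basis -/

section LinearAlgebra
variable {K M ι J : Type*} [Field K] [AddCommGroup M] [Module K M]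

theorem linearIndependent_of_joint_eigenvectors (f : J → Module.End K M) {v : ι → M}
    (χ : ι → J → K) (hχ : Function.Injective χ) (hv : ∀ i, v i ≠ 0)
    (hf : ∀ i j, f j (v i) = χ i j • v i) : LinearIndependent K v := by
  classical
  rw [linearIndependent_iff']
  intro t
  induction t using Finset.induction_on with
  | empty => simp
  | insert a t ha ih =>
    intro c hc
    have h1 : ∀ i ∈ t, c i = 0 := by
      intro i hi
      have hia : χ i ≠ χ a := fun h => ha (hχ h ▸ hi)
      obtain ⟨j, hj⟩ := Function.ne_iff.1 hia
      -- this operator removes the term with index `a`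
      have h2 := congrArg (f j - χ a j • (1 : Module.End K M)) hc
      rw [Finset.sum_insert ha, map_add, map_sum, map_zero] at h2
      have h3 : ∀ i, (f j - χ a j • (1 : Module.End K M)) (c i • v i) =
          (c i * (χ i j - χ a j)) • v i := by
        intro i
        simp only [LinearMap.sub_apply, LinearMap.smul_apply, Module.End.one_apply, map_smul, hf]
        module
      simp only [h3, sub_self, mul_zero, zero_smul, zero_add] at h2
      exact (mul_eq_zero.1 (ih _ h2 i hi)).resolve_right (sub_ne_zero.2 hj)
    rw [Finset.sum_insert ha, Finset.sum_eq_zero fun i hi => by rw [h1 i hi, zero_smul],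
      add_zero, smul_eq_zero] at hc
    intro i hi
    rcases Finset.mem_insert.1 hi with rfl | hi
    · exact hc.resolve_right (hv _)
    · exact h1 i hi

/-- A linearly independent family that is compatible with the grading of a basis by finite sets of
the same index type spans: in each degree both families have the same finite size. -/
theorem top_le_span_of_graded (b : Module.Basis ι K M) (deg : ι → ℕ)
    (hfin : ∀ d, {x | deg x = d}.Finite) {v : ι → M} (hv : LinearIndependent K v)
    (hmem : ∀ x, v x ∈ Submodule.span K (b '' {y | deg y = deg x})) :
    ⊤ ≤ Submodule.span K (Set.range v) := by
  rw [← b.span_eq, Submodule.span_le]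
  rintro _ ⟨x, rfl⟩
  have := (hfin (deg x)).fintype
  let F := {y | deg y = deg x}
  have h1 : Submodule.span K (Set.range fun y : F => v y) ≤
      Submodule.span K (Set.range fun y : F => b y) := by
    rw [Submodule.span_le]
    rintro _ ⟨y, rfl⟩
    have h2 := hmem y
    rw [y.2, Set.image_eq_range] at h2
    exact h2
  have h3 := finrank_span_eq_card (hv.comp (Subtype.val : F → ι) Subtype.val_injective)
  have h4 := finrank_span_eq_card (b.linearIndependent.comp (Subtype.val : F → ι)
    Subtype.val_injective)
  have : FiniteDimensional K (Submodule.span K (Set.range fun y : F => b y)) :=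
    FiniteDimensional.span_of_finite K (Set.finite_range _)
  have h5 := Submodule.eq_of_le_of_finrank_eq h1 (h3.trans h4.symm)
  have h6 : b x ∈ Submodule.span K (Set.range fun y : F => b y) :=
    Submodule.subset_span ⟨⟨x, rfl⟩, rfl⟩
  rw [← h5] at h6
  refine Submodule.span_mono ?_ h6
  rintro _ ⟨y, rfl⟩
  exact ⟨y, rfl⟩

end LinearAlgebra

section Degree
open MvPolynomial
variable {K : Type*} [Field K] {q s : K} {μ : YoungDiagram} {n : ℕ} {h : μ.card = n + 1}

theorem weight_one_apply {σ : Type*} (m : σ →₀ ℕ) : Finsupp.weight 1 m = m.degree :=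
  (DFunLike.congr_fun Finsupp.degree_eq_weight_one m).symm

/-- A quotient of homogeneous polynomials that is a polynomial is homogeneous. -/
theorem isHomogeneous_of_mul_left {σ : Type*} {p f : MvPolynomial σ K} {d e : ℕ} (hp : p ≠ 0)
    (hpd : p.IsHomogeneous d) (hpf : (p * f).IsHomogeneous (d + e)) : f.IsHomogeneous e := by
  let := gradedAlgebra (σ := σ) (R := K)
  intro m hm
  by_contra h
  rw [weight_one_apply] at h
  apply hm
  have h1 : p * homogeneousComponent m.degree f = 0 := by
    have h2 := DirectSum.coe_decompose_mul_add_of_left_mem (homogeneousSubmodule σ K)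
      (b := f) (j := m.degree) ((mem_homogeneousSubmodule d p).2 hpd)
    rw [DirectSum.decompose_of_mem_ne _ ((mem_homogeneousSubmodule (d + e) _).2 hpf)
      (fun h3 => h (Nat.add_left_cancel h3).symm)] at h2
    rw [← decomposition.decompose'_apply]
    exact h2.symm
  have h3 := congrArg (coeff m) ((mul_eq_zero.1 h1).resolve_left hp)
  rwa [coeff_homogeneousComponent, if_pos rfl, coeff_zero] at h3

theorem isHomogeneous_sX {f : MvPolynomial (Fin (n + 1)) K} {d : ℕ} (hf : f.IsHomogeneous d)
    (i : Fin n) : (sX K i f).IsHomogeneous d := hf.rename_isHomogeneous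

theorem isHomogeneous_deltaX (s : K) {f : MvPolynomial (Fin (n + 1)) K} {d : ℕ}
    (hf : f.IsHomogeneous d) (i : Fin n) : (deltaX s i f).IsHomogeneous d := by
  refine isHomogeneous_of_mul_left (X_sub_X_ne_zero K i)
    ((isHomogeneous_X K i.castSucc).sub (isHomogeneous_X K i.succ)) ?_
  have h1 : (X i.castSucc - X i.succ) * deltaX s i f =
      C (1 - s) * (X i.succ * (f - sX K i f)) := by
    rw [deltaX_apply, ← divDiff_spec, ← smul_eq_C_mul, mul_smul_comm, mul_left_comm]
  rw [h1]
  exact ((isHomogeneous_X K i.succ).mul (hf.sub (isHomogeneous_sX hf i))).C_mul _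

/-- The vector valued polynomials that are homogeneous of degree `d`. -/
def homogVV (K : Type*) [Field K] (μ : YoungDiagram) (n d : ℕ) : Submodule K (VVPoly K μ n) :=
  Submodule.span K {x | ∃ f u, f.IsHomogeneous d ∧ f ⊗ₜ u = x}

theorem mapsTo_homogVV {d e : ℕ} (A : Module.End K (VVPoly K μ n))
    (hA : ∀ f u, f.IsHomogeneous d → A (f ⊗ₜ u) ∈ homogVV K μ n e) {P : VVPoly K μ n}
    (hP : P ∈ homogVV K μ n d) : A P ∈ homogVV K μ n e := by
  have h1 : homogVV K μ n d ≤ (homogVV K μ n e).comap A := by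
    rw [homogVV, Submodule.span_le]
    rintro _ ⟨f, u, hf, rfl⟩
    exact hA f u hf
  exact h1 hP

theorem tmul_mem_homogVV {f : MvPolynomial (Fin (n + 1)) K} {d : ℕ} (hf : f.IsHomogeneous d)
    (u : V K μ (n + 1)) : f ⊗ₜ u ∈ homogVV K μ n d :=
  Submodule.subset_span ⟨f, u, hf, rfl⟩

theorem boldT_mem_homogVV (s : K) {d : ℕ} {P : VVPoly K μ n} (hP : P ∈ homogVV K μ n d)
    (i : Fin n) : boldT μ s i P ∈ homogVV K μ n d := by
  refine mapsTo_homogVV _ (fun f u hf => ?_) hP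
  rw [boldT_tmul]
  exact add_mem (tmul_mem_homogVV (isHomogeneous_deltaX s hf i) _)
    (tmul_mem_homogVV (isHomogeneous_sX hf i) _)

theorem boldPhi_mem_homogVV (s : K) {d : ℕ} {P : VVPoly K μ n} (hP : P ∈ homogVV K μ n d) :
    boldPhi μ s n P ∈ homogVV K μ n (d + 1) := by
  have h1 : ∀ (L : List (Fin n)) (P : VVPoly K μ n), P ∈ homogVV K μ n d →
      rightProd (L.map (boldTinv μ s)) P ∈ homogVV K μ n d := by
    intro L
    induction L with
    | nil => exact fun _ hP => hP
    | cons i L ih =>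
      intro P hP
      have h2 : rightProd ((i :: L).map (boldTinv μ s)) P =
          rightProd (L.map (boldTinv μ s)) (boldTinv μ s i P) := by simp [rightProd]
      rw [h2]
      exact ih _ (Submodule.smul_mem _ _ (add_mem (boldT_mem_homogVV s hP i)
        (Submodule.smul_mem _ _ hP)))
  have h2 : boldPhi μ s n P = mulX K μ (Fin.last n)
      (rightProd ((List.finRange n).map (boldTinv μ s)) P) := by
    simp [boldPhi, rightProd, mulX]
  rw [h2]
  refine mapsTo_homogVV _ (fun f u hf => ?_) (h1 _ _ hP)
  rw [mulX_tmul]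
  exact tmul_mem_homogVV (add_comm d 1 ▸ (isHomogeneous_X K _).mul hf) _

theorem Reach.mem_homogVV {m : ℕ} {A : Vertex K μ n} {P : VVPoly K μ n}
    (hA : Reach q s h m A P) : P ∈ homogVV K μ n (∑ i, A.v i) := by
  have hv : ∀ A : Vertex K μ n, ∑ i, A.v i = ∑ i, (A.spec i).1 := fun _ => rfl
  induction hA with
  | root => exact tmul_mem_homogVV (by simpa [rootVertex] using isHomogeneous_one _ _) _
  | @snoc m A B P a hA ha ih =>
    have hstd := hA.isStandard
    cases a with
    | transp i =>
      obtain ⟨-, -, hspec⟩ := hstd.of_arrow_transp ha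
      rw [pathStep_transp hstd, hv, hspec]
      rw [hv, ← Equiv.sum_comp (Equiv.swap i.castSucc i.succ)] at ih
      exact add_mem (boldT_mem_homogVV s ih i) (Submodule.smul_mem _ _ ih)
    | affine =>
      cases ha
      rw [pathStep_affine, hv, Vertex.spec_affine, Fin.sum_univ_castSucc]
      simp only [rotSpec_castSucc, rotSpec_last]
      rw [hv, Fin.sum_univ_succ] at ih
      convert boldPhi_mem_homogVV s ih using 2
      ring

/-- The basis of `K[x_1, …, x_N] ⊗ V_μ` formed by the tensors of a monomial and a tableau. -/
def monomialTabBasis (K : Type*) [Field K] (μ : YoungDiagram) (n : ℕ) :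
    Module.Basis ((Fin (n + 1) → ℕ) × Tab μ (n + 1)) K (VVPoly K μ n) :=
  ((basisMonomials (Fin (n + 1)) K).tensorProduct Finsupp.basisSingleOne).reindex
    (Finsupp.equivFunOnFinite.prodCongr (Equiv.refl _))

theorem homogVV_le_span (d : ℕ) : homogVV K μ n d ≤
    Submodule.span K (monomialTabBasis K μ n '' {y | ∑ i, y.1 i = d}) := by
  rw [homogVV, Submodule.span_le]
  rintro _ ⟨f, u, hf, rfl⟩
  rw [← support_sum_monomial_coeff f, ← u.sum_single, Finsupp.sum, TensorProduct.sum_tmul]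
  refine sum_mem fun m hm => ?_
  rw [TensorProduct.tmul_sum]
  refine sum_mem fun T _ => ?_
  have h1 : monomial m (coeff m f) ⊗ₜ[K] Finsupp.single T (u T) =
      (coeff m f * u T) • monomialTabBasis K μ n (⇑m, T) := by
    rw [monomialTabBasis, Module.Basis.reindex_apply]
    have h2 : (Finsupp.equivFunOnFinite.prodCongr (Equiv.refl (Tab μ (n + 1)))).symm (⇑m, T) =
        (m, T) := by
      rw [Equiv.symm_apply_eq]; rfl
    rw [h2, Module.Basis.tensorProduct_apply, coe_basisMonomials, Finsupp.coe_basisSingleOne,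
      mul_comm, mul_smul, TensorProduct.smul_tmul', ← TensorProduct.tmul_smul]
    simp [smul_monomial]
  rw [h1]
  refine Submodule.smul_mem _ _ (Submodule.subset_span ⟨_, ?_, rfl⟩)
  have h2 := hf (mem_support_iff.1 hm)
  rw [weight_one_apply, Finsupp.degree_eq_sum] at h2
  exact h2

instance : Finite (Tab μ (n + 1)) := by
  unfold Tab Filling
  infer_instance

/-- In each degree there are finitely many pairs `(v, T)`. -/
theorem finite_sum_eq (d : ℕ) :
    {x : (Fin (n + 1) → ℕ) × Tab μ (n + 1) | ∑ i, x.1 i = d}.Finite := by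
  refine ((Set.finite_Iic (fun _ : Fin (n + 1) => d)).prod Set.finite_univ).subset ?_
  rintro ⟨v, T⟩ hx
  refine ⟨fun i => ?_, Set.mem_univ _⟩
  exact (Finset.single_le_sum (fun _ _ => Nat.zero_le _) (Finset.mem_univ i)).trans_eq hx

end Degree

end VVMacdonald
end

theorem mainTheorem1 {K : Type*} [Field K] (q s : K) (hq : q ≠ 0) (hs : s ≠ 0)
    (hqs : ∀ a b : ℤ, q ^ a * s ^ b = 1 → a = 0 ∧ b = 0)
    (n : ℕ) (μ : YoungDiagram) (hμ : μ.card = n + 1) :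
    -- simultaneous eigenfunctions, with eigenvalues the spectral vector of the end point
    (∀ (p : List (VVMacdonald.Label n)) (A : VVMacdonald.Vertex K μ n),
      VVMacdonald.IsPath q s hμ p (some A) →
        VVMacdonald.pathPoly q s hμ p ≠ 0 ∧
        ∀ i : Fin (n + 1), VVMacdonald.cherednik μ q s i (VVMacdonald.pathPoly q s hμ p) =
          A.zeta i • VVMacdonald.pathPoly q s hμ p) ∧
    -- dependence on the end point only, which may be labelled by its spectral vector
    (∀ (p p' : List (VVMacdonald.Label n)) (A : VVMacdonald.Vertex K μ n),
      VVMacdonald.IsPath q s hμ p (some A) → VVMacdonald.IsPath q s hμ p' (some A) →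
        VVMacdonald.pathPoly q s hμ p = VVMacdonald.pathPoly q s hμ p') ∧
    (∀ (p p' : List (VVMacdonald.Label n)) (A A' : VVMacdonald.Vertex K μ n),
      VVMacdonald.IsPath q s hμ p (some A) → VVMacdonald.IsPath q s hμ p' (some A') →
        A.zeta = A'.zeta → VVMacdonald.pathPoly q s hμ p = VVMacdonald.pathPoly q s hμ p') ∧
    -- each pair `(v, T)` labels exactly one vertex
    (∀ (v : Fin (n + 1) → ℕ) (T : VVMacdonald.Tab μ (n + 1)),
      ∃! A : VVMacdonald.Vertex K μ n,
        (∃ p, VVMacdonald.IsPath q s hμ p (some A)) ∧ A.v = v ∧ A.tab = T) ∧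
    -- the family `P_{v,T}` is a basis of simultaneous eigenfunctions
    (∃ B : Module.Basis ((Fin (n + 1) → ℕ) × VVMacdonald.Tab μ (n + 1)) K
        (VVMacdonald.VVPoly K μ n),
      (∀ (p : List (VVMacdonald.Label n)) (A : VVMacdonald.Vertex K μ n),
        VVMacdonald.IsPath q s hμ p (some A) →
          B (A.v, A.tab) = VVMacdonald.pathPoly q s hμ p) ∧
      (∀ (v : Fin (n + 1) → ℕ) (T : VVMacdonald.Tab μ (n + 1)),
        ∃ (p : List (VVMacdonald.Label n)) (A : VVMacdonald.Vertex K μ n),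
          VVMacdonald.IsPath q s hμ p (some A) ∧ A.v = v ∧ A.tab = T ∧
          ∀ i : Fin (n + 1),
            VVMacdonald.cherednik μ q s i (B (v, T)) = A.zeta i • B (v, T))) := by
  have hs1 : ∀ m : ℤ, s ^ m = 1 → m = 0 := fun m hm => (hqs 0 m (by simpa using hm)).2
  have heig : ∀ (p : List (VVMacdonald.Label n)) (A : VVMacdonald.Vertex K μ n),
      VVMacdonald.IsPath q s hμ p (some A) → VVMacdonald.pathPoly q s hμ p ≠ 0 ∧
        ∀ i : Fin (n + 1), VVMacdonald.cherednik μ q s i (VVMacdonald.pathPoly q s hμ p) =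
          A.zeta i • VVMacdonald.pathPoly q s hμ p := by
    intro p A hp
    have hR := hp.reach A rfl
    obtain ⟨h1, h2⟩ := hR.eigen hq hs hqs hs1
    refine ⟨h1, fun i => ?_⟩
    rw [h2, hR.isStandard.zeta_spec, VVMacdonald.specValue]
  have huniq : ∀ (p p' : List (VVMacdonald.Label n)) (A : VVMacdonald.Vertex K μ n),
      VVMacdonald.IsPath q s hμ p (some A) → VVMacdonald.IsPath q s hμ p' (some A) →
        VVMacdonald.pathPoly q s hμ p = VVMacdonald.pathPoly q s hμ p' :=
    fun p p' A hp hp' => ((hp'.reach A rfl).unique hq hs hqs hs1 (hp.reach A rfl)).2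
  have hzeta : ∀ (p p' : List (VVMacdonald.Label n)) (A A' : VVMacdonald.Vertex K μ n),
      VVMacdonald.IsPath q s hμ p (some A) → VVMacdonald.IsPath q s hμ p' (some A') →
        A.zeta = A'.zeta → A = A' := by
    intro p p' A A' hp hp' hz
    have hA := (hp.reach A rfl).isStandard
    have hA' := (hp'.reach A' rfl).isStandard
    exact hA.ext_spec hA' (funext fun i => hA.spec_eq_of_zeta hqs hq hs hA' (congrFun hz i))
  refine ⟨heig, huniq, ?_, fun v T => VVMacdonald.existsUnique_reachable v T, ?_⟩
  · intro p p' A A' hp hp' hz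
    obtain rfl := hzeta p p' A A' hp hp' hz
    exact huniq p p' A hp hp'
  -- one path to the vertex of each pair `(v, T)` is chosen
  choose A hA hv hT using VVMacdonald.exists_reachable (q := q) (s := s) (h := hμ)
  choose p hp using hA
  let P : (Fin (n + 1) → ℕ) × VVMacdonald.Tab μ (n + 1) → VVMacdonald.VVPoly K μ n :=
    fun x => VVMacdonald.pathPoly q s hμ (p x.1 x.2)
  have hlin : LinearIndependent K P := by
    refine VVMacdonald.linearIndependent_of_joint_eigenvectors (VVMacdonald.cherednik μ q s)
      (fun x => (A x.1 x.2).zeta) (fun x y hxy => ?_) (fun x => (heig _ _ (hp x.1 x.2)).1)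
      (fun x => (heig _ _ (hp x.1 x.2)).2)
    have h1 := hzeta _ _ _ _ (hp x.1 x.2) (hp y.1 y.2) hxy
    refine Prod.ext ?_ ?_
    · rw [← hv x.1 x.2, ← hv y.1 y.2, h1]
    · rw [← hT x.1 x.2, ← hT y.1 y.2, h1]
  have hspan : ⊤ ≤ Submodule.span K (Set.range P) := by
    refine VVMacdonald.top_le_span_of_graded (VVMacdonald.monomialTabBasis K μ n)
      (fun x => ∑ i, x.1 i) VVMacdonald.finite_sum_eq hlin fun x => ?_
    have h1 := ((hp x.1 x.2).reach _ rfl).mem_homogVV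
    rw [hv] at h1
    exact VVMacdonald.homogVV_le_span _ h1
  refine ⟨Module.Basis.mk hlin hspan, fun p' A' hp' => ?_, fun v T => ?_⟩
  · rw [Module.Basis.mk_apply]
    have hR := (hp'.reach A' rfl).isStandard
    have h1 : A A'.v A'.tab = A' :=
      ((hp _ _).reach _ rfl).isStandard.ext hR (hv _ _) (hT _ _)
    have h2 := hp A'.v A'.tab
    rw [h1] at h2
    exact huniq _ _ A' h2 hp'
  · refine ⟨p v T, A v T, hp v T, hv v T, hT v T, ?_⟩
    rw [Module.Basis.mk_apply]
    exact (heig _ _ (hp v T)).2
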